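/- Let $k$ be an algebraically closed field of characteristic zero and $\mathfrak g$ a finite-dimensional simple Lie algebra over $k$, with a Cartan subalgebra $\mathfrak h$, a basis $\alpha_1,\dots,\alpha_r$ of its root system (numbered as in Bourbaki; in particular $\alpha_1$ is the short simple root for $G_2$), simple coroots $H_1,\dots,H_r$, fundamental weights $\varpi_i$ defined by $\varpi_i(H_j)=\delta_{ij}$, and highest root $\theta$. Let $(\,,\,)_{\mathfrak g}$ be the multiple of the Killing form for which $(\theta,\theta)_{\mathfrak g}=2$. On the loop algebra $\mathfrak g\otimes_k k((z))$ consider the cocycle $$\psi_{\mathfrak g}(X\otimes f,\,Y\otimes g)=(X,Y)_{\mathfrak g}\,\mathrm{Res}(g\,df).$$ For a finite-dimensional vector space $V$ define $\psi_{\mathfrak{sl}(V)}$ by the same formula with the form $(X,Y)\mapsto \mathrm{Tr}(XY)$ on $\mathfrak{sl}(V)$. The Dynkin index of a representation $\rho:\mathfrak g\to\mathfrak{sl}(V)$ is the number $d_\rho\in k$ such that the pullback of $\psi_{\mathfrak{sl}(V)}$ along $\rho\otimes\mathrm{id}$ equals $d_\rho\,\psi_{\mathfrak g}$. Then for every finite-dimensional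 representation $\rho$ the Dynkin index $d_\rho$ exists, is unique, and is a non-negative integer. The minimal Dynkin index $d_{\mathfrak g}$, defined as the minimum of $d_\rho$ over all nontrivial ($\rho\neq 0$) finite-dimensional representations $\rho:\mathfrak g\to\mathfrak{sl}(V)$, is given by the following table: $$\begin{array}{c|c|c|c|c|c|c|c|c|c} \text{Type of }\mathfrak g&A_r,\ r\ge1&B_r,\ r\geq 3&C_r,\ r\ge 1&D_r,\ r\geq 4&E_6&E_7&E_8&F_4&G_2\\\hline d_{\mathfrak g}&1&2&1&2&6&12&60&6&2\\\hline \lambda&\varpi_1&\varpi_1&\varpi_1&\varpi_1&\varpi_6&\varpi_7&\varpi_8&\varpi_4&\varpi_1 \end{array}$$ For the weight $\lambda$ in the last row, a finite-dimensional irreducible representation of $\mathfrak g$ with highest weight $\lambda$ exists, and every such representation has Dynkin index $d_{\mathfrak g}$. Moreover, $d_\rho$ is divisible by $d_{\mathfrak g}$ for every finite-dimensional representation $\rho:\mathfrak g\to\mathfrak{sl}(V)$. -/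

import Mathlib

open scoped TensorProduct

universe u v w

-- The commutator bracket on an associative ring.
attribute [local instance 100] LieRing.ofAssociativeRing

-- The algebra structure of `k((z))` whose scalar multiplication is coefficientwise by definition.
attribute [local instance 2000] HahnSeries.instAlgebra

namespace DynkinIndex

noncomputable section

/-! ### Types of simple Lie algebras -/

/-- The types of simple Lie algebras. -/
inductive SimpleType : Type
  | A (r : ℕ) (hr : 1 ≤ r)
  | B (r : ℕ) (hr : 3 ≤ r)
  | C (r : ℕ) (hr : 1 ≤ r)
  | D (r : ℕ) (hr : 4 ≤ r)
  | E6
  | E7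
  | E8
  | F4
  | G2

namespace SimpleType

/-- The rank of a type. -/
def rank : SimpleType → ℕ
  | A r _ => r
  | B r _ => r
  | C r _ => r
  | D r _ => r
  | E6 => 6
  | E7 => 7
  | E8 => 8
  | F4 => 4
  | G2 => 2

/-- The Cartan matrix `(α_i(H_j))` in Bourbaki's numbering of the simple roots (rows and columns
are numbered from `0`). For `G₂` the first simple root is the short one, so that Bourbaki's matrix
is the transpose of Mathlib's. -/
def cartanMatrix : (T : SimpleType) → Matrix (Fin T.rank) (Fin T.rank) ℤ
  | A r _ => CartanMatrix.A r
  | B r _ => CartanMatrix.B r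
  | C r _ => CartanMatrix.C r
  | D r _ => CartanMatrix.D r
  | E6 => CartanMatrix.E₆
  | E7 => CartanMatrix.E₇
  | E8 => CartanMatrix.E₈
  | F4 => CartanMatrix.F₄
  | G2 => CartanMatrix.G₂.transpose

/-- The table of minimal Dynkin indices. -/
def minIndex : SimpleType → ℕ
  | A _ _ => 1
  | B _ _ => 2
  | C _ _ => 1
  | D _ _ => 2
  | E6 => 6
  | E7 => 12
  | E8 => 60
  | F4 => 6
  | G2 => 2

/-- The position (numbered from `0`) of the fundamental weight listed in the table: `ϖ₁` for the
classical types and `G₂`, and `ϖ₆`, `ϖ₇`, `ϖ₈`, `ϖ₄` for `E₆`, `E₇`, `E₈`, `F₄`. -/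
def node : (T : SimpleType) → Fin T.rank
  | A _ hr => ⟨0, hr⟩
  | B _ hr => ⟨0, Nat.lt_of_lt_of_le (by decide) hr⟩
  | C _ hr => ⟨0, hr⟩
  | D _ hr => ⟨0, Nat.lt_of_lt_of_le (by decide) hr⟩
  | E6 => ⟨5, by decide⟩
  | E7 => ⟨6, by decide⟩
  | E8 => ⟨7, by decide⟩
  | F4 => ⟨3, by decide⟩
  | G2 => ⟨0, by decide⟩

end SimpleType

/-! ### Loop algebras and their cocycles -/

section Loop

variable (k : Type u) [Field k]

/-- The bilinear form `(f, g) ↦ Res (g df)` on `k((z))`. -/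
def residueForm : LinearMap.BilinForm k (LaurentSeries k) :=
  LinearMap.mk₂ k (fun f g ↦ (g * LaurentSeries.hasseDeriv k 1 f).coeff (-1))
    (by intro f f' g; simp [mul_add])
    (by intro c f g; rw [map_smul, mul_smul_comm]; rfl)
    (by intro f g g'; simp [add_mul])
    (by intro c f g; rw [smul_mul_assoc]; rfl)

/-- The loop algebra `𝔤 ⊗ k((z))`. -/
abbrev LoopAlgebra (L : Type v) [LieRing L] [LieAlgebra k L] : Type (max u v) :=
  LaurentSeries k ⊗[k] L

variable {k}

/-- The cocycle `(X ⊗ f, Y ⊗ g) ↦ (X, Y) Res (g df)` on the loop algebra of `L` attached to a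
bilinear form `( , )` on `L`. -/
def loopCocycle {L : Type v} [LieRing L] [LieAlgebra k L] (B : LinearMap.BilinForm k L) :
    LinearMap.BilinForm k (LoopAlgebra k L) :=
  LinearMap.BilinForm.tmul (residueForm k) B

theorem loopCocycle_tmul {L : Type v} [LieRing L] [LieAlgebra k L] (B : LinearMap.BilinForm k L)
    (f g : LaurentSeries k) (X Y : L) :
    loopCocycle B (f ⊗ₜ[k] X) (g ⊗ₜ[k] Y) =
      B X Y * (g * LaurentSeries.hasseDeriv k 1 f).coeff (-1) :=
  rfl

/-- The morphism of loop algebras induced by a morphism of Lie algebras. -/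
def loopMap {L : Type v} [LieRing L] [LieAlgebra k L] {L' : Type w} [LieRing L'] [LieAlgebra k L']
    (φ : L →ₗ⁅k⁆ L') : LoopAlgebra k L →ₗ⁅k⁆ LoopAlgebra k L' :=
  LieAlgebra.ExtendScalars.map (AlgHom.id k (LaurentSeries k)) φ

end Loop

/-! ### The special linear Lie algebra of a vector space -/

section SpecialLinear

variable (k : Type u) [Field k] (V : Type w) [AddCommGroup V] [Module k V]

/-- The Lie algebra `𝔰𝔩(V)` of endomorphisms of trace zero. -/
def sl : LieSubalgebra k (Module.End k V) where
  toSubmodule := LinearMap.ker (LinearMap.trace k V)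
  lie_mem' := by
    intro x y _ _
    simp

/-- The normalized invariant form `(X, Y) ↦ Tr (X Y)` of `𝔰𝔩(V)`. -/
def slForm : LinearMap.BilinForm k (sl k V) :=
  LinearMap.mk₂ k (fun X Y ↦ LinearMap.trace k V ((X : Module.End k V) * (Y : Module.End k V)))
    (by intro X X' Y; simp [add_mul])
    (by intro c X Y; simp)
    (by intro X Y Y'; simp [mul_add])
    (by intro c X Y; simp)

end SpecialLinear

/-! ### Simple Lie algebras -/

section Simple

variable {k : Type u} [Field k] [IsAlgClosed k] [CharZero k]
  {L : Type v} [LieRing L] [LieAlgebra k L] [FiniteDimensional k L] [LieAlgebra.IsSimple k L]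
  {H : LieSubalgebra k L} [H.IsCartanSubalgebra]

/-- `θ` is the highest root with respect to the base `b`: for every root `α`, the difference
`θ - α` is a sum of simple roots. -/
def IsHighestRoot (b : (LieAlgebra.IsKilling.rootSystem H).Base) (θ : H.root) : Prop :=
  ∀ α : H.root, (LieAlgebra.IsKilling.rootSystem H).root θ -
    (LieAlgebra.IsKilling.rootSystem H).root α ∈
      AddSubmonoid.closure ((LieAlgebra.IsKilling.rootSystem H).root '' b.support)

/-- The Cartan-Killing form rescaled in such a way that `(θ, θ) = 2`. Here
`t = (cartanEquivDual H).symm θ` is the element of `H` that represents `θ` for the Killing form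
`κ`, so that `θ(t)` is the square length of `θ` for the form on the dual of `H` induced by `κ`;
the multiple `c κ` induces `c⁻¹` times that form. -/
def normalizedForm (θ : H.root) : LinearMap.BilinForm k L :=
  (2⁻¹ * θ.1 ((LieAlgebra.IsKilling.cartanEquivDual H).symm θ.1.toLinear)) • killingForm k L

/-- The coroot of `θ` represents `θ` for the normalized form, and the square length `(θ, θ)` of
`θ`, which is therefore the value of the normalized form at this coroot, is `2`. -/
theorem normalizedForm_spec (θ : H.root) :
    (∀ h : H, normalizedForm θ (LieAlgebra.IsKilling.coroot θ.1 : L) (h : L) = θ.1 h) ∧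
    normalizedForm θ (LieAlgebra.IsKilling.coroot θ.1 : L)
      (LieAlgebra.IsKilling.coroot θ.1 : L) = 2 := by
  have hθ : θ.1.IsNonZero := by
    obtain ⟨α, hα⟩ := θ
    simpa using hα
  have h0 := LieAlgebra.IsKilling.root_apply_cartanEquivDual_symm_ne_zero hθ
  have h1 : ∀ h : H, normalizedForm θ (LieAlgebra.IsKilling.coroot θ.1 : L) (h : L) = θ.1 h := by
    intro h
    have h2 := LieAlgebra.IsKilling.traceForm_coroot θ.1 h
    have h3 : killingForm k L (LieAlgebra.IsKilling.coroot θ.1 : L) (h : L) =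
        LieModule.traceForm k H L (LieAlgebra.IsKilling.coroot θ.1) h := rfl
    rw [normalizedForm, LinearMap.smul_apply, LinearMap.smul_apply, h3, h2]
    simp only [smul_eq_mul, nsmul_eq_mul, Nat.cast_ofNat]
    field_simp
  refine ⟨h1, ?_⟩
  rw [h1, LieAlgebra.IsKilling.root_apply_coroot hθ]

/-- `d` is the Dynkin index of `ρ : 𝔤 → 𝔰𝔩(V)`: the cocycle of the central extension of the loop
algebra of `𝔤` pulled back from that of `𝔰𝔩(V)` is `d` times the cocycle of `𝔤`. -/
def HasDynkinIndex (θ : H.root) {V : Type w} [AddCommGroup V] [Module k V]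
    (ρ : L →ₗ⁅k⁆ sl k V) (d : k) : Prop :=
  ∀ x y : LoopAlgebra k L,
    loopCocycle (slForm k V) (loopMap ρ x) (loopMap ρ y) = d * loopCocycle (normalizedForm θ) x y

/-- `m` is the minimal Dynkin index: the least Dynkin index of a nontrivial finite dimensional
representation. -/
def IsMinimalDynkinIndex (θ : H.root) (m : ℕ) : Prop :=
  IsLeast {d : ℕ | ∃ (V : Type u) (_ : AddCommGroup V) (_ : Module k V)
    (_ : FiniteDimensional k V) (ρ : L →ₗ⁅k⁆ sl k V), ρ ≠ 0 ∧ HasDynkinIndex θ ρ (d : k)} m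

/-- The fundamental weight `ϖ_i`: the basis `(ϖ_i)` of the dual of `H` is dual to the basis of `H`
formed by the simple coroots. -/
def fundamentalWeight (b : (LieAlgebra.IsKilling.rootSystem H).Base) (i : b.support) :
    Module.Dual k H :=
  b.toCoweightBasis.coord i

/-- `ρ` is the irreducible representation with highest weight `lam`: it has exactly two invariant
subspaces, and there is a nonzero vector of weight `lam` that is killed by the root spaces of all
positive roots. -/
def IsIrreducibleWithHighestWeight (b : (LieAlgebra.IsKilling.rootSystem H).Base)
    {V : Type w} [AddCommGroup V] [Module k V] (ρ : L →ₗ⁅k⁆ sl k V) (lam : Module.Dual k H) :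
    Prop :=
  (∀ W : Submodule k V, (∀ x : L, ∀ w ∈ W, (ρ x : Module.End k V) w ∈ W) → W = ⊥ ∨ W = ⊤) ∧
  ∃ v : V, v ≠ 0 ∧ (∀ h : H, (ρ (h : L) : Module.End k V) v = lam h • v) ∧
    ∀ α : H.root, b.IsPos α → ∀ x ∈ LieAlgebra.rootSpace H α.1,
      (ρ x : Module.End k V) v = 0

end Simple

end

end DynkinIndex

namespace DynkinIndex

/-! ### Divisibility of invariant functionals by group orbits -/

section Orbits

open Finset Function

variable {X κ : Type*} (I : (X → ℤ) →+ ℤ)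

/-! Record every weight of a representation by its integer values at the simple coroots, and let
I(F) = ∑ m(χ) F(χ) be the sum of an integer function over the weights with multiplicity
(`weightFunctional`). The operators exp(e) exp(-f) exp(e) carry weight spaces to reflected weight
spaces, so I is invariant under the simple reflections. By Schur's lemma the trace form is a
multiple of the normalized form (`exists_traceForm_eq_mul`), and since Res(z⁻¹ dz) = 1 the factor d
is the Dynkin index. The highest root is long, so the coroot of a long simple root ℓ also has
normalized square 2, whence 2d = I(v_ℓ²). This is a sum of squares; it is even because s_ℓ negates
v_ℓ, and it vanishes for the long node only if the whole trace form does, in which case all weights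
are zero and the representation is trivial. So d is a natural number, nonzero if ρ ≠ 0
(`exists_nat_hasDynkinIndex_iff`).

Divisibility (`minIndex_dvd`) uses only the invariance of I, through sizes of orbits. For 2 and 4,
take commuting reflections in orthogonal roots: modulo 4 the squares count the weights with odd
value at one coroot, and such a weight is forced to have odd values at further coroots of the
system, so it lies in a large orbit of sign changes. For 3, orthogonal subsystems A₂ and their
rotations of order three play the same role. For 5 and E₈, the sixth power of a Coxeter element has
order five and no nonzero fixed vector, and the invariant quadratic form sums to 8d. Subdiagrams D₄,
B₃, E₆, E₇ carry these factors to the larger diagrams. Divisibility gives the lower bound for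
nontrivial representations.

The bound is attained because the listed weight is quasi-minuscule: in a module generated by a
highest weight vector with that weight, the weights are its Weyl orbit, with multiplicity one, and
possibly zero (`weightFunctional_of_isQuasiMinuscule`). Thus I(v_ℓ²) is a finite sum over an
explicit orbit.

Existence of the module does not need Serre's presentation. Operators satisfying the Chevalley
relations define a homomorphism from the Lie algebra, because the subalgebra they generate together
with the Chevalley generators inside a product projects isomorphically onto the first factor
(`exists_lieHom_of_isChevalley`). Such operators are written down on the orbit in the minuscule
cases, obtained by folding for B, F₄, G₂, and given by the adjoint representation for E₈. -/

theorem apply_comp_iterate {c : X → X} (hc : ∀ F : X → ℤ, I (F ∘ c) = I F) (t : ℕ)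
    (F : X → ℤ) : I (F ∘ c^[t]) = I F := by
  induction t with
  | zero => rfl
  | succ t ih => rw [iterate_succ, ← comp_assoc, hc, ih]

/-- If every orbit of `c` on the support of `F` meets `D` in one point of `p`, then `I F` is `p`
times the value at the restriction of `F` to `D`. -/
theorem apply_eq_mul_of_domain {c : X → X} (hc : ∀ F : X → ℤ, I (F ∘ c) = I F) {p : ℕ}
    {D : X → Prop} [DecidablePred D] {F : X → ℤ} (hF : ∀ v, F (c v) = F v)
    (hD : ∀ v, F v ≠ 0 → ∑ t ∈ range p, (if D (c^[t] v) then (1 : ℤ) else 0) = 1) :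
    I F = p * I (fun v ↦ if D v then F v else 0) := by
  set G : X → ℤ := fun v ↦ if D v then F v else 0 with hG
  have hFt : ∀ t v, F (c^[t] v) = F v := by
    intro t
    induction t with
    | zero => simp
    | succ t ih => intro v; rw [iterate_succ_apply, ih, hF]
  have h1 : F = ∑ t ∈ range p, G ∘ c^[t] := by
    funext v
    rw [Finset.sum_apply]
    have h2 : ∀ t, (G ∘ c^[t]) v = (if D (c^[t] v) then (1 : ℤ) else 0) * F v := by
      intro t
      simp only [hG, comp_apply, hFt]
      split_ifs <;> simp
    simp only [h2, ← Finset.sum_mul]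
    by_cases hv : F v = 0
    · simp [hv]
    · rw [hD v hv, one_mul]
  conv_lhs => rw [h1]
  rw [map_sum, Finset.sum_congr rfl (fun t _ ↦ apply_comp_iterate I hc t G)]
  simp

variable {c : κ → X → X} {p : ℕ} {D nz : κ → X → Prop}
  [∀ j, DecidablePred (D j)]

/-- The maps need not commute: it is enough that each domain is stable under the other maps.
Restricting `F` to the domain of one map yields a factor p and leaves a function still invariant
under the remaining maps, so the indices can be removed one at a time. -/
theorem pow_card_dvd_apply (hc : ∀ j, ∀ F : X → ℤ, I (F ∘ c j) = I F)
    (hD : ∀ j v, nz j v → ∑ t ∈ range p, (if D j ((c j)^[t] v) then (1 : ℤ) else 0) = 1)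
    (hDc : ∀ i j, i ≠ j → ∀ v, D i (c j v) ↔ D i v) (J : Finset κ) :
    ∀ F : X → ℤ, (∀ j ∈ J, ∀ v, F (c j v) = F v) → (∀ j ∈ J, ∀ v, F v ≠ 0 → nz j v) →
      (p : ℤ) ^ #J ∣ I F := by
  classical
  induction J using Finset.induction_on with
  | empty => simp
  | insert a J ha ih =>
    intro F hF hnz
    rw [apply_eq_mul_of_domain I (hc a) (p := p) (D := D a) (hF a (mem_insert_self a J))
      (fun v hv ↦ hD a v (hnz a (mem_insert_self a J) v hv)), card_insert_of_notMem ha, pow_succ']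
    refine mul_dvd_mul_left _ (ih _ ?_ ?_)
    · intro j hj v
      have : a ≠ j := fun h ↦ ha (h ▸ hj)
      simp only [hDc a j this, hF j (mem_insert_of_mem hj)]
    · intro j hj v hv
      refine hnz j (mem_insert_of_mem hj) v fun h0 ↦ hv ?_
      simp [h0]

/-- Divisibility of the value at the indicator of `P`, if every point of `P` is moved by at least
`t` of the maps `c j`. -/
theorem pow_dvd_apply_indicator [Fintype κ] (hc : ∀ j, ∀ F : X → ℤ, I (F ∘ c j) = I F)
    (hD : ∀ j v, nz j v → ∑ t ∈ range p, (if D j ((c j)^[t] v) then (1 : ℤ) else 0) = 1)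
    (hDc : ∀ i j, i ≠ j → ∀ v, D i (c j v) ↔ D i v) {q : κ → X → Prop}
    [∀ j, DecidablePred (q j)]
    (hq : ∀ j v, q j v → nz j v) (hqc : ∀ i j v, q i (c j v) ↔ q i v)
    {P : X → Prop} [DecidablePred P] (hP : ∀ j v, P (c j v) ↔ P v) {t : ℕ}
    (ht : ∀ v, P v → t ≤ #{j | q j v}) :
    (p : ℤ) ^ t ∣ I (fun v ↦ if P v then 1 else 0) := by
  classical
  set S : X → Finset κ := fun v ↦ ({j | q j v} : Finset κ) with hS
  have hSc : ∀ j v, S (c j v) = S v := by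
    intro j v
    simp only [hS, hqc]
  -- The indicator is cut according to the exact set of maps that are active at the point; this set
  -- is invariant, so every piece falls under the previous lemma.
  have h1 : (fun v ↦ if P v then (1 : ℤ) else 0) =
      ∑ J : Finset κ, fun v ↦ if P v ∧ S v = J then (1 : ℤ) else 0 := by
    funext v
    rw [Finset.sum_apply]
    by_cases hv : P v <;> simp [hv]
  rw [h1, map_sum]
  refine Finset.dvd_sum fun J _ ↦ ?_
  by_cases hJ : t ≤ #J
  · refine (pow_dvd_pow _ hJ).trans (pow_card_dvd_apply I hc hD hDc J _ ?_ ?_)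
    · intro j _ v
      simp only [hP, hSc]
    · intro j hj v hv
      have hv' : P v ∧ S v = J := by
        by_contra h
        simp [h] at hv
      rw [← hv'.2] at hj
      exact hq j v (by simpa [hS] using hj)
  · have : (fun v ↦ if P v ∧ S v = J then (1 : ℤ) else 0) = 0 := by
      funext v
      have : ¬ (P v ∧ S v = J) := by
        rintro ⟨hv, rfl⟩
        exact hJ (ht v hv)
      simp [this]
    rw [this, map_zero]
    exact dvd_zero _

open Classical in
/-- A transformation of prime order `p` without fixed points on the support of `F`. -/
theorem prime_dvd_apply [Countable X] {c : X → X} (hc : ∀ F : X → ℤ, I (F ∘ c) = I F) {p : ℕ}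
    (hp : p.Prime) (hcp : ∀ v, c^[p] v = v) {F : X → ℤ} (hF : ∀ v, F (c v) = F v)
    (hfix : ∀ v, F v ≠ 0 → c v ≠ v) : (p : ℤ) ∣ I F := by
  -- The injection into ℕ selects one point of each orbit, the one where it is least. On the support
  -- the minimal period is exactly p, so this point occurs once among the first p iterates.
  obtain ⟨φ, hφ⟩ := exists_injective_nat X
  have hper : ∀ v, F v ≠ 0 → minimalPeriod c v = p := by
    intro v hv
    have h1 : minimalPeriod c v ∣ p := IsPeriodicPt.minimalPeriod_dvd (hcp v)
    rcases (Nat.dvd_prime hp).1 h1 with h | h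
    · exact absurd (minimalPeriod_eq_one_iff_isFixedPt.1 h) (hfix v hv)
    · exact h
  rw [apply_eq_mul_of_domain I hc (p := p) (D := fun v ↦ ∀ s, φ v ≤ φ (c^[s] v)) hF ?_]
  · exact dvd_mul_right _ _
  intro v hv
  obtain ⟨t₀, ht₀, hmin⟩ := Finset.exists_min_image (range p) (fun t ↦ φ (c^[t] v))
    ⟨0, mem_range.2 hp.pos⟩
  have hmod : ∀ s, c^[s] v = c^[s % p] v := by
    intro s
    rw [← hper v hv, iterate_mod_minimalPeriod_eq]
  have key : ∀ t ∈ range p, (∀ s, φ (c^[t] v) ≤ φ (c^[s] (c^[t] v))) ↔ t = t₀ := by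
    intro t ht
    constructor
    · intro h
      obtain ⟨s, hs⟩ : ∃ s, c^[s] (c^[t] v) = c^[t₀] v := by
        refine ⟨t₀ + (p - t), ?_⟩
        rw [← iterate_add_apply, add_assoc, Nat.sub_add_cancel (mem_range.1 ht).le,
          iterate_add_apply, hcp]
      have h2 : φ (c^[t] v) = φ (c^[t₀] v) := le_antisymm (hs ▸ h s) (hmin t ht)
      refine iterate_injOn_Iio_minimalPeriod (f := c) (x := v) ?_ ?_ (hφ h2)
      · rw [hper v hv]; exact mem_range.1 ht
      · rw [hper v hv]; exact mem_range.1 ht₀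
    · rintro rfl s
      rw [← iterate_add_apply, hmod (s + t)]
      exact hmin _ (mem_range.2 (Nat.mod_lt _ hp.pos))
  rw [Finset.sum_congr rfl (fun t ht ↦ by rw [if_congr (key t ht) rfl rfl])]
  simp [mem_range.1 ht₀]

end Orbits

/-! ### Functionals invariant under the Weyl group -/

section Invariant

open Finset Function

variable {ι : Type*}

/-- The action of a simple reflection on a weight given by its values at the simple coroots. -/
def simpleReflection (A : Matrix ι ι ℤ) (i : ι) (v : ι → ℤ) : ι → ℤ := fun j ↦ v j - v i * A i j

/-- Invariance of a functional under the simple reflections. -/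
def IsWeylInvariant (A : Matrix ι ι ℤ) (I : ((ι → ℤ) → ℤ) →+ ℤ) : Prop :=
  ∀ (i : ι) (F : (ι → ℤ) → ℤ), I (F ∘ simpleReflection A i) = I F

variable {A : Matrix ι ι ℤ} {I : ((ι → ℤ) → ℤ) →+ ℤ}

theorem simpleReflection_simpleReflection {i : ι} (hA : A i i = 2) (v : ι → ℤ) :
    simpleReflection A i (simpleReflection A i v) = v := by
  funext j
  simp only [simpleReflection, hA]
  ring

theorem apply_int_mul (I : ((ι → ℤ) → ℤ) →+ ℤ) (a : ℤ) (F : (ι → ℤ) → ℤ) :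
    I (fun v ↦ a * F v) = a * I F := by
  have : (fun v ↦ a * F v) = a • F := by funext v; simp
  rw [this, map_zsmul, smul_eq_mul]

theorem apply_add' (I : ((ι → ℤ) → ℤ) →+ ℤ) (F G : (ι → ℤ) → ℤ) :
    I (fun v ↦ F v + G v) = I F + I G := map_add I F G

/-- The reflection s_i sends v_i v_j to -v_i v_j + A_ij v_i², and both have the same value under
`I`. All quadratic moments are thereby reduced to the squares of coordinates. -/
theorem IsWeylInvariant.two_mul_apply_mul (hI : IsWeylInvariant A I) {i : ι} (hA : A i i = 2)
    (j : ι) : 2 * I (fun v ↦ v i * v j) = A i j * I (fun v ↦ v i ^ 2) := by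
  have h := hI i (fun v ↦ v i * v j)
  have h2 : (fun v : ι → ℤ ↦ v i * v j) ∘ simpleReflection A i =
      fun v ↦ (-1) * (v i * v j) + A i j * v i ^ 2 := by
    funext v
    simp only [comp_apply, simpleReflection, hA]
    ring
  rw [h2, apply_add', apply_int_mul, apply_int_mul] at h
  linarith

theorem IsWeylInvariant.mul_apply_sq (hI : IsWeylInvariant A I) (hA : ∀ i, A i i = 2) (i j : ι) :
    A i j * I (fun v ↦ v i ^ 2) = A j i * I (fun v ↦ v j ^ 2) := by
  rw [← hI.two_mul_apply_mul (hA i), ← hI.two_mul_apply_mul (hA j)]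
  simp only [mul_comm]

theorem IsWeylInvariant.apply_sq_eq (hI : IsWeylInvariant A I) (hA : ∀ i, A i i = 2) {i j : ι}
    (h : A i j = -1) (h' : A j i = -1) : I (fun v ↦ v i ^ 2) = I (fun v ↦ v j ^ 2) := by
  have := hI.mul_apply_sq hA i j
  rw [h, h'] at this
  linarith

/-- The functional of a subdiagram. -/
def restrictFunctional {κ : Type*} (f : κ → ι) (I : ((ι → ℤ) → ℤ) →+ ℤ) :
    ((κ → ℤ) → ℤ) →+ ℤ where
  toFun F := I (fun v ↦ F (v ∘ f))
  map_zero' := I.map_zero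
  map_add' F G := I.map_add (fun v ↦ F (v ∘ f)) (fun v ↦ G (v ∘ f))

/-- Forgetting the coordinates outside a subdiagram commutes with the simple reflections of its
nodes; this is restriction of weights to a smaller algebra. -/
theorem IsWeylInvariant.restrict {κ : Type*} {B : Matrix κ κ ℤ} (hI : IsWeylInvariant A I)
    {f : κ → ι} (hf : ∀ i j, A (f i) (f j) = B i j) :
    IsWeylInvariant B (restrictFunctional f I) := by
  intro i F
  have := hI (f i) (fun v ↦ F (v ∘ f))
  refine Eq.trans ?_ this
  change I _ = I _
  congr 1
  funext v
  simp only [comp_apply]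
  congr 1
  funext j
  simp [simpleReflection, hf]

variable [Fintype ι] [DecidableEq ι]

/-- The action of a simple reflection on the coefficients of a combination of simple coroots. -/
def coreflection (A : Matrix ι ι ℤ) (i : ι) (a : ι → ℤ) : ι → ℤ :=
  fun j ↦ if j = i then a i - A i ⬝ᵥ a else a j

theorem coreflection_dotProduct (i : ι) (a v : ι → ℤ) :
    coreflection A i a ⬝ᵥ v = a ⬝ᵥ simpleReflection A i v := by
  have h1 : coreflection A i a = a - Pi.single i (A i ⬝ᵥ a) := by
    funext j
    by_cases h : j = i
    · subst h; simp [coreflection]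
    · simp [coreflection, h]
  have h2 : simpleReflection A i v = v - v i • A i := by
    funext j; simp [simpleReflection]
  rw [h1, h2, sub_dotProduct, dotProduct_sub, dotProduct_smul, single_dotProduct,
    dotProduct_comm a (A i), smul_eq_mul, mul_comm]

/-- The pairs formed by the coefficients `a` of a coroot and the coordinates `r` of its root, for
the roots in the orbit of the simple root `j`. -/
inductive IsRootPair (A : Matrix ι ι ℤ) (j : ι) : (ι → ℤ) → (ι → ℤ) → Prop
  | simple : IsRootPair A j (Pi.single j 1) (A j)
  | reflect (i : ι) {a r : ι → ℤ} (h : IsRootPair A j a r) :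
      IsRootPair A j (coreflection A i a) (simpleReflection A i r)

/-- The reflection in a root. -/
def rootReflection (a r : ι → ℤ) (v : ι → ℤ) : ι → ℤ := v - (a ⬝ᵥ v) • r

theorem dotProduct_rootReflection (a r b v : ι → ℤ) :
    b ⬝ᵥ rootReflection a r v = b ⬝ᵥ v - (a ⬝ᵥ v) * (b ⬝ᵥ r) := by
  rw [rootReflection, dotProduct_sub, dotProduct_smul, smul_eq_mul]

/-- The reflection in s_i(α) is s_i s_α s_i, so invariance spreads from simple reflections to all
reflections in the orbit. -/
theorem IsWeylInvariant.apply_comp_rootReflection (hI : IsWeylInvariant A I)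
    (hA : ∀ i, A i i = 2) {j : ι} {a r : ι → ℤ} (h : IsRootPair A j a r) (F : (ι → ℤ) → ℤ) :
    I (F ∘ rootReflection a r) = I F := by
  induction h generalizing F with
  | simple =>
    have : rootReflection (Pi.single j 1) (A j) = simpleReflection A j := by
      funext v k
      simp [rootReflection, simpleReflection]
    rw [this, hI]
  | reflect i h ih =>
    rename_i a r
    have h1 : rootReflection (coreflection A i a) (simpleReflection A i r) =
        simpleReflection A i ∘ rootReflection a r ∘ simpleReflection A i := by
      funext v k
      have h2 := congrFun (simpleReflection_simpleReflection (hA i) v) k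
      simp only [rootReflection, comp_apply, coreflection_dotProduct, Pi.sub_apply, Pi.smul_apply,
        smul_eq_mul]
      conv_lhs => rw [← h2]
      simp only [simpleReflection, Pi.sub_apply, Pi.smul_apply, smul_eq_mul]
      ring
    rw [h1, ← comp_assoc, ← comp_assoc, hI, ih, hI]

theorem IsWeylInvariant.apply_coroot (hI : IsWeylInvariant A I) {j : ι} {a r : ι → ℤ}
    (h : IsRootPair A j a r) (F : ℤ → ℤ) : I (fun v ↦ F (a ⬝ᵥ v)) = I (fun v ↦ F (v j)) := by
  induction h with
  | simple => simp
  | reflect i h ih =>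
    rw [← ih]
    simp only [coreflection_dotProduct]
    exact hI i (fun v ↦ F (_ ⬝ᵥ v))

end Invariant

/-! ### Divisibility by powers of 2 and by 3 from orthogonal subsystems -/

section Divisibility

open Finset Function

variable {ι κ : Type*} [Fintype ι] [DecidableEq ι] [Fintype κ] [DecidableEq κ]
  {A : Matrix ι ι ℤ} {I : ((ι → ℤ) → ℤ) →+ ℤ}

/-- Divisibility of the index by powers of `2`, from a system of orthogonal roots. -/
theorem IsWeylInvariant.two_pow_dvd_of_orthogonal (hI : IsWeylInvariant A I)
    (hA : ∀ i, A i i = 2) {a r : κ → ι → ℤ} (h : ∀ k, ∃ j, IsRootPair A j (a k) (r k))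
    (har : ∀ k l, a k ⬝ᵥ r l = if k = l then 2 else 0) (k₀ : κ) {t : ℕ} (ht : t ≤ 2)
    (hpar : ∀ v : ι → ℤ, Odd (a k₀ ⬝ᵥ v) → t + 1 ≤ #{k | Odd (a k ⬝ᵥ v)}) {d : ℤ}
    (hd : I (fun v ↦ (a k₀ ⬝ᵥ v) ^ 2) = 2 * d) : 2 ^ t ∣ d := by
  have hinv : ∀ k, ∀ F : (ι → ℤ) → ℤ, I (F ∘ rootReflection (a k) (r k)) = I F := fun k F ↦ by
    obtain ⟨j, hj⟩ := h k
    exact hI.apply_comp_rootReflection hA hj F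
  have hact : ∀ k l v, a k ⬝ᵥ rootReflection (a l) (r l) v =
      if k = l then - (a k ⬝ᵥ v) else a k ⬝ᵥ v := by
    intro k l v
    rw [dotProduct_rootReflection, har]
    split_ifs with hkl
    · subst hkl; ring
    · ring
  have hself : ∀ k v, a k ⬝ᵥ rootReflection (a k) (r k) v = - (a k ⬝ᵥ v) := by
    intro k v; rw [hact, if_pos rfl]
  have hdom : ∀ k v, a k ⬝ᵥ v ≠ 0 → ∑ s ∈ range 2,
      (if 0 < a k ⬝ᵥ ((rootReflection (a k) (r k))^[s] v) then (1 : ℤ) else 0) = 1 := by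
    intro k v hv
    have h0 : (rootReflection (a k) (r k))^[0] v = v := rfl
    have h1 : a k ⬝ᵥ (rootReflection (a k) (r k))^[1] v = - (a k ⬝ᵥ v) := hself k v
    rw [sum_range_succ, sum_range_one]
    rw [h0, h1]
    rcases lt_or_gt_of_ne hv with h | h
    · rw [if_neg (by omega), if_pos (by omega), zero_add]
    · rw [if_pos (by omega), if_neg (by omega), add_zero]
  have hodd : ∀ k l v, Odd (a k ⬝ᵥ rootReflection (a l) (r l) v) ↔ Odd (a k ⬝ᵥ v) := by
    intro k l v
    rw [hact]
    split_ifs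
    · exact odd_neg
    · rfl
  have hne : ∀ k v, Odd (a k ⬝ᵥ v) → a k ⬝ᵥ v ≠ 0 := by
    rintro k v hk h0
    simp [h0] at hk
  -- Weights odd at `k₀` are nonzero at no fewer than t + 1 of the orthogonal coroots, so the sign
  -- changes group them in blocks of 2^(t+1). The comparison below with the positive half costs one
  -- factor 2.
  have h1 : ((2 : ℕ) : ℤ) ^ (t + 1) ∣ I (fun v ↦ if Odd (a k₀ ⬝ᵥ v) then 1 else 0) := by
    refine pow_dvd_apply_indicator I (c := fun k ↦ rootReflection (a k) (r k))
      (D := fun k v ↦ 0 < a k ⬝ᵥ v) (nz := fun k v ↦ a k ⬝ᵥ v ≠ 0)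
      (q := fun k v ↦ Odd (a k ⬝ᵥ v)) hinv hdom ?_ hne hodd (fun k v ↦ hodd k₀ k v) hpar
    intro k l hkl v
    rw [hact, if_neg hkl]
  have h2 := apply_eq_mul_of_domain I (hinv k₀) (p := 2) (D := fun v ↦ 0 < a k₀ ⬝ᵥ v)
    (F := fun v ↦ (a k₀ ⬝ᵥ v) ^ 2) (fun v ↦ by rw [hself, neg_sq])
    (fun v hv ↦ hdom k₀ v fun h0 ↦ hv (by simp only [h0]; rfl))
  have h3 := apply_eq_mul_of_domain I (hinv k₀) (p := 2) (D := fun v ↦ 0 < a k₀ ⬝ᵥ v)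
    (F := fun v ↦ if Odd (a k₀ ⬝ᵥ v) then 1 else 0) (fun v ↦ by simp only [hodd])
    (fun v hv ↦ hdom k₀ v (hne k₀ v (by by_contra h0; simp [h0] at hv)))
  -- `G` is the quotient by 4 of the square: odd squares are 1 and even squares 0 modulo 4. Hence d
  -- is the number of weights with odd positive value plus a multiple of 4, which is why t ≤ 2 is
  -- required.
  set G : (ι → ℤ) → ℤ := fun v ↦ if 0 < a k₀ ⬝ᵥ v then (a k₀ ⬝ᵥ v) ^ 2 / 4 else 0 with hG
  have h4 : (fun v ↦ if 0 < a k₀ ⬝ᵥ v then (a k₀ ⬝ᵥ v) ^ 2 else 0) =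
      fun v ↦ (if 0 < a k₀ ⬝ᵥ v then (if Odd (a k₀ ⬝ᵥ v) then 1 else 0) else 0) + 4 * G v := by
    funext v
    simp only [hG]
    by_cases h0 : 0 < a k₀ ⬝ᵥ v
    · simp only [if_pos h0]
      split_ifs with h5
      · obtain ⟨m, hm⟩ := h5
        have : (a k₀ ⬝ᵥ v) ^ 2 = 4 * (m ^ 2 + m) + 1 := by rw [hm]; ring
        omega
      · obtain ⟨m, hm⟩ := Int.not_odd_iff_even.1 h5
        have : (a k₀ ⬝ᵥ v) ^ 2 = 4 * m ^ 2 := by rw [hm]; ring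
        omega
    · simp only [if_neg h0]; ring
  have h5 : d = I (fun v ↦ if 0 < a k₀ ⬝ᵥ v then
      (if Odd (a k₀ ⬝ᵥ v) then 1 else 0) else 0) + 4 * I G := by
    rw [← apply_int_mul, ← apply_add', ← h4]
    have := hd.symm.trans h2
    push_cast at this
    linarith
  rw [h3, pow_succ', Nat.cast_ofNat] at h1
  rw [h5]
  refine dvd_add (Int.dvd_of_mul_dvd_mul_left (by norm_num) h1) (dvd_mul_of_dvd_left ?_ _)
  have : (4 : ℤ) = 2 ^ 2 := by norm_num
  rw [this]
  exact pow_dvd_pow 2 ht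

theorem odd_dotProduct_iff (a v : ι → ℤ) :
    Odd (a ⬝ᵥ v) ↔ (fun i ↦ (a i : ZMod 2)) ⬝ᵥ (fun i ↦ (v i : ZMod 2)) = 1 := by
  rw [← ZMod.intCast_eq_one_iff_odd]
  simp [dotProduct]

/-- Divisibility of the index by `2`, from a system of orthogonal roots whose coroots have an even
sum. -/
theorem IsWeylInvariant.two_dvd_of_sum_eq (hI : IsWeylInvariant A I)
    (hA : ∀ i, A i i = 2) {a r : κ → ι → ℤ} (h : ∀ k, ∃ j, IsRootPair A j (a k) (r k))
    (har : ∀ k l, a k ⬝ᵥ r l = if k = l then 2 else 0) (k₀ : κ) (b : ι → ℤ)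
    (hb : ∑ k, a k = (2 : ℤ) • b) {d : ℤ}
    (hd : I (fun v ↦ (a k₀ ⬝ᵥ v) ^ 2) = 2 * d) : 2 ∣ d := by
  classical
  have := hI.two_pow_dvd_of_orthogonal hA h har k₀ (t := 1) (by norm_num) ?_ hd
  · simpa using this
  intro v hv
  -- If `k₀` were the only index with an odd value, the sum of all values would be odd, whereas it
  -- is twice an integer.
  by_contra! hlt
  have h1 : ({k | Odd (a k ⬝ᵥ v)} : Finset κ) = {k₀} :=
    (Finset.eq_of_subset_of_card_le (by simpa using hv) (by rw [card_singleton]; omega)).symm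
  have h2 : ∀ k ≠ k₀, Even (a k ⬝ᵥ v) := by
    intro k hk
    by_contra h3
    have : k ∈ ({k | Odd (a k ⬝ᵥ v)} : Finset κ) := by simpa using h3
    rw [h1] at this
    exact hk (by simpa using this)
  have h3 : ∑ k, a k ⬝ᵥ v = 2 * (b ⬝ᵥ v) := by
    rw [← sum_dotProduct, hb, smul_dotProduct, smul_eq_mul]
  rw [← Finset.add_sum_erase _ _ (mem_univ k₀)] at h3
  have h4 : Even (∑ k ∈ univ.erase k₀, a k ⬝ᵥ v) :=
    Finset.even_sum _ fun k hk ↦ h2 k (ne_of_mem_erase hk)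
  have h5 : Even (a k₀ ⬝ᵥ v + ∑ k ∈ univ.erase k₀, a k ⬝ᵥ v) := by
    rw [h3]; exact even_two_mul _
  exact Int.not_even_iff_odd.2 hv ((Int.even_add.1 h5).2 h4)

/-- Divisibility of the index by `3`, from a system of orthogonal subsystems of type `A₂`. -/
theorem IsWeylInvariant.three_dvd_of_sum_eq (hI : IsWeylInvariant A I)
    (hA : ∀ i, A i i = 2) {a r b s : κ → ι → ℤ} (h : ∀ k, ∃ j, IsRootPair A j (a k) (r k))
    (h' : ∀ k, ∃ j, IsRootPair A j (b k) (s k))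
    (har : ∀ k l, a k ⬝ᵥ r l = if k = l then 2 else 0)
    (has : ∀ k l, a k ⬝ᵥ s l = if k = l then -1 else 0)
    (hbr : ∀ k l, b k ⬝ᵥ r l = if k = l then -1 else 0)
    (hbs : ∀ k l, b k ⬝ᵥ s l = if k = l then 2 else 0) (k₀ : κ) (w : ι → ℤ)
    (hw : ∑ k, (a k - b k) = (3 : ℤ) • w) {d : ℤ}
    (hd : I (fun v ↦ (a k₀ ⬝ᵥ v) ^ 2) = 2 * d) : 3 ∣ d := by
  set c : κ → (ι → ℤ) → (ι → ℤ) :=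
    fun k ↦ rootReflection (a k) (r k) ∘ rootReflection (b k) (s k) with hc
  have hinv : ∀ k, ∀ F : (ι → ℤ) → ℤ, I (F ∘ c k) = I F := fun k F ↦ by
    obtain ⟨j, hj⟩ := h k
    obtain ⟨j', hj'⟩ := h' k
    rw [hc, ← comp_assoc, hI.apply_comp_rootReflection hA hj',
      hI.apply_comp_rootReflection hA hj]
  have hac : ∀ k l v, a k ⬝ᵥ c l v = if k = l then - (a k ⬝ᵥ v) - b k ⬝ᵥ v else a k ⬝ᵥ v := by
    intro k l v
    simp only [hc, comp_apply, dotProduct_rootReflection, har, has, hbr, hbs]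
    split_ifs with hkl
    · subst hkl; simp; ring
    · simp
  have hbc : ∀ k l v, b k ⬝ᵥ c l v = if k = l then a k ⬝ᵥ v else b k ⬝ᵥ v := by
    intro k l v
    simp only [hc, comp_apply, dotProduct_rootReflection, har, has, hbr, hbs]
    split_ifs with hkl
    · subst hkl; simp; ring
    · simp
  have haself : ∀ k v, a k ⬝ᵥ c k v = - (a k ⬝ᵥ v) - b k ⬝ᵥ v := fun k v ↦ by
    rw [hac, if_pos rfl]
  have hbself : ∀ k v, b k ⬝ᵥ c k v = a k ⬝ᵥ v := fun k v ↦ by rw [hbc, if_pos rfl]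
  -- The rotation permutes the three values a, b, -a-b cyclically. The domain asks that a be the
  -- largest; one strict and one weak inequality settle ties, and all three coincide only at zero.
  set D : κ → (ι → ℤ) → Prop := fun k v ↦ b k ⬝ᵥ v ≤ a k ⬝ᵥ v ∧
    - (a k ⬝ᵥ v) - b k ⬝ᵥ v < a k ⬝ᵥ v with hDdef
  have hDdec : ∀ k, DecidablePred (D k) := fun k ↦ Classical.decPred _
  have hdom : ∀ k v, ¬ (a k ⬝ᵥ v = 0 ∧ b k ⬝ᵥ v = 0) → ∑ t ∈ range 3,
      (if D k ((c k)^[t] v) then (1 : ℤ) else 0) = 1 := by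
    intro k v hv
    rw [sum_range_succ, sum_range_succ, sum_range_one]
    simp only [hDdef, iterate_zero, id_eq, iterate_one, iterate_succ, comp_apply, haself, hbself]
    split_ifs <;> omega
  have hq : ∀ k l v, 3 ∣ (a k - b k) ⬝ᵥ c l v ↔ 3 ∣ (a k - b k) ⬝ᵥ v := by
    intro k l v
    rw [sub_dotProduct, hac, hbc, sub_dotProduct]
    split_ifs <;> omega
  have hqnz : ∀ k v, ¬ 3 ∣ (a k - b k) ⬝ᵥ v → ¬ (a k ⬝ᵥ v = 0 ∧ b k ⬝ᵥ v = 0) := by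
    rintro k v h1 ⟨h2, h3⟩
    exact h1 (by rw [sub_dotProduct, h2, h3]; simp)
  have hcard : ∀ v : ι → ℤ, ¬ 3 ∣ (a k₀ - b k₀) ⬝ᵥ v →
      2 ≤ #{k | ¬ 3 ∣ (a k - b k) ⬝ᵥ v} := by
    intro v hv
    by_contra! hlt
    have h1 : ({k | ¬ 3 ∣ (a k - b k) ⬝ᵥ v} : Finset κ) = {k₀} :=
      (Finset.eq_of_subset_of_card_le (by simpa using hv) (by rw [card_singleton]; omega)).symm
    have h2 : ∀ k ≠ k₀, 3 ∣ (a k - b k) ⬝ᵥ v := by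
      intro k hk
      by_contra h3
      have : k ∈ ({k | ¬ 3 ∣ (a k - b k) ⬝ᵥ v} : Finset κ) := by simpa using h3
      rw [h1] at this
      exact hk (by simpa using this)
    have h3 : ∑ k, (a k - b k) ⬝ᵥ v = 3 * (w ⬝ᵥ v) := by
      rw [← sum_dotProduct, hw, smul_dotProduct, smul_eq_mul]
    rw [← Finset.add_sum_erase _ _ (mem_univ k₀)] at h3
    have h4 : 3 ∣ ∑ k ∈ univ.erase k₀, (a k - b k) ⬝ᵥ v :=
      Finset.dvd_sum fun k hk ↦ h2 k (ne_of_mem_erase hk)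
    omega
  have h1 : ((3 : ℕ) : ℤ) ^ 2 ∣ I (fun v ↦ if ¬ 3 ∣ (a k₀ - b k₀) ⬝ᵥ v then 1 else 0) := by
    refine pow_dvd_apply_indicator I (c := c) (D := D)
      (nz := fun k v ↦ ¬ (a k ⬝ᵥ v = 0 ∧ b k ⬝ᵥ v = 0))
      (q := fun k v ↦ ¬ 3 ∣ (a k - b k) ⬝ᵥ v) hinv hdom ?_ hqnz
      (fun i j v ↦ not_congr (hq i j v)) (fun k v ↦ not_congr (hq k₀ k v)) hcard
    intro k l hkl v
    simp only [hDdef, hac, hbc, if_neg hkl]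
  have h3 := apply_eq_mul_of_domain I (hinv k₀) (p := 3) (D := D k₀)
    (F := fun v ↦ if ¬ 3 ∣ (a k₀ - b k₀) ⬝ᵥ v then 1 else 0) (fun v ↦ by simp only [hq])
    (fun v hv ↦ hdom k₀ v (hqnz k₀ v (fun h0 ↦ hv (if_neg (not_not.2 h0)))))
  have h2 := apply_eq_mul_of_domain I (hinv k₀) (p := 3) (D := D k₀)
    (F := fun v ↦ (a k₀ ⬝ᵥ v) ^ 2 + (a k₀ ⬝ᵥ v) * (b k₀ ⬝ᵥ v) + (b k₀ ⬝ᵥ v) ^ 2)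
    (fun v ↦ by rw [haself, hbself]; ring)
    (fun v hv ↦ hdom k₀ v (by rintro ⟨h4, h5⟩; exact hv (by rw [h4, h5]; ring)))
  have hdb : I (fun v ↦ (b k₀ ⬝ᵥ v) ^ 2) = 2 * d := by
    rw [← hd, ← hinv k₀]
    simp only [comp_def, hbself]
  have hdab : I (fun v ↦ (a k₀ ⬝ᵥ v + b k₀ ⬝ᵥ v) ^ 2) = 2 * d := by
    rw [← hd, ← hinv k₀ (fun v ↦ (a k₀ ⬝ᵥ v) ^ 2)]
    simp only [comp_def, haself]
    congr 1
    funext v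
    ring
  -- The three coroots a, b, a+b of A₂ contribute 2d each, and 2(x² + xy + y²) = x² + y² + (x+y)².
  have h6 : 2 * I (fun v ↦ (a k₀ ⬝ᵥ v) ^ 2 + (a k₀ ⬝ᵥ v) * (b k₀ ⬝ᵥ v) + (b k₀ ⬝ᵥ v) ^ 2) =
      6 * d := by
    rw [← apply_int_mul]
    have : (fun v : ι → ℤ ↦ 2 * ((a k₀ ⬝ᵥ v) ^ 2 + (a k₀ ⬝ᵥ v) * (b k₀ ⬝ᵥ v) + (b k₀ ⬝ᵥ v) ^ 2))
        = fun v ↦ (a k₀ ⬝ᵥ v) ^ 2 + ((b k₀ ⬝ᵥ v) ^ 2 + (a k₀ ⬝ᵥ v + b k₀ ⬝ᵥ v) ^ 2) := by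
      funext v; ring
    rw [this, apply_add', apply_add', hd, hdb, hdab]
    ring
  -- Since x² + xy + y² ≡ (x-y)² modulo 3, the sum over the domain is congruent to the number of its
  -- weights with 3 ∤ x - y. Over all weights that number is divisible by 9, hence over the domain
  -- by 3.
  set G : (ι → ℤ) → ℤ := fun v ↦ if D k₀ v then
    ((a k₀ ⬝ᵥ v) ^ 2 + (a k₀ ⬝ᵥ v) * (b k₀ ⬝ᵥ v) + (b k₀ ⬝ᵥ v) ^ 2) / 3 else 0 with hG
  have h4 : (fun v ↦ if D k₀ v then
      (a k₀ ⬝ᵥ v) ^ 2 + (a k₀ ⬝ᵥ v) * (b k₀ ⬝ᵥ v) + (b k₀ ⬝ᵥ v) ^ 2 else 0) =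
      fun v ↦ (if D k₀ v then (if ¬ 3 ∣ (a k₀ - b k₀) ⬝ᵥ v then 1 else 0) else 0) + 3 * G v := by
    funext v
    simp only [hG]
    by_cases h0 : D k₀ v
    · simp only [if_pos h0, sub_dotProduct]
      generalize a k₀ ⬝ᵥ v = x
      generalize b k₀ ⬝ᵥ v = y
      have h7 : x ^ 2 + x * y + y ^ 2 = (x - y) ^ 2 + 3 * (x * y) := by ring
      rw [h7]
      split_ifs with h5
      · obtain ⟨m, hm⟩ := h5
        have : (x - y) ^ 2 = 3 * (3 * m ^ 2) := by rw [hm]; ring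
        omega
      · obtain ⟨m, hm⟩ : ∃ m, (x - y) ^ 2 = 3 * m + 1 := by
          obtain h8 | h8 : (x - y) % 3 = 1 ∨ (x - y) % 3 = 2 := by omega
          · refine ⟨3 * ((x - y) / 3) ^ 2 + 2 * ((x - y) / 3), ?_⟩
            have h9 : x - y = 3 * ((x - y) / 3) + 1 := by omega
            conv_lhs => rw [h9]
            ring
          · refine ⟨3 * ((x - y) / 3) ^ 2 + 4 * ((x - y) / 3) + 1, ?_⟩
            have h9 : x - y = 3 * ((x - y) / 3) + 2 := by omega
            conv_lhs => rw [h9]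
            ring
        omega
    · simp only [if_neg h0]; ring
  have h5 : d = I (fun v ↦ if D k₀ v then
      (if ¬ 3 ∣ (a k₀ - b k₀) ⬝ᵥ v then 1 else 0) else 0) + 3 * I G := by
    rw [← apply_int_mul, ← apply_add', ← h4]
    push_cast at h2
    linarith
  rw [h3, pow_two, Nat.cast_ofNat] at h1
  rw [h5]
  exact dvd_add (Int.dvd_of_mul_dvd_mul_left (by norm_num) h1) (dvd_mul_right _ _)

/-- The roots obtained from simple roots by words in the simple reflections. -/
theorem IsRootPair.word (j : ι) (l : List ι) :
    IsRootPair A j (l.foldr (coreflection A) (Pi.single j 1)) (l.foldr (simpleReflection A) (A j)) := by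
  induction l with
  | nil => exact .simple
  | cons i l ih => exact .reflect i ih

end Divisibility

/-! ### Orthogonal systems in D₄, B₃, G₂, E₆, F₄ and E₇ -/

section DivisibilityOfTypes

open Finset Function

/-- The three outer simple roots and the highest root are orthogonal, and their coroots sum to twice
the sum of the simple coroots. -/
theorem two_dvd_of_D4 {I : ((Fin 4 → ℤ) → ℤ) →+ ℤ} (hI : IsWeylInvariant (CartanMatrix.D 4) I)
    {d : ℤ} (hd : I (fun v ↦ v 0 ^ 2) = 2 * d) : 2 ∣ d := by
  have h := hI.two_dvd_of_sum_eq (CartanMatrix.D_diag 4) (κ := Fin 4)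
    (fun k ↦ ⟨_, IsRootPair.word (![0, 2, 3, 0] k) (![[], [], [], [1, 3, 2, 1]] k)⟩)
    (by decide +kernel) 0 ![1, 1, 1, 1] (by decide +kernel) (d := d)
  exact h (by simpa using hd)

/-- The orthogonal roots are ε₁ - ε₂, ε₃ and ε₁ + ε₂; their coroots sum to 2ε₁ + 2ε₃. -/
theorem two_dvd_of_B3 {I : ((Fin 3 → ℤ) → ℤ) →+ ℤ} (hI : IsWeylInvariant (CartanMatrix.B 3) I)
    {d : ℤ} (hd : I (fun v ↦ v 0 ^ 2) = 2 * d) : 2 ∣ d := by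
  have h := hI.two_dvd_of_sum_eq (CartanMatrix.B_diag 3) (κ := Fin 3)
    (fun k ↦ ⟨_, IsRootPair.word (![0, 2, 0] k) (![[], [], [1, 2, 1]] k)⟩)
    (by decide +kernel) 0 ![1, 1, 1] (by decide +kernel) (d := d)
  exact h (by simpa using hd)

theorem two_dvd_of_G2 {I : ((Fin 2 → ℤ) → ℤ) →+ ℤ}
    (hI : IsWeylInvariant CartanMatrix.G₂.transpose I)
    {d : ℤ} (hd : I (fun v ↦ v 1 ^ 2) = 2 * d) : 2 ∣ d := by
  have h := hI.two_dvd_of_sum_eq CartanMatrix.G₂_diag (κ := Fin 2)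
    (fun k ↦ ⟨_, IsRootPair.word (![1, 0] k) (![[], [0, 1]] k)⟩)
    (by decide +kernel) 0 ![1, 2] (by decide +kernel) (d := d)
  exact h (by simpa using hd)

/-- Removing the branch node from the extended diagram leaves three copies of A₂; the long word
produces the opposite of the highest root. -/
theorem three_dvd_of_E6 {I : ((Fin 6 → ℤ) → ℤ) →+ ℤ} (hI : IsWeylInvariant CartanMatrix.E₆ I)
    {d : ℤ} (hd : I (fun v ↦ v 0 ^ 2) = 2 * d) : 3 ∣ d := by
  have h := hI.three_dvd_of_sum_eq CartanMatrix.E₆_diag (κ := Fin 3)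
    (fun k ↦ ⟨_, IsRootPair.word (![0, 5, 0] k) (![[], [], [1, 3, 4, 5, 2, 3, 4, 1, 3, 2, 0]] k)⟩)
    (fun k ↦ ⟨_, IsRootPair.word (![2, 4, 1] k) []⟩)
    (by decide +kernel) (by decide +kernel) (by decide +kernel) (by decide +kernel) 0
    ![0, -1, -1, -1, -1, 0] (by decide +kernel) (d := d)
  exact h (by simpa using hd)

/-- Node 1 is removed from the extended diagram, leaving a long and a short A₂. The coroot used is
that of the lowest root, which is conjugate to the first simple root; `IsWeylInvariant.apply_coroot`
transfers the hypothesis. -/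
theorem three_dvd_of_F4 {I : ((Fin 4 → ℤ) → ℤ) →+ ℤ} (hI : IsWeylInvariant CartanMatrix.F₄ I)
    {d : ℤ} (hd : I (fun v ↦ v 0 ^ 2) = 2 * d) : 3 ∣ d := by
  have h := hI.three_dvd_of_sum_eq CartanMatrix.F₄_diag (κ := Fin 2)
    (fun k ↦ ⟨_, IsRootPair.word (![0, 3] k) (![[0, 1, 2, 3, 1, 2, 1, 0], []] k)⟩)
    (fun k ↦ ⟨_, IsRootPair.word (![0, 2] k) []⟩)
    (by decide +kernel) (by decide +kernel) (by decide +kernel) (by decide +kernel) 0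
    ![-1, -1, -1, 0] (by decide +kernel) (d := d)
  exact h ((hI.apply_coroot (IsRootPair.word 0 _) (fun x ↦ x ^ 2)).trans hd)

/-- E₇ contains seven orthogonal roots, and the parities of an integral weight at their coroots form
a word of the Hamming code of length 7, whose nonzero words have at least three odd entries. This is
t = 2, checked over all weights modulo 2. -/
theorem four_dvd_of_E7 {I : ((Fin 7 → ℤ) → ℤ) →+ ℤ} (hI : IsWeylInvariant CartanMatrix.E₇ I)
    {d : ℤ} (hd : I (fun v ↦ v 0 ^ 2) = 2 * d) : 4 ∣ d := by
  classical
  have h := hI.two_pow_dvd_of_orthogonal CartanMatrix.E₇_diag (κ := Fin 7)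
    (fun k ↦ ⟨_, IsRootPair.word (![0, 1, 1, 1, 2, 4, 6] k)
      (![[0, 2, 3, 4, 5, 6, 1, 3, 4, 5, 2, 3, 4, 1, 3, 2], [5, 6, 4, 5, 3, 4, 2, 3],
        [3, 4, 2, 3], [], [], [], []] k)⟩)
    (by decide +kernel) 0 (t := 2) le_rfl ?_ (d := d)
  · exact h ((hI.apply_coroot (IsRootPair.word 0 _) (fun x ↦ x ^ 2)).trans hd)
  · intro v
    simp only [odd_dotProduct_iff]
    generalize (fun i ↦ (v i : ZMod 2)) = w
    revert w
    decide +kernel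

end DivisibilityOfTypes

/-! ### Divisibility by 5 for E₈ from a Coxeter element -/

section DivisibilityByFive

open Finset Function

variable {ι : Type*} [Fintype ι] [DecidableEq ι] {A : Matrix ι ι ℤ} {I : ((ι → ℤ) → ℤ) →+ ℤ}

/-- The simple reflection as a linear map. -/
def simpleReflectionHom (A : Matrix ι ι ℤ) (i : ι) : Module.End ℤ (ι → ℤ) where
  toFun := simpleReflection A i
  map_add' v w := by funext j; simp only [simpleReflection, Pi.add_apply]; ring
  map_smul' a v := by
    funext j; simp only [simpleReflection, Pi.smul_apply, smul_eq_mul, RingHom.id_apply]; ring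

theorem IsWeylInvariant.apply_comp_list_prod (hI : IsWeylInvariant A I) (l : List ι)
    (F : (ι → ℤ) → ℤ) : I (F ∘ (l.map (simpleReflectionHom A)).prod) = I F := by
  induction l generalizing F with
  | nil => rfl
  | cons i l ih =>
    rw [List.map_cons, List.prod_cons, Module.End.mul_eq_comp, LinearMap.coe_comp, ← comp_assoc,
      ih]
    exact hI i F

/-- An element of order five without nonzero fixed vectors makes every invariant function vanishing
at 0 sum to a multiple of 5. Applied to the invariant quadratic form, whose sum is 8d, this gives 5
∣ d. -/
theorem five_dvd_of_E8 {I : ((Fin 8 → ℤ) → ℤ) →+ ℤ} (hI : IsWeylInvariant CartanMatrix.E₈ I)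
    {d : ℤ} (hd : I (fun v ↦ v 0 ^ 2) = 2 * d) : 5 ∣ d := by
  -- `C` is the Coxeter element, the product of all simple reflections in the order of the nodes;
  -- the Coxeter number is 30, so `M`, its sixth power, has order 5. `B` is the inverse Cartan
  -- matrix, and `hsum` is the trace of the identity.
  set C : Matrix (Fin 8) (Fin 8) ℤ := !![-1, 0, -1, -1, -1, -1, -1, -1;
    0, -1, 0, -1, -1, -1, -1, -1;
    1, 0, 0, 0, 0, 0, 0, 0;
    0, 1, 1, 1, 1, 1, 1, 1;
    0, 0, 0, 1, 0, 0, 0, 0;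
    0, 0, 0, 0, 1, 0, 0, 0;
    0, 0, 0, 0, 0, 1, 0, 0;
    0, 0, 0, 0, 0, 0, 1, 0] with hC
  set M : Matrix (Fin 8) (Fin 8) ℤ := !![-1, -1, -2, -2, -2, -2, -1, -1;
    -1, -2, -2, -3, -3, -2, -2, -1;
    0, -1, -1, -2, -1, -1, -1, 0;
    0, 1, 1, 1, 1, 1, 1, 0;
    1, 1, 1, 2, 1, 1, 1, 1;
    0, 0, 1, 1, 1, 0, 0, 0;
    0, 1, 0, 1, 1, 1, 0, 0;
    1, 0, 1, 1, 1, 1, 1, 0] with hM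
  set B : Matrix (Fin 8) (Fin 8) ℤ := !![4, 5, 7, 10, 8, 6, 4, 2;
    5, 8, 10, 15, 12, 9, 6, 3;
    7, 10, 14, 20, 16, 12, 8, 4;
    10, 15, 20, 30, 24, 18, 12, 6;
    8, 12, 16, 24, 20, 15, 10, 5;
    6, 9, 12, 18, 15, 12, 8, 4;
    4, 6, 8, 12, 10, 8, 6, 3;
    2, 3, 4, 6, 5, 4, 3, 2] with hB
  have hCM : C ^ 6 = M := by decide +kernel
  have hM5 : M ^ 5 = 1 := by decide +kernel
  have hM0 : 1 + M + M ^ 2 + M ^ 3 + M ^ 4 = 0 := by decide +kernel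
  have hMB : M.transpose * B * M = B := by decide +kernel
  have hBA : ∀ i j, B i j * CartanMatrix.E₈ i j = B j i * CartanMatrix.E₈ j i := by decide +kernel
  have hsum : ∑ i, ∑ j, B i j * CartanMatrix.E₈ i j = 8 := by decide +kernel
  have hcol : ∀ j k, [0, 1, 2, 3, 4, 5, 6, 7].foldr (simpleReflection CartanMatrix.E₈)
      (Pi.single j 1) k = C k j := by decide +kernel
  have hA := CartanMatrix.E₈_diag
  have hCI : ∀ F : (Fin 8 → ℤ) → ℤ, I (F ∘ C.mulVec) = I F := by
    intro F
    have h1 : (([0, 1, 2, 3, 4, 5, 6, 7] : List (Fin 8)).map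
        (simpleReflectionHom CartanMatrix.E₈)).prod = C.mulVecLin := by
      refine (Pi.basisFun ℤ (Fin 8)).ext fun j ↦ ?_
      funext k
      rw [Pi.basisFun_apply, Matrix.mulVecLin_apply, Matrix.mulVec_single_one, Matrix.col_apply,
        ← hcol]
      rfl
    rw [← hI.apply_comp_list_prod [0, 1, 2, 3, 4, 5, 6, 7] F, h1]
    rfl
  have hpow : ∀ (K : Matrix (Fin 8) (Fin 8) ℤ) (n : ℕ), K.mulVec^[n] = (K ^ n).mulVec := by
    intro K n
    induction n with
    | zero => funext v; simp
    | succ n ih => funext v; rw [iterate_succ_apply, ih, Matrix.mulVec_mulVec, pow_succ]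
  have hMI : ∀ F : (Fin 8 → ℤ) → ℤ, I (F ∘ M.mulVec) = I F := by
    intro F
    rw [← hCM, ← hpow]
    exact apply_comp_iterate I hCI 6 F
  have h5 : (5 : ℤ) ∣ I (fun v ↦ v ⬝ᵥ B.mulVec v) := by
    refine prime_dvd_apply I (p := 5) hMI (by norm_num) ?_ ?_ ?_
    · intro v
      rw [hpow, hM5, Matrix.one_mulVec]
    · intro v
      rw [Matrix.mulVec_mulVec, Matrix.dotProduct_mulVec, Matrix.vecMul_mulVec, ← Matrix.mul_assoc,
        hMB, Matrix.dotProduct_mulVec]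
    · intro v hv hMv
      apply hv
      have h1 : ∀ n, (M ^ n).mulVec v = v := by
        intro n
        rw [← hpow]
        exact iterate_fixed hMv n
      -- A fixed vector is multiplied by 5 by 1 + M + M² + M³ + M⁴ = 0.
      have h2 : (5 : ℤ) • v = 0 := by
        have := congrArg (fun K ↦ K.mulVec v) hM0
        simp only [Matrix.add_mulVec, Matrix.one_mulVec, Matrix.zero_mulVec, h1, hMv] at this
        rw [← this]
        module
      have h3 : v = 0 := (smul_eq_zero.1 h2).resolve_left (by norm_num)
      simp [h3]
  have hsq : ∀ i, I (fun v ↦ v i ^ 2) = 2 * d := by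
    have key : ∀ i j, CartanMatrix.E₈ i j = -1 → CartanMatrix.E₈ j i = -1 →
        I (fun v ↦ v i ^ 2) = 2 * d → I (fun v ↦ v j ^ 2) = 2 * d := fun i j h h' hi ↦
      (hI.apply_sq_eq hA h h').symm.trans hi
    have h2 := key 0 2 rfl rfl hd
    have h3 := key 2 3 rfl rfl h2
    have h4 := key 3 4 rfl rfl h3
    have h5 := key 4 5 rfl rfl h4
    have h6 := key 5 6 rfl rfl h5
    have h7 := key 6 7 rfl rfl h6
    have h1 := key 3 1 rfl rfl h3
    intro i
    fin_cases i <;> assumption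
  have h8 : I (fun v ↦ v ⬝ᵥ B.mulVec v) = 8 * d := by
    have h1 : (fun v : Fin 8 → ℤ ↦ v ⬝ᵥ B.mulVec v) =
        ∑ i, ∑ j, fun v ↦ B i j * (v i * v j) := by
      funext v
      simp only [dotProduct, Matrix.mulVec, Finset.sum_apply, Finset.mul_sum]
      refine Finset.sum_congr rfl fun i _ ↦ Finset.sum_congr rfl fun j _ ↦ by ring
    rw [h1]
    simp only [map_sum, apply_int_mul]
    rw [← hsum, Finset.sum_mul]
    refine Finset.sum_congr rfl fun i _ ↦ ?_
    rw [Finset.sum_mul]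
    refine Finset.sum_congr rfl fun j _ ↦ ?_
    have h2 := hI.two_mul_apply_mul (hA i) j
    rw [hsq] at h2
    have h3 : I (fun v ↦ v i * v j) = CartanMatrix.E₈ i j * d := by linarith
    rw [h3]
    ring
  omega

end DivisibilityByFive

/-! ### Long simple roots of the Cartan matrices -/

namespace SimpleType

/-- A node with a long simple root. -/
def longNode : (T : SimpleType) → Fin T.rank
  | A _ hr => ⟨0, hr⟩
  -- The offsets r - 3, and r - 4 for type D, make this node the first node of the subdiagram B₃ or
  -- D₄ at the end of the diagram.
  | B r hr => ⟨r - 3, by simp only [rank]; omega⟩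
  | C r hr => ⟨r - 1, by simp only [rank]; omega⟩
  | D r hr => ⟨r - 4, by simp only [rank]; omega⟩
  | E6 => ⟨0, by decide⟩
  | E7 => ⟨0, by decide⟩
  | E8 => ⟨0, by decide⟩
  | F4 => ⟨0, by decide⟩
  | G2 => ⟨1, by decide⟩

theorem cartanMatrix_A_apply {r : ℕ} (hr : 1 ≤ r) (i j : Fin r) : (A r hr).cartanMatrix i j =
    if i.1 = j.1 then 2 else if i.1 + 1 = j.1 ∨ j.1 + 1 = i.1 then -1 else 0 := by
  change CartanMatrix.A r i j = _
  simp [CartanMatrix.A, Fin.ext_iff]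

theorem cartanMatrix_B_apply {r : ℕ} (hr : 3 ≤ r) (i j : Fin r) : (B r hr).cartanMatrix i j =
    if i.1 = j.1 then 2 else if i.1 + 1 = j.1 then (if j.1 = r - 1 then -2 else -1)
    else if j.1 + 1 = i.1 then -1 else 0 := by
  change CartanMatrix.B r i j = _
  simp [CartanMatrix.B, Fin.ext_iff]

theorem cartanMatrix_C_apply {r : ℕ} (hr : 1 ≤ r) (i j : Fin r) : (C r hr).cartanMatrix i j =
    if i.1 = j.1 then 2 else if i.1 + 1 = j.1 then -1
    else if j.1 + 1 = i.1 then (if i.1 = r - 1 then -2 else -1) else 0 := by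
  change CartanMatrix.C r i j = _
  simp [CartanMatrix.C, Fin.ext_iff]

theorem cartanMatrix_D_apply {r : ℕ} (hr : 4 ≤ r) (i j : Fin r) : (D r hr).cartanMatrix i j =
    if i.1 = j.1 then 2 else if i.1 + 1 = j.1 ∧ j.1 + 2 < r then -1
    else if j.1 + 1 = i.1 ∧ i.1 + 2 < r then -1
    else if i.1 + 3 = r ∧ (j.1 + 2 = r ∨ j.1 + 1 = r) then -1
    else if j.1 + 3 = r ∧ (i.1 + 2 = r ∨ i.1 + 1 = r) then -1 else 0 := by
  change CartanMatrix.D r i j = _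
  have : ¬ r ≤ 2 := by omega
  simp [CartanMatrix.D, Fin.ext_iff, this]

/-- The long simple roots have the short coroots. -/
theorem le_of_symmetrizes (T : SimpleType) {L : Fin T.rank → ℚ}  (h0 : ∀ i, 0 < L i)
    (h : ∀ i j, (T.cartanMatrix i j : ℚ) * L i = T.cartanMatrix j i * L j) (j : Fin T.rank) :
    L T.longNode ≤ L j := by
  -- `L` plays the role of the square lengths of the simple coroots: they agree along simple edges,
  -- and `key2` compares them across a multiple edge.
  have key : ∀ i j, T.cartanMatrix i j = -1 → T.cartanMatrix j i = -1 → L i = L j := by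
    intro i j h1 h2
    have := h i j
    rw [h1, h2] at this
    push_cast at this
    linarith
  have key2 : ∀ i j (c : ℤ), T.cartanMatrix i j = c → T.cartanMatrix j i = -1 → c * L i = - L j := by
    intro i j c h1 h2
    have := h i j
    rw [h1, h2] at this
    push_cast at this
    linarith
  cases T with
  | A r hr =>
    have : ∀ n (hn : n < r), L ⟨0, hr⟩ = L ⟨n, hn⟩ := by
      intro n hn
      induction n with
      | zero => rfl
      | succ n ih =>
        rw [ih (by omega)]
        apply key <;> refine (cartanMatrix_A_apply hr _ _).trans ?_ <;> grind
    exact (this j.1 j.2).le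
  | B r hr =>
    have : ∀ n (hn : n < r - 1), L ⟨n, show n < r by omega⟩ = L ⟨0, show 0 < r by omega⟩ := by
      intro n hn
      induction n with
      | zero => rfl
      | succ n ih =>
        rw [← ih (by omega)]
        apply key <;> refine (cartanMatrix_B_apply hr _ _).trans ?_ <;> grind
    have h1 : L (longNode (B r hr)) = L ⟨0, show 0 < r by omega⟩ := this (r - 3) (by omega)
    have h2 := this (r - 2) (by omega)
    have h3 := key2 ⟨r - 2, show r - 2 < r by omega⟩ ⟨r - 1, show r - 1 < r by omega⟩ (-2)
      (by refine (cartanMatrix_B_apply hr _ _).trans ?_; grind) (by refine (cartanMatrix_B_apply hr _ _).trans ?_; grind)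
    have h4 := h0 ⟨0, show 0 < r by omega⟩
    obtain ⟨j, hj⟩ := j
    replace hj : j < r := hj
    by_cases hj' : j < r - 1
    · rw [h1, this j hj']
    · obtain rfl : j = r - 1 := by omega
      push_cast at h3
      linarith
  | C r hr =>
    have : ∀ n (hn : n < r - 1), L ⟨n, show n < r by omega⟩ = L ⟨0, show 0 < r by omega⟩ := by
      intro n hn
      induction n with
      | zero => rfl
      | succ n ih =>
        rw [← ih (by omega)]
        apply key <;> refine (cartanMatrix_C_apply hr _ _).trans ?_ <;> grind
    have h4 := h0 ⟨r - 1, show r - 1 < r by omega⟩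
    obtain ⟨j, hj⟩ := j
    replace hj : j < r := hj
    by_cases hj' : j < r - 1
    · have h2 := this (r - 2) (by omega)
      have h3 := key2 ⟨r - 1, show r - 1 < r by omega⟩ ⟨r - 2, show r - 2 < r by omega⟩ (-2)
        (by refine (cartanMatrix_C_apply hr _ _).trans ?_; grind)
        (by refine (cartanMatrix_C_apply hr _ _).trans ?_; grind)
      push_cast at h3
      rw [this j hj', ← h2]
      change L ⟨r - 1, _⟩ ≤ _
      linarith
    · obtain rfl : j = r - 1 := by omega
      exact le_rfl
  | D r hr =>
    have : ∀ n (hn : n < r - 1), L ⟨n, show n < r by omega⟩ = L ⟨0, show 0 < r by omega⟩ := by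
      intro n hn
      induction n with
      | zero => rfl
      | succ n ih =>
        rw [← ih (by omega)]
        apply key <;> refine (cartanMatrix_D_apply hr _ _).trans ?_ <;> grind
    have h2 := this (r - 3) (by omega)
    have h3 := key ⟨r - 1, show r - 1 < r by omega⟩ ⟨r - 3, show r - 3 < r by omega⟩
        (by refine (cartanMatrix_D_apply hr _ _).trans ?_; grind)
        (by refine (cartanMatrix_D_apply hr _ _).trans ?_; grind)
    have h5 : L (longNode (D r hr)) = L ⟨0, show 0 < r by omega⟩ := this (r - 4) (by omega)
    obtain ⟨j, hj⟩ := j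
    replace hj : j < r := hj
    by_cases hj' : j < r - 1
    · rw [h5, this j hj']
    · obtain rfl : j = r - 1 := by omega
      rw [h5, h3, h2]
  | E6 =>
    change Fin 6 → ℚ at L
    have h2 : L 0 = L 2 := key _ _ rfl rfl
    have h3 := key (2 : Fin 6) (3 : Fin 6) rfl rfl
    have h4 := key (3 : Fin 6) (4 : Fin 6) rfl rfl
    have h5 := key (4 : Fin 6) (5 : Fin 6) rfl rfl
    have h1 := key (3 : Fin 6) (1 : Fin 6) rfl rfl
    have : ∀ j, L j = L 0 := by
      intro j; fin_cases j <;> simp_all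
    exact (this j).ge
  | E7 =>
    change Fin 7 → ℚ at L
    have h2 : L 0 = L 2 := key _ _ rfl rfl
    have h3 := key (2 : Fin 7) (3 : Fin 7) rfl rfl
    have h4 := key (3 : Fin 7) (4 : Fin 7) rfl rfl
    have h5 := key (4 : Fin 7) (5 : Fin 7) rfl rfl
    have h6 := key (5 : Fin 7) (6 : Fin 7) rfl rfl
    have h1 := key (3 : Fin 7) (1 : Fin 7) rfl rfl
    have : ∀ j, L j = L 0 := by
      intro j; fin_cases j <;> simp_all
    exact (this j).ge
  | E8 =>
    change Fin 8 → ℚ at L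
    have h2 : L 0 = L 2 := key _ _ rfl rfl
    have h3 := key (2 : Fin 8) (3 : Fin 8) rfl rfl
    have h4 := key (3 : Fin 8) (4 : Fin 8) rfl rfl
    have h5 := key (4 : Fin 8) (5 : Fin 8) rfl rfl
    have h6 := key (5 : Fin 8) (6 : Fin 8) rfl rfl
    have h7 := key (6 : Fin 8) (7 : Fin 8) rfl rfl
    have h1 := key (3 : Fin 8) (1 : Fin 8) rfl rfl
    have : ∀ j, L j = L 0 := by
      intro j; fin_cases j <;> simp_all
    exact (this j).ge
  | F4 =>
    change Fin 4 → ℚ at L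
    have h2 : L 0 = L 1 := key _ _ rfl rfl
    have h3 := key2 (1 : Fin 4) (2 : Fin 4) (-2) rfl rfl
    have h4 : L 2 = L 3 := key (2 : Fin 4) (3 : Fin 4) rfl rfl
    have h5 := h0 (0 : Fin 4)
    push_cast at h3
    have h6 : ∀ j, L 0 ≤ L j := by
      intro j
      fin_cases j
      · exact le_rfl
      · exact h2.le
      · change L 0 ≤ L 2; linarith
      · change L 0 ≤ L 3; linarith
    exact h6 j
  | G2 =>
    change Fin 2 → ℚ at L
    have h3 := key2 (1 : Fin 2) (0 : Fin 2) (-3) rfl rfl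
    have h5 := h0 (1 : Fin 2)
    push_cast at h3
    have h6 : ∀ j, L 1 ≤ L j := by
      intro j
      fin_cases j
      · change L 1 ≤ L 0; linarith
      · exact le_rfl
    exact h6 j

end SimpleType

/-- The prime powers are collected from subdiagrams: 6 for E₆ from D₄ and the A₂ triples, 12 for E₇
from E₆ and 4, 60 for E₈ from E₇ and 5, 6 for F₄ from B₃ and the A₂ pairs. -/
theorem minIndex_dvd (T : SimpleType) {I : ((Fin T.rank → ℤ) → ℤ) →+ ℤ}
    (hI : IsWeylInvariant T.cartanMatrix I) {d : ℤ}
    (hd : I (fun v ↦ v T.longNode ^ 2) = 2 * d) : (T.minIndex : ℤ) ∣ d := by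
  have h46 : CartanMatrix.E₆.submatrix ![2, 3, 1, 4] ![2, 3, 1, 4] = CartanMatrix.D 4 := by
    decide
  have h67 : CartanMatrix.E₇.submatrix Fin.castSucc Fin.castSucc = CartanMatrix.E₆ := by decide
  have h78 : CartanMatrix.E₈.submatrix Fin.castSucc Fin.castSucc = CartanMatrix.E₇ := by decide
  have h34 : CartanMatrix.F₄.submatrix ![0, 1, 2] ![0, 1, 2] = CartanMatrix.B 3 := by decide
  have hE6 : ∀ {J : ((Fin 6 → ℤ) → ℤ) →+ ℤ}, IsWeylInvariant CartanMatrix.E₆ J →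
      J (fun v ↦ v 0 ^ 2) = 2 * d → 6 ∣ d := by
    intro J hJ hd
    have h3 := three_dvd_of_E6 hJ hd
    have h2 : 2 ∣ d := by
      refine two_dvd_of_D4 (hJ.restrict (congrFun₂ h46)) ?_
      rw [← hd]
      -- The first outer node of D₄ is node 2 of E₆; the squares at nodes 0 and 2 agree because a
      -- simple edge joins them.
      exact (hJ.apply_sq_eq CartanMatrix.E₆_diag (i := 0) (j := 2) rfl rfl).symm
    omega
  have hE7 : ∀ {J : ((Fin 7 → ℤ) → ℤ) →+ ℤ}, IsWeylInvariant CartanMatrix.E₇ J →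
      J (fun v ↦ v 0 ^ 2) = 2 * d → 12 ∣ d := by
    intro J hJ hd
    have h4 := four_dvd_of_E7 hJ hd
    have h6 := hE6 (hJ.restrict (f := Fin.castSucc) (congrFun₂ h67)) hd
    omega
  cases T with
  | A r hr => exact one_dvd _
  | C r hr => exact one_dvd _
  | B r hr =>
    refine two_dvd_of_B3 (hI.restrict (f := fun i : Fin 3 ↦ ⟨r - 3 + i, by
      simp only [SimpleType.rank]; omega⟩) ?_) hd
    intro i j
    fin_cases i <;> fin_cases j <;> refine (SimpleType.cartanMatrix_B_apply hr _ _).trans ?_ <;> simp [CartanMatrix.B] <;> omega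
  | D r hr =>
    refine two_dvd_of_D4 (hI.restrict (f := fun i : Fin 4 ↦ ⟨r - 4 + i, by
      simp only [SimpleType.rank]; omega⟩) ?_) hd
    intro i j
    fin_cases i <;> fin_cases j <;> refine (SimpleType.cartanMatrix_D_apply hr _ _).trans ?_ <;> simp [CartanMatrix.D] <;> omega
  | E6 => exact hE6 hI hd
  | E7 => exact hE7 hI hd
  | E8 =>
    have h12 := hE7 (J := restrictFunctional (Fin.castSucc (n := 7)) I) 
      (hI.restrict (congrFun₂ h78)) hd
    have h5 := five_dvd_of_E8 hI hd
    change (60 : ℤ) ∣ d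
    omega
  | F4 =>
    have h3 := three_dvd_of_F4 hI hd
    have h2 : 2 ∣ d := two_dvd_of_B3 (hI.restrict (congrFun₂ h34)) hd
    change (6 : ℤ) ∣ d
    omega
  | G2 => exact two_dvd_of_G2 hI hd

/-! ### Reflections of weights of finite dimensional representations -/

section Exponential

open Finset

variable {R : Type*} [Ring R] [Module ℚ R] {x y z e : R}

/-- This is the Leibniz expansion of x eⁿ in iterated commutators with e; it stops after the second
one because the third vanishes. The coefficients are binomial, for exponent n + 2. -/
theorem mul_pow_of_commutators (hx : x * e = e * x + y) (hy : y * e = e * y + z)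
    (hz : z * e = e * z) (n : ℕ) : x * e ^ (n + 2) =
      e ^ (n + 2) * x + ((n : ℚ) + 2) • (e ^ (n + 1) * y) +
        (((n : ℚ) + 2) * (n + 1) / 2) • (e ^ n * z) := by
  have hzn : ∀ n, z * e ^ n = e ^ n * z := fun n ↦ (Commute.pow_right hz n)
  have hyn : ∀ n : ℕ, y * e ^ (n + 1) = e ^ (n + 1) * y + ((n : ℚ) + 1) • (e ^ n * z) := by
    intro n
    induction n with
    | zero => simp [hy]
    | succ n ih =>
      rw [pow_succ' e (n + 1), ← mul_assoc, hy, add_mul, mul_assoc, ih, hzn, pow_succ' e n]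
      simp only [mul_add, mul_smul_comm, mul_assoc]
      push_cast
      module
  induction n with
  | zero =>
    rw [zero_add, pow_two, ← mul_assoc, hx, add_mul, hy, mul_assoc, hx]
    simp only [mul_add, mul_assoc, pow_zero, zero_add, pow_one, one_mul]
    push_cast
    module
  | succ n ih =>
    rw [pow_succ' e (n + 2), ← mul_assoc, hx, add_mul, mul_assoc, ih, hyn, pow_succ' e (n + 1),
      pow_succ' e n]
    simp only [mul_add, mul_smul_comm, mul_assoc]
    push_cast
    module

/-- Commutation of `exp e` with `x`, if `[x, e] = y`, `[y, e] = z` and `[z, e] = 0`. -/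
theorem mul_exp_of_commutators (he : IsNilpotent e) (hx : x * e = e * x + y)
    (hy : y * e = e * y + z) (hz : z * e = e * z) :
    x * IsNilpotent.exp e = IsNilpotent.exp e * (x + y + (2⁻¹ : ℚ) • z) := by
  set S : ℕ → R := fun k ↦ ∑ i ∈ range k, ((i.factorial : ℚ)⁻¹) • e ^ i with hS
  have hSs : ∀ k, S (k + 1) = S k + ((k.factorial : ℚ)⁻¹) • e ^ k := fun k ↦ sum_range_succ _ _
  -- The factors n and n(n-1)/2 shift the inverse factorials by one and two, so three consecutive
  -- truncations of the exponential occur. They coincide once the length exceeds the nilpotency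
  -- order.
  have key : ∀ k, x * S (k + 2) = S (k + 2) * x + S (k + 1) * y + (2⁻¹ : ℚ) • (S k * z) := by
    intro k
    induction k with
    | zero =>
      simp only [hS, sum_range_succ, sum_range_zero, mul_add, add_mul]
      simp [hx]
      abel
    | succ k ih =>
      rw [hSs (k + 2), mul_add, ih, hSs (k + 1), hSs k, mul_smul_comm,
        mul_pow_of_commutators hx hy hz]
      rw [smul_add, smul_add, smul_smul, smul_smul]
      have h0 : (k.factorial : ℚ) ≠ 0 := by exact_mod_cast k.factorial_ne_zero
      have h1 : (((k + 2).factorial : ℚ))⁻¹ * ((k : ℚ) + 2) = (((k + 1).factorial : ℚ))⁻¹ := by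
        rw [Nat.factorial_succ (k + 1), Nat.factorial_succ k]
        push_cast
        field_simp
        ring
      have h2 : (((k + 2).factorial : ℚ))⁻¹ * (((k : ℚ) + 2) * (k + 1) / 2) =
          2⁻¹ * ((k.factorial : ℚ))⁻¹ := by
        rw [Nat.factorial_succ (k + 1), Nat.factorial_succ k]
        push_cast
        field_simp
        ring
      rw [h1, h2]
      simp only [add_mul, smul_mul_assoc, smul_add, smul_smul]
      abel
  obtain ⟨k, hk⟩ := he
  have hE : ∀ j, S (k + j) = IsNilpotent.exp e := fun j ↦
    (IsNilpotent.exp_eq_sum (pow_eq_zero_of_le (Nat.le_add_right k j) hk)).symm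
  have := key k
  rw [hE, hE, ← hE 0, add_zero] at this
  rw [← hE 0, add_zero, this, mul_add, mul_add, mul_smul_comm]

/-- Commutation of the reflection `exp e * exp (-f) * exp e` with a semisimple element `x`. -/
theorem mul_reflection {f a b : R} (he : IsNilpotent e) (hf : IsNilpotent f)
    (hxe : x * e = e * x + a) (hxf : x * f = f * x - b)
    (hae : a * e = e * a) (hbf : b * f = f * b) {c : R} (hab : a * f = f * a + c)
    (hce : c * e = e * c + (a + a))
    (hcf : c * f = f * c - (b + b)) :
    x * (IsNilpotent.exp e * IsNilpotent.exp (-f) * IsNilpotent.exp e) =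
      IsNilpotent.exp e * IsNilpotent.exp (-f) * IsNilpotent.exp e * (x - c) := by
  -- In the application a, b, c are α(x)e, α(x)f, α(x)h. The five relations move x, a and c past the
  -- exponentials that they meet, and the remainders combine to x - c.
  have h1 := mul_exp_of_commutators (x := x) (y := a) (z := 0) he hxe (by simp [hae]) (by simp)
  have h2 := mul_exp_of_commutators (x := x) (y := b) (z := 0) (e := -f) hf.neg
    (by rw [mul_neg, neg_mul, hxf]; abel) (by simp [hbf]) (by simp)
  have h3 := mul_exp_of_commutators (x := a) (y := -c) (z := - (b + b)) (e := -f) hf.neg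
    (by simp only [mul_neg, hab, neg_mul]; abel) (by simp only [mul_neg, hcf, neg_mul]; abel)
    (by rw [mul_neg, neg_mul, neg_mul, mul_neg, mul_add, add_mul, hbf])
  have h4 := mul_exp_of_commutators (x := c) (y := a + a) (z := 0) he hce
    (by simp only [add_mul, mul_add, hae]; abel) (by simp)
  have h5 := mul_exp_of_commutators (x := a) (y := 0) (z := 0) he (by simp [hae]) (by simp)
    (by simp)
  simp only [smul_zero, add_zero] at h1 h2 h4 h5
  have h6 : a + -c + (2⁻¹ : ℚ) • (-(b + b)) = a - c - b := by module
  rw [h6] at h3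
  rw [← mul_assoc, ← mul_assoc, h1, mul_assoc (IsNilpotent.exp e), add_mul, h2, h3, ← mul_add,
    ← mul_assoc]
  have h7 : x + b + (a - c - b) = x + a - c := by abel
  rw [h7, mul_assoc _ _ (IsNilpotent.exp e), sub_mul, add_mul, h1, h5, h4, ← mul_add, ← mul_sub,
    ← mul_assoc]
  congr 1
  abel

end Exponential

/-! ### Symmetry and integrality of weights -/

section Reflection

open LieModule LieAlgebra

variable {k L V : Type*} [Field k] [CharZero k] [LieRing L] [LieAlgebra k L]
  {H : LieSubalgebra k L} [IsLieAbelian H]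
  [AddCommGroup V] [Module k V] [LieRingModule L V] [LieModule k L V] [FiniteDimensional k V]

/-- The reflection of a weight. -/
def reflectWeight (α : H →ₗ[k] k) (h : H) (χ : H → k) : H → k := fun x ↦ χ (x - α x • h)

/-- The operator is exp(e) exp(-f) exp(e), which intertwines x with x - α(x)h. Its preservation of
subspaces stable under e and f serves to show that the Chevalley generators generate. -/
theorem exists_map_genWeightSpace_le {α : H →ₗ[k] k} {h : H} {e f : L}
    (t : IsSl2Triple (h : L) e f) (he : ∀ x : H, ⁅(x : L), e⁆ = α x • e)
    (hf : ∀ x : H, ⁅(x : L), f⁆ = - (α x • f))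
    (hen : IsNilpotent (toEnd k L V e)) (hfn : IsNilpotent (toEnd k L V f)) :
    ∃ T : V →ₗ[k] V, Function.Injective T ∧ (∀ χ : H → k, ∀ v ∈ genWeightSpace V χ,
      T v ∈ genWeightSpace V (reflectWeight α h χ)) ∧ ∀ W : Submodule k V,
      (∀ w ∈ W, ⁅e, w⁆ ∈ W) → (∀ w ∈ W, ⁅f, w⁆ ∈ W) → ∀ w ∈ W, T w ∈ W := by
  -- The rational structure is the one induced from `k`, so that the terms of the exponential are
  -- visibly `k`-multiples of powers.
  letI : Module ℚ (Module.End k V) := Module.compHom _ (algebraMap ℚ k)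
  set T : Module.End k V := IsNilpotent.exp (toEnd k L V e) * IsNilpotent.exp (-(toEnd k L V f)) *
    IsNilpotent.exp (toEnd k L V e) with hT
  have hcomm : ∀ x y : L, toEnd k L V x * toEnd k L V y =
      toEnd k L V y * toEnd k L V x + toEnd k L V ⁅x, y⁆ := by
    intro x y
    rw [LieHom.map_lie, Ring.lie_def]
    abel
  have h2e : ⁅(h : L), e⁆ = e + e := by rw [t.lie_h_e_nsmul, two_nsmul]
  have h2f : ⁅(h : L), f⁆ = - (f + f) := by rw [t.lie_h_f_nsmul, two_nsmul]
  have key : ∀ x : H, toEnd k L V x * T = T * toEnd k L V ((x : L) - α x • (h : L)) := by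
    intro x
    rw [map_sub, hT]
    refine mul_reflection (a := α x • toEnd k L V e) (b := α x • toEnd k L V f) hen hfn
      ?_ ?_ ?_ ?_ ?_ ?_ ?_
    · rw [hcomm, he, map_smul]
    · rw [hcomm, hf, map_neg, map_smul, sub_eq_add_neg]
    · rw [smul_mul_assoc, mul_smul_comm]
    · rw [smul_mul_assoc, mul_smul_comm]
    · rw [smul_mul_assoc, mul_smul_comm, map_smul, hcomm, t.lie_e_f, smul_add]
    · rw [map_smul, smul_mul_assoc, mul_smul_comm, hcomm, h2e, map_add, smul_add, smul_add]
    · rw [map_smul, smul_mul_assoc, mul_smul_comm, hcomm, h2f, map_neg, map_add, smul_add,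
        smul_neg, smul_add, sub_eq_add_neg]
  have hu : IsUnit T := ((IsNilpotent.isUnit_exp hen).mul (IsNilpotent.isUnit_exp hfn.neg)).mul
    (IsNilpotent.isUnit_exp hen)
  refine ⟨T, ((Module.End.isUnit_iff _).1 hu).1, fun χ v hv ↦ ?_, fun W hWe hWf ↦ ?_⟩
  rotate_left
  · have hexp : ∀ g : Module.End k V, (∀ w ∈ W, g w ∈ W) → ∀ w ∈ W,
        IsNilpotent.exp g w ∈ W := by
      intro g hg w hw
      rw [IsNilpotent.exp, LinearMap.sum_apply]
      refine Submodule.sum_mem _ fun i hi ↦ ?_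
      clear hi
      change algebraMap ℚ k _ • (g ^ i) w ∈ W
      refine W.smul_mem _ ?_
      induction i with
      | zero => simpa using hw
      | succ i ih => rw [pow_succ', Module.End.mul_apply]; exact hg _ ih
    intro w hw
    exact hexp _ hWe _ (hexp _ (fun u hu ↦ W.neg_mem (hWf u hu)) _ (hexp _ hWe _ hw))
  rw [mem_genWeightSpace] at hv ⊢
  intro x
  obtain ⟨n, hn⟩ := hv (x - α x • h)
  refine ⟨n, ?_⟩
  have h1 : (toEnd k H V x - reflectWeight α h χ x • 1) * T =
      T * (toEnd k H V (x - α x • h) - χ (x - α x • h) • 1) := by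
    have := key x
    rw [sub_mul, mul_sub, smul_mul_assoc, mul_smul_comm, one_mul, mul_one]
    congr 1
  have h2 : (toEnd k H V x - reflectWeight α h χ x • 1) ^ n * T =
      T * (toEnd k H V (x - α x • h) - χ (x - α x • h) • 1) ^ n :=
    (SemiconjBy.pow_right (show SemiconjBy T _ _ from h1.symm) n).symm
  rw [← Module.End.mul_apply, h2, Module.End.mul_apply, hn, map_zero]

theorem reflectWeight_reflectWeight {α : H →ₗ[k] k} {h : H} (hα : α h = 2) (χ : H → k) :
    reflectWeight α h (reflectWeight α h χ) = χ := by
  funext x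
  simp only [reflectWeight]
  congr 1
  simp only [map_sub, map_smul, hα, smul_eq_mul]
  module

/-- The injection gives an inequality of dimensions; applied to the reflected weight it gives the
opposite one, since reflection is an involution. -/
theorem finrank_genWeightSpace_reflectWeight {α : H →ₗ[k] k} {h : H} {e f : L}
    (t : IsSl2Triple (h : L) e f) (he : ∀ x : H, ⁅(x : L), e⁆ = α x • e)
    (hf : ∀ x : H, ⁅(x : L), f⁆ = - (α x • f)) (hα : α h = 2)
    (hen : IsNilpotent (toEnd k L V e)) (hfn : IsNilpotent (toEnd k L V f)) (χ : H → k) :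
    Module.finrank k (genWeightSpace V (reflectWeight α h χ)) =
      Module.finrank k (genWeightSpace V χ) := by
  obtain ⟨T, hT, h1, -⟩ := exists_map_genWeightSpace_le (V := V) t he hf hen hfn
  have h2 : ∀ χ : H → k, Module.finrank k (genWeightSpace V χ) ≤
      Module.finrank k (genWeightSpace V (reflectWeight α h χ)) := by
    intro χ
    refine LinearMap.finrank_le_finrank_of_injective
      (f := T.restrict (p := (genWeightSpace V χ).toSubmodule)
        (q := (genWeightSpace V (reflectWeight α h χ)).toSubmodule) (h1 χ)) ?_
    intro v w hvw
    exact Subtype.ext (hT (congrArg Subtype.val hvw))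
  refine le_antisymm ?_ (h2 χ)
  have := h2 (reflectWeight α h χ)
  rwa [reflectWeight_reflectWeight hα] at this

/-- The values of weights at coroots are integers. -/
theorem exists_int_weight_apply [IsAlgClosed k] {h : H} {e f : L} (t : IsSl2Triple (h : L) e f)
    (hen : IsNilpotent (toEnd k L V e)) (χ : Weight k H V) : ∃ n : ℤ, χ h = n := by
  obtain ⟨v, hv0, hv⟩ := exists_forall_lie_eq_smul k H V χ
  have hvh : ⁅(h : L), v⁆ = χ h • v := hv h
  obtain ⟨N, hN⟩ := hen
  have hex : ∃ n, (toEnd k L V e ^ n) v = 0 := ⟨N, by rw [hN]; rfl⟩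
  classical
  -- Raising the weight vector as long as possible gives a primitive vector after m steps. Its
  -- eigenvalue χ(h) + 2m is a natural number.
  obtain ⟨m, hm0, hm1⟩ := Nat.exists_not_and_succ_of_not_zero_of_exists
    (p := fun n ↦ (toEnd k L V e ^ n) v = 0) (by simpa using hv0) hex
  have hp : t.HasPrimitiveVectorWith ((toEnd k L V e ^ m) v) (χ h + 2 * m) :=
    { ne_zero := hm0
      lie_h := IsSl2Triple.lie_h_pow_toEnd_e t hvh m
      lie_e := by rw [IsSl2Triple.lie_e_pow_toEnd_e, hm1] }
  obtain ⟨n, hn⟩ := hp.exists_nat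
  exact ⟨n - 2 * m, by push_cast; rw [← hn]; ring⟩

end Reflection

/-! ### Chevalley generators -/

section Generators

open LieModule LieAlgebra LieAlgebra.IsKilling Module

variable {k L : Type*} [Field k] [CharZero k] [LieRing L] [LieAlgebra k L]
  [FiniteDimensional k L] [IsKilling k L] {H : LieSubalgebra k L} [H.IsCartanSubalgebra]
  [IsTriangularizable k H L]

/-- The reflection operator of the adjoint representation maps the root space of α injectively into
that of the reflected root. Both are lines, so the map is onto, and it preserves the subalgebra `M`.
-/
theorem rootSpace_le_of_reflect {M : LieSubalgebra k L} {i : H.root} {h e f : L}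
    (t : IsSl2Triple h e f) (he : e ∈ rootSpace H i.1) (hf : f ∈ rootSpace H (-i.1))
    (heM : e ∈ M) (hfM : f ∈ M) {α : H.root}
    (hα : ∀ x ∈ rootSpace H α.1, x ∈ M) :
    ∀ x ∈ rootSpace H ((rootSystem H).reflectionPerm i α).1, x ∈ M := by
  have hi := H.isNonZero_coe_root i
  have hi0 : (i.1 : H → k) ≠ 0 := hi
  obtain rfl := t.h_eq_coroot hi he hf
  obtain ⟨T, hT, h1, h2⟩ := exists_map_genWeightSpace_le (V := L) (α := i.1.toLinear)
    (h := coroot i.1) t (fun x ↦ lie_eq_smul_of_mem_rootSpace he x)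
    (fun x ↦ (lie_eq_smul_of_mem_rootSpace hf x).trans (by simp))
    (LieModule.isNilpotent_toEnd_of_mem_rootSpace L H hi0 he)
    (LieModule.isNilpotent_toEnd_of_mem_rootSpace L H (neg_ne_zero.2 hi0) hf)
  have h3 : (((rootSystem H).reflectionPerm i α).1 : H → k) =
      reflectWeight i.1.toLinear (coroot i.1) α.1 := by
    have h4 := (rootSystem H).root_reflectionPerm i α
    funext x
    have h5 : ((rootSystem H).reflectionPerm i α).1 x = _ := LinearMap.congr_fun h4 x
    rw [h5, RootPairing.reflection_apply]
    simp [reflectWeight, mul_comm]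
  set T' := T.restrict (p := (rootSpace H α.1).toSubmodule)
    (q := (rootSpace H ((rootSystem H).reflectionPerm i α).1).toSubmodule)
    (fun v hv ↦ h3 ▸ h1 α.1 v hv) with hT'
  have hinj : Function.Injective T' := fun v w hvw ↦
    Subtype.ext (hT (congrArg Subtype.val hvw))
  have hfin : finrank k (rootSpace H α.1).toSubmodule =
      finrank k (rootSpace H ((rootSystem H).reflectionPerm i α).1).toSubmodule :=
    (finrank_rootSpace_eq_one _ (H.isNonZero_coe_root α)).trans
      (finrank_rootSpace_eq_one _ (H.isNonZero_coe_root _)).symm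
  have hsurj := (LinearMap.injective_iff_surjective_of_finrank_eq_finrank hfin).1 hinj
  intro x hx
  obtain ⟨y, hy⟩ := hsurj ⟨x, hx⟩
  have hxy : T y.1 = x := congrArg Subtype.val hy
  rw [← hxy]
  exact h2 M.toSubmodule (fun w hw ↦ M.lie_mem heM hw) (fun w hw ↦ M.lie_mem hfM hw) _
    (hα _ y.2)

theorem mem_of_mem_rootSpace {M : LieSubalgebra k L} {α : H.root} {x y : L}
    (hy : y ∈ rootSpace H α.1) (hy0 : y ≠ 0) (hyM : y ∈ M) (hx : x ∈ rootSpace H α.1) :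
    x ∈ M := by
  obtain ⟨c, hc⟩ := (finrank_eq_one_iff_of_nonzero' (⟨y, hy⟩ : rootSpace H α.1)
    (fun h ↦ hy0 (congrArg Subtype.val h))).1
    (finrank_rootSpace_eq_one _ (H.isNonZero_coe_root α)) ⟨x, hx⟩
  have : c • y = x := congrArg Subtype.val hc
  rw [← this]
  exact M.smul_mem c hyM

/-- The Chevalley generators attached to a base of the root system. -/
theorem exists_lieBasis (b : (rootSystem H).Base) {ι : Type*} [Finite ι] (ε : ι ≃ b.support) :
    ∃ B : LieAlgebra.Basis ι H, (∀ i j, B.A i j = b.cartanMatrix (ε i) (ε j)) ∧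
      (∀ i, B.h i = coroot (ε i).1.1) ∧ (∀ i, B.e i ∈ rootSpace H (ε i).1.1) ∧
      ∀ i, B.f i ∈ rootSpace H (-(ε i).1.1) := by
  choose h e f t he hf using fun i ↦
    exists_isSl2Triple_of_weight_isNonZero (H.isNonZero_coe_root (ε i).1)
  have hh : ∀ i, h i = coroot (ε i).1.1 := fun i ↦
    (t i).h_eq_coroot (H.isNonZero_coe_root (ε i).1) (he i) (hf i)
  have hA : ∀ i j, ((b.cartanMatrix (ε i) (ε j) : ℤ) : k) = (ε i).1.1 (coroot (ε j).1.1) := by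
    intro i j
    have := b.algebraMap_cartanMatrixIn_apply ℤ (ε i) (ε j)
    simpa using this
  have hspan : (Submodule.span k (Set.range h)) = H.toSubmodule := by
    have h1 : Set.range h = H.subtype '' ((rootSystem H).coroot '' b.support) := by
      ext x
      simp only [Set.mem_range, Set.mem_image, rootSystem_coroot_apply, exists_exists_and_eq_and]
      constructor
      · rintro ⟨i, rfl⟩
        exact ⟨(ε i).1, (ε i).2, (hh i).symm⟩
      · rintro ⟨a, ha, rfl⟩
        exact ⟨ε.symm ⟨a, ha⟩, by rw [hh]; simp⟩
    rw [h1, ← Submodule.map_span, b.span_coroot_support]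
    simp
  have hhh : ∀ i j, ⁅h i, h j⁆ = 0 := by
    intro i j
    rw [hh, hh]
    have := trivial_lie_zero H H (coroot (ε i).1.1) (coroot (ε j).1.1)
    exact congrArg Subtype.val this
  -- The bracket has weight α_i - α_j, which is neither zero nor a root.
  have hne : ∀ i j, i ≠ j → ⁅e i, f j⁆ = 0 := by
    intro i j hij
    have h1 : ⁅e i, f j⁆ ∈ rootSpace H ((ε i).1.1 + (-(ε j).1.1) : H → k) :=
      lie_mem_genWeightSpace_of_mem_genWeightSpace (he i) (hf j)
    by_contra h2
    have hb : genWeightSpace L ((ε i).1.1 + (-(ε j).1.1) : H → k) ≠ ⊥ := by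
      intro h3
      rw [rootSpace, h3] at h1
      exact h2 (by simpa using h1)
    have hij' : (ε i).1 ≠ (ε j).1 := fun h ↦ hij (ε.injective (Subtype.ext h))
    set w : Weight k H L := ⟨_, hb⟩ with hw
    by_cases hw0 : w.IsZero
    · apply hij'
      have h4 : ((ε i).1.1 : H → k) + (-(ε j).1.1) = 0 := hw0
      apply Subtype.ext
      ext x
      have := congrFun h4 x
      simp only [Pi.add_apply, Pi.neg_apply, Pi.zero_apply] at this
      linear_combination this
    · refine b.sub_notMem_range_root (ε i).2 (ε j).2 ⟨⟨w, by simpa using hw0⟩, ?_⟩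
      ext x
      simp [hw, sub_eq_add_neg]
  set M := LieSubalgebra.lieSpan k L (Set.range e ∪ Set.range f) with hM
  have heM : ∀ i, e i ∈ M := fun i ↦ LieSubalgebra.subset_lieSpan (Or.inl ⟨i, rfl⟩)
  have hfM : ∀ i, f i ∈ M := fun i ↦ LieSubalgebra.subset_lieSpan (Or.inr ⟨i, rfl⟩)
  -- The root and its opposite are treated together, because the induction over reflections also
  -- contains a step that passes to the opposite root.
  have hroot : ∀ α : H.root, (∀ x ∈ rootSpace H α.1, x ∈ M) ∧
      ∀ x ∈ rootSpace H ((rootSystem H).reflectionPerm α α).1, x ∈ M := by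
    intro α
    have hneg' : ∀ i : H.root, (rootSystem H).root ((rootSystem H).reflectionPerm i i) =
        -(rootSystem H).root i := fun i ↦ by
      rw [RootPairing.root_reflectionPerm, RootPairing.reflection_apply_self]
    have hneg : ∀ i : H.root, (((rootSystem H).reflectionPerm i i).1 : H → k) = -i.1 := by
      intro i
      funext x
      exact LinearMap.congr_fun (hneg' i) x
    refine b.induction_reflect α (p := fun α ↦ (∀ x ∈ rootSpace H α.1, x ∈ M) ∧
      ∀ x ∈ rootSpace H ((rootSystem H).reflectionPerm α α).1, x ∈ M) ?_ ?_ ?_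
    · rintro i ⟨h1, h2⟩
      refine ⟨h2, ?_⟩
      have : (rootSystem H).reflectionPerm ((rootSystem H).reflectionPerm i i)
          ((rootSystem H).reflectionPerm i i) = i := by
        apply Subtype.ext
        ext x
        rw [hneg, hneg]
        simp
      rwa [this]
    · intro i hi
      obtain ⟨j, hj⟩ := ε.surjective ⟨i, hi⟩
      have hj' : (ε j).1 = i := congrArg Subtype.val hj
      constructor
      · intro x hx
        exact mem_of_mem_rootSpace (hj' ▸ he j) (t j).e_ne_zero (heM j) hx
      · intro x hx
        refine mem_of_mem_rootSpace ?_ (t j).f_ne_zero (hfM j) hx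
        rw [hneg, ← hj']
        exact hf j
    · rintro α i ⟨h1, h2⟩ hi
      obtain ⟨j, hj⟩ := ε.surjective ⟨i, hi⟩
      obtain rfl : (ε j).1 = i := congrArg Subtype.val hj
      have key : ∀ β : H.root, (∀ x ∈ rootSpace H β.1, x ∈ M) →
          ∀ x ∈ rootSpace H ((rootSystem H).reflectionPerm (ε j).1 β).1, x ∈ M := fun β hβ ↦
        rootSpace_le_of_reflect (t j) (he j) (hf j) (heM j) (hfM j) hβ
      refine ⟨key α h1, ?_⟩
      have h3 := key _ h2
      have : (rootSystem H).reflectionPerm ((rootSystem H).reflectionPerm (ε j).1 α)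
          ((rootSystem H).reflectionPerm (ε j).1 α) = (rootSystem H).reflectionPerm (ε j).1
            ((rootSystem H).reflectionPerm α α) := by
        refine (rootSystem H).root.injective ?_
        rw [hneg', RootPairing.root_reflectionPerm, RootPairing.root_reflectionPerm, hneg', map_neg]
      rwa [this]
  have hhM : ∀ i, h i ∈ M := fun i ↦ by
    rw [← (t i).lie_e_f]
    exact M.lie_mem (heM i) (hfM i)
  refine ⟨{ A := fun i j ↦ b.cartanMatrix (ε i) (ε j), h := h, e := e, f := f,
            cartan_eq_lieSpan := ?_, span_ef := ?_, linInd := ?_, nondegen := ?_, sl2 := t,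
            lie_h_h := hhh, lie_h_e := ?_, lie_h_f := ?_, lie_e_f_ne := hne },
    fun _ _ ↦ rfl, hh, he, hf⟩
  · refine (LieSubalgebra.toSubmodule_injective ?_)
    apply SetLike.coe_injective
    have := LieSubalgebra.coe_lieSpan_eq_span_of_forall_lie_eq_zero (R := k) (L := L)
      (s := Set.range h) (by rintro - ⟨i, rfl⟩ - ⟨j, rfl⟩; exact hhh i j)
    rw [← hspan]
    exact congrArg SetLike.coe this.symm
  · have hHM : ∀ x ∈ H, x ∈ M := by
      intro x hx
      have h1 : x ∈ Submodule.span k (Set.range h) := by rw [hspan]; exact hx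
      have h2 : Submodule.span k (Set.range h) ≤ M.toSubmodule :=
        Submodule.span_le.2 (by rintro - ⟨i, rfl⟩; exact hhM i)
      exact h2 h1
    let N : LieSubmodule k H L :=
      { M.toSubmodule with lie_mem := fun {x y} hy ↦ M.lie_mem (hHM x x.2) hy }
    have hN : N = ⊤ := by
      rw [eq_top_iff, ← cartan_sup_iSup_rootSpace_eq_top (K := k) (H := H)]
      refine sup_le (fun x hx ↦ hHM x hx) (iSup₂_le fun α hα ↦ ?_)
      exact (hroot ⟨α, by simpa using hα⟩).1
    rw [← hM, eq_top_iff]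
    intro x _
    have : x ∈ N := by rw [hN]; trivial
    exact this
  · have h1 := b.toCoweightBasis.linearIndependent.comp ε ε.injective
    have h2 := h1.map' H.subtype (LinearMap.ker_eq_bot.2 Subtype.val_injective)
    have h3 : h = H.subtype ∘ b.toCoweightBasis ∘ ε := by
      funext i
      rw [hh, Function.comp_apply, Function.comp_apply, RootPairing.Base.toCoweightBasis_apply]
      rfl
    rw [h3]
    exact h2
  · classical
    have := Fintype.ofFinite ι
    have h1 := b.cartanMatrix_nondegenerate
    have h2 : (b.cartanMatrix.submatrix ε ε).det ≠ 0 := by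
      rw [Matrix.det_submatrix_equiv_self]
      exact Matrix.nondegenerate_iff_det_ne_zero.1 h1
    exact Matrix.nondegenerate_iff_det_ne_zero.2 h2
  · intro i j
    have := lie_eq_smul_of_mem_rootSpace (he i) (coroot (ε j).1.1)
    rw [hh j, ← Int.cast_smul_eq_zsmul k, hA]
    exact this
  · intro i j
    have := lie_eq_smul_of_mem_rootSpace (hf i) (coroot (ε j).1.1)
    rw [hh j, ← Int.cast_smul_eq_zsmul k, Int.cast_neg, hA]
    exact this

end Generators

/-! ### The weight functional of a representation -/

section WeightFunctional

open LieModule LieAlgebra LieAlgebra.IsKilling Module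

variable {k L ι : Type*} [Field k] [IsAlgClosed k] [CharZero k] [LieRing L] [LieAlgebra k L]
  [FiniteDimensional k L] [IsKilling k L] {H : LieSubalgebra k L} [H.IsCartanSubalgebra]
  [Fintype ι] (B : LieAlgebra.Basis ι H)
  (V : Type*) [AddCommGroup V] [Module k V] [LieRingModule L V] [LieModule k L V]
  [FiniteDimensional k V]

theorem lieBasis_e_mem (i : ι) : B.e i ∈ rootSpace H (B.baseSupp i) :=
  (mem_genWeightSpace _ _ _).mpr fun x ↦ ⟨1, by simp⟩

theorem lieBasis_f_mem (i : ι) : B.f i ∈ rootSpace H (-B.baseSupp i) :=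
  (mem_genWeightSpace _ _ _).mpr fun x ↦ ⟨1, by simp [← eq_neg_iff_add_eq_zero]⟩

theorem lieBasis_baseSupp_ne_zero (i : ι) : (B.baseSupp i : H → k) ≠ 0 := by
  have := B.linearIndependent_baseSupp.ne_zero i
  contrapose! this
  exact LinearMap.coe_injective this

theorem isNilpotent_toEnd_e (i : ι) : IsNilpotent (toEnd k L V (B.e i)) :=
  LieModule.isNilpotent_toEnd_of_mem_rootSpace V H (lieBasis_baseSupp_ne_zero B i)
    (lieBasis_e_mem B i)

theorem isNilpotent_toEnd_f (i : ι) : IsNilpotent (toEnd k L V (B.f i)) :=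
  LieModule.isNilpotent_toEnd_of_mem_rootSpace V H
    (neg_ne_zero.2 (lieBasis_baseSupp_ne_zero B i)) (lieBasis_f_mem B i)

theorem span_lieBasis_h' : Submodule.span k (Set.range B.h') = ⊤ := by
  rw [eq_top_iff]
  rintro ⟨x, hx⟩ -
  have h1 : x ∈ Submodule.span k (Set.range B.h) := by
    have : (x : L) ∈ H.toSubmodule := hx
    rwa [B.coe_cartan_eq_span] at this
  have h2 : Submodule.span k (Set.range B.h) =
      (Submodule.span k (Set.range B.h')).map H.subtype := by
    rw [Submodule.map_span, ← Set.range_comp]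
    rfl
  rw [h2] at h1
  obtain ⟨y, hy, hyx⟩ := h1
  have : y = ⟨x, hx⟩ := Subtype.ext hyx
  rwa [← this]

variable {V} in
theorem exists_weightCoord (χ : Weight k H V) : ∃ v : ι → ℤ, ∀ i, χ (B.h' i) = v i := by
  choose v hv using fun i ↦ exists_int_weight_apply (h := B.h' i) (B.sl2 i)
    (isNilpotent_toEnd_e B V i) χ
  exact ⟨v, hv⟩

variable {V} in
/-- The coordinates of a weight are its values at the simple coroots. -/
noncomputable def weightCoord (χ : Weight k H V) : ι → ℤ := (exists_weightCoord B χ).choose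

variable {V} in
theorem weightCoord_spec (χ : Weight k H V) (i : ι) : χ (B.h' i) = weightCoord B χ i :=
  (exists_weightCoord B χ).choose_spec i

variable {V} in
theorem weight_eq_of_weightCoord_eq {χ χ' : Weight k H V}
    (h : weightCoord B χ = weightCoord B χ') : χ = χ' := by
  have h1 : χ.toLinear = χ'.toLinear := by
    refine LinearMap.ext_on_range (span_lieBasis_h' B) fun i ↦ ?_
    rw [Weight.toLinear_apply, Weight.toLinear_apply, weightCoord_spec B, weightCoord_spec B, h]
  ext x
  exact LinearMap.congr_fun h1 x

/-- The functional `F ↦ ∑ m(χ) F(χ)` given by the weights of a representation. -/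
noncomputable def weightFunctional : ((ι → ℤ) → ℤ) →+ ℤ where
  toFun F := ∑ χ : Weight k H V, (finrank k (genWeightSpace V χ) : ℤ) * F (weightCoord B χ)
  map_zero' := by simp
  map_add' F G := by simp [mul_add, Finset.sum_add_distrib]

theorem weightFunctional_apply (F : (ι → ℤ) → ℤ) : weightFunctional B V F =
    ∑ χ : Weight k H V, (finrank k (genWeightSpace V χ) : ℤ) * F (weightCoord B χ) := rfl

variable {V} in
theorem finrank_genWeightSpace_reflect (i : ι) (χ : H → k) :
    finrank k (genWeightSpace V (reflectWeight (B.baseSupp i) (B.h' i) χ)) =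
      finrank k (genWeightSpace V χ) := by
  have : IsAddTorsionFree L := .of_isTorsionFree k L
  refine finrank_genWeightSpace_reflectWeight (B.sl2 i) (fun x ↦ ?_) (fun x ↦ ?_) ?_
    (isNilpotent_toEnd_e B V i) (isNilpotent_toEnd_f B V i) χ
  · rw [B.baseSupp_apply_smul_e]; rfl
  · rw [B.baseSupp_apply_smul_f, neg_neg]; rfl
  · simp

variable {V} in
/-- The reflection of a weight in a simple root. -/
noncomputable def reflectedWeight (i : ι) (χ : Weight k H V) : Weight k H V :=
  ⟨reflectWeight (B.baseSupp i) (B.h' i) χ, by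
    intro h0
    have h1 := finrank_genWeightSpace_reflect B i (χ : H → k) (V := V)
    rw [h0] at h1
    have h2 := LieModule.zero_lt_finrank_genWeightSpace χ.genWeightSpace_ne_bot
    rw [← h1] at h2
    exact h2.ne' (finrank_bot k V)⟩

variable {V} in
theorem reflectedWeight_involutive (i : ι) :
    Function.Involutive (reflectedWeight B i : Weight k H V → Weight k H V) := by
  have : IsAddTorsionFree L := .of_isTorsionFree k L
  intro χ
  ext x
  exact congrFun (reflectWeight_reflectWeight (α := B.baseSupp i) (h := B.h' i) (by simp) χ) x

variable {V} in
theorem weightCoord_reflectedWeight (i : ι) (χ : Weight k H V) :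
    weightCoord B (reflectedWeight B i χ) = simpleReflection B.A i (weightCoord B χ) := by
  funext j
  have h1 : (reflectedWeight B i χ) (B.h' j) = χ (B.h' j - B.baseSupp i (B.h' j) • B.h' i) := rfl
  have h2 : χ (B.h' j - B.baseSupp i (B.h' j) • B.h' i) =
      χ (B.h' j) - B.baseSupp i (B.h' j) * χ (B.h' i) := by
    rw [← Weight.toLinear_apply, map_sub, map_smul]; rfl
  rw [weightCoord_spec, h2, weightCoord_spec, weightCoord_spec, B.baseSupp_apply_h'] at h1
  have h3 : ((weightCoord B (reflectedWeight B i χ) j : ℤ) : k) =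
      ((weightCoord B χ j - weightCoord B χ i * B.A i j : ℤ) : k) := by
    rw [h1]; push_cast; ring
  exact Int.cast_injective h3

theorem weightFunctional_isWeylInvariant : IsWeylInvariant B.A (weightFunctional B V) := by
  intro i F
  rw [weightFunctional_apply, weightFunctional_apply,
    ← Equiv.sum_comp (reflectedWeight_involutive (V := V) B i).toPerm]
  refine Finset.sum_congr rfl fun χ _ ↦ ?_
  have : IsAddTorsionFree L := .of_isTorsionFree k L
  have h1 : finrank k (genWeightSpace V (reflectedWeight B i χ)) =
      finrank k (genWeightSpace V χ) := finrank_genWeightSpace_reflect B i (χ : H → k) (V := V)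
  rw [Function.Involutive.coe_toPerm, h1, Function.comp_apply, weightCoord_reflectedWeight,
    simpleReflection_simpleReflection (B.A_diag_eq_two i)]

theorem traceForm_h_h (i j : ι) : traceForm k L V (B.h i) (B.h j) =
    (weightFunctional B V (fun v ↦ v i * v j) : ℤ) := by
  have h1 : traceForm k L V (B.h i) (B.h j) = traceForm k H V (B.h' i) (B.h' j) := rfl
  rw [h1, LieModule.traceForm_eq_sum_finrank_nsmul_mul, weightFunctional_apply]
  push_cast
  refine Finset.sum_congr rfl fun χ _ ↦ ?_
  rw [weightCoord_spec B, weightCoord_spec B, nsmul_eq_mul]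

theorem weightFunctional_nonneg {F : (ι → ℤ) → ℤ} (hF : ∀ v, 0 ≤ F v) :
    0 ≤ weightFunctional B V F :=
  Finset.sum_nonneg fun _ _ ↦ mul_nonneg (Int.natCast_nonneg _) (hF _)

theorem eq_zero_of_weightFunctional_eq_zero {F : (ι → ℤ) → ℤ} (hF : ∀ v, 0 ≤ F v)
    (h : weightFunctional B V F = 0) (χ : Weight k H V) : F (weightCoord B χ) = 0 := by
  have h1 := (Finset.sum_eq_zero_iff_of_nonneg
    (fun _ _ ↦ mul_nonneg (Int.natCast_nonneg _) (hF _))).1 h χ (Finset.mem_univ _)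
  have h2 := LieModule.zero_lt_finrank_genWeightSpace χ.genWeightSpace_ne_bot
  have h3 : (finrank k (genWeightSpace V χ) : ℤ) ≠ 0 := by exact_mod_cast h2.ne'
  exact (mul_eq_zero.1 h1).resolve_left h3

/-- The reflection s_i negates v_i, so the weights with v_i ≠ 0 fall into pairs with equal squares.
-/
theorem two_dvd_weightFunctional_sq (i : ι) : 2 ∣ weightFunctional B V (fun v ↦ v i ^ 2) := by
  have : IsAddTorsionFree L := .of_isTorsionFree k L
  have h0 : ∀ v, simpleReflection B.A i v i = - v i := by
    intro v; simp [simpleReflection]; ring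
  refine ⟨_, apply_eq_mul_of_domain _ (weightFunctional_isWeylInvariant B V i) (p := 2)
    (D := fun v ↦ 0 < v i) (fun v ↦ by rw [h0, neg_sq]) (fun v hv ↦ ?_)⟩
  have hv0 : v i ≠ 0 := fun h ↦ hv (by simp [h])
  have h1 : ((simpleReflection B.A i)^[0] v) i = v i := rfl
  have h2 : ((simpleReflection B.A i)^[1] v) i = - v i := h0 v
  rw [Finset.sum_range_succ, Finset.sum_range_one, h1, h2]
  rcases lt_or_gt_of_ne hv0 with h | h
  · rw [if_neg (by omega), if_pos (by omega), zero_add]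
  · rw [if_pos (by omega), if_neg (by omega), add_zero]

/-- A representation on which the functional vanishes at a square is trivial. -/
theorem lie_eq_zero_of_traceForm_eq_zero (h : traceForm k L V = 0) (i : ι) (v : V) :
    ⁅B.e i, v⁆ = 0 := by
  have h0 : ∀ χ : Weight k H V, (χ : H → k) = 0 := by
    intro χ
    have h1 : ∀ j, weightCoord B χ j = 0 := by
      intro j
      have h2 := traceForm_h_h B V j j
      rw [h] at h2
      have h3 : weightFunctional B V (fun v ↦ v j * v j) = 0 := by
        have : ((weightFunctional B V (fun v ↦ v j * v j) : ℤ) : k) = 0 := by rw [← h2]; rfl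
        exact_mod_cast this
      exact mul_self_eq_zero.1 (eq_zero_of_weightFunctional_eq_zero B V
        (fun v ↦ mul_self_nonneg (v j)) h3 χ)
    have h4 : χ.toLinear = 0 := by
      refine LinearMap.ext_on_range (span_lieBasis_h' B) fun j ↦ ?_
      rw [Weight.toLinear_apply, weightCoord_spec B, h1]
      simp
    funext x
    exact LinearMap.congr_fun h4 x
  have htop := iSup_genWeightSpace_eq_top' k H V
  have hv : v ∈ genWeightSpace V (0 : H → k) := by
    have : (⊤ : LieSubmodule k H V) ≤ genWeightSpace V (0 : H → k) := by
      rw [← htop]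
      exact iSup_le fun χ ↦ by rw [h0 χ]
    exact this trivial
  -- Zero is the only weight, so a vector of weight α_i must vanish.
  have h1 : ⁅B.e i, v⁆ ∈ genWeightSpace V ((B.baseSupp i : H → k) + 0) :=
    lie_mem_genWeightSpace_of_mem_genWeightSpace (lieBasis_e_mem B i) hv
  by_contra h2
  have h3 : genWeightSpace V ((B.baseSupp i : H → k) + 0) ≠ ⊥ := by
    intro h4
    rw [h4] at h1
    exact h2 (by simpa using h1)
  have := h0 ⟨_, h3⟩
  rw [Weight.coe_weight_mk, add_zero] at this
  exact lieBasis_baseSupp_ne_zero B i this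

end WeightFunctional

/-! ### The highest root is long -/

section HighestRoot

open RootPairing Set Function

variable {ι R M N : Type*} [Finite ι] [Field R] [CharZero R] [AddCommGroup M] [Module R M]
  [AddCommGroup N] [Module R N] {P : RootPairing ι R M N} [P.IsRootSystem]
  [P.IsCrystallographic] [P.IsReduced] (b : P.Base)

theorem exists_nat_repr_of_mem_closure {x : M} (hx : x ∈ AddSubmonoid.closure (P.root '' b.support))
    (i : b.support) : ∃ n : ℕ, b.toWeightBasis.repr x i = n := by
  classical
  induction hx using AddSubmonoid.closure_induction with
  | mem x hx =>
    obtain ⟨j, hj, rfl⟩ := hx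
    have := b.toWeightBasis_repr_root ⟨j, hj⟩
    simp only at this
    rw [this, Finsupp.single_apply]
    split_ifs
    · exact ⟨1, by simp⟩
    · exact ⟨0, by simp⟩
  | zero => exact ⟨0, by simp⟩
  | add x y _ _ hx hy =>
    obtain ⟨m, hm⟩ := hx
    obtain ⟨n, hn⟩ := hy
    exact ⟨m + n, by simp [hm, hn]⟩

/-- Elements of the cone have natural coefficients in the basis of simple roots, so the cone
contains no pair of nonzero opposite vectors. -/
theorem eq_zero_of_add_eq_zero_of_mem_closure {x y : M}
    (hx : x ∈ AddSubmonoid.closure (P.root '' b.support))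
    (hy : y ∈ AddSubmonoid.closure (P.root '' b.support)) (h : x + y = 0) : x = 0 := by
  refine b.toWeightBasis.repr.map_eq_zero_iff.1 (Finsupp.ext fun i ↦ ?_)
  obtain ⟨m, hm⟩ := exists_nat_repr_of_mem_closure b hx i
  obtain ⟨n, hn⟩ := exists_nat_repr_of_mem_closure b hy i
  have h1 : b.toWeightBasis.repr (x + y) i = 0 := by rw [h]; simp
  rw [map_add, Finsupp.add_apply, hm, hn] at h1
  have h2 : m + n = 0 := by exact_mod_cast h1
  rw [hm, Finsupp.zero_apply]
  have : m = 0 := by omega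
  simp [this]

variable {b} {θ : ι}
  (hθ : ∀ i, P.root θ - P.root i ∈ AddSubmonoid.closure (P.root '' b.support))

-- If the pairing of β with the coroot of θ were n + 2, then θ - β, 2θ and β - (n+1)θ, the last
-- coming from the opposite of the reflected root, would lie in the cone of simple roots. But 2(θ -
-- β) + 2(β - (n+1)θ) + n·2θ = 0 forces β = θ.
include hθ in
theorem pairingIn_le_one_of_highest {i : ι} (hi : i ≠ θ) : P.pairingIn ℤ i θ ≤ 1 := by
  by_contra! hn
  obtain ⟨n, hn'⟩ : ∃ n : ℕ, P.pairingIn ℤ i θ = n + 2 := ⟨(P.pairingIn ℤ i θ - 2).toNat, by omega⟩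
  have hneg : ∀ j, P.root (P.reflectionPerm j j) = - P.root j := fun j ↦ by
    rw [RootPairing.root_reflectionPerm, RootPairing.reflection_apply_self]
  have h1 := hθ (P.reflectionPerm (P.reflectionPerm θ i) (P.reflectionPerm θ i))
  have h2 := hθ (P.reflectionPerm θ θ)
  have h3 := hθ i
  rw [hneg] at h1 h2
  have h4 : P.root (P.reflectionPerm θ i) = P.root i - (n + 2 : ℤ) • P.root θ := by
    rw [RootPairing.root_reflectionPerm, RootPairing.reflection_apply_root' ℤ, hn']
  rw [h4] at h1
  have h5 := eq_zero_of_add_eq_zero_of_mem_closure b (nsmul_mem h3 2)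
    (add_mem (nsmul_mem h1 2) (nsmul_mem h2 n)) (by module)
  have h6 : P.root θ - P.root i = 0 := by
    have : (2 : R) • (P.root θ - P.root i) = 0 := by rw [← h5]; module
    exact (smul_eq_zero.1 this).resolve_left two_ne_zero
  exact hi (P.root.injective (sub_eq_zero.1 h6)).symm

include hθ in
/-- The highest root is long, so its coroot is short. -/
theorem flip_rootLength_le_of_highest [P.IsIrreducible] (B : P.flip.RootPositiveForm ℤ) (i : ι) :
    B.rootLength θ ≤ B.rootLength i := by
  have hneg : ∀ j, P.root (P.reflectionPerm j j) = - P.root j := fun j ↦ by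
    rw [RootPairing.root_reflectionPerm, RootPairing.reflection_apply_self]
  -- By irreducibility some root of the same length as `i` is not orthogonal to `θ`. Unless it is
  -- ±θ, its pairing with θ is ±1, so the coroot of θ is not longer.
  obtain ⟨j, hj, hj'⟩ := P.flip.exists_form_eq_form_and_form_ne_zero B.toInvariantForm θ i
  have hj1 : B.rootLength j = B.rootLength i := by
    apply FaithfulSMul.algebraMap_injective ℤ R
    rw [B.algebraMap_rootLength, B.algebraMap_rootLength]
    exact hj
  rw [← hj1]
  by_cases h1 : j = θ
  · rw [h1]
  by_cases h2 : P.reflectionPerm j j = θ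
  · have := B.rootLength_reflectionPerm_self j
    rw [← this]
    exact le_of_eq (congrArg _ h2.symm)
  have h3 := pairingIn_le_one_of_highest hθ h1
  have h4 := pairingIn_le_one_of_highest hθ h2
  rw [pairingIn_reflectionPerm_self_left] at h4
  have h5 : P.pairingIn ℤ j θ ≠ 0 := by
    intro h
    apply hj'
    refine (B.toInvariantForm.apply_root_root_zero_iff θ j).2 ?_
    have : P.pairing j θ = 0 := by
      rw [← P.algebraMap_pairingIn ℤ, h, map_zero]
    exact this
  refine B.rootLength_le_of_pairingIn_eq (i := θ) (j := j) ?_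
  have h6 : P.flip.pairingIn ℤ θ j = P.pairingIn ℤ j θ := by
    apply FaithfulSMul.algebraMap_injective ℤ R
    rw [algebraMap_pairingIn, algebraMap_pairingIn]
    rfl
  omega

end HighestRoot

/-! ### The Dynkin index -/

section DynkinIndexOfRep

open LieModule LieAlgebra LieAlgebra.IsKilling Module

section Loop

variable {k : Type u} [Field k] {L : Type v} [LieRing L] [LieAlgebra k L]
  {L' : Type w} [LieRing L'] [LieAlgebra k L']

theorem exists_residueForm_eq_one : ∃ f g : LaurentSeries k, residueForm k f g = 1 := by
  refine ⟨HahnSeries.single 1 1, HahnSeries.single (-1) 1, ?_⟩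
  change (HahnSeries.single (-1) (1 : k) *
    LaurentSeries.hasseDeriv k 1 (HahnSeries.single 1 (1 : k))).coeff (-1) = 1
  rw [LaurentSeries.hasseDeriv_single]
  simp

theorem loopMap_tmul (φ : L →ₗ⁅k⁆ L') (f : LaurentSeries k) (X : L) :
    loopMap φ (f ⊗ₜ[k] X) = f ⊗ₜ[k] φ X := rfl

/-- The residue form takes the value 1 at (z, z⁻¹), so proportionality of the cocycles amounts to
proportionality of the bilinear forms. -/
theorem loopCocycle_comp_eq_iff (φ : L →ₗ⁅k⁆ L') (B : LinearMap.BilinForm k L)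
    (B' : LinearMap.BilinForm k L') (c : k) :
    (∀ x y : LoopAlgebra k L, loopCocycle B' (loopMap φ x) (loopMap φ y) = c * loopCocycle B x y) ↔
      ∀ X Y, B' (φ X) (φ Y) = c * B X Y := by
  constructor
  · intro h X Y
    obtain ⟨f, g, hfg⟩ := exists_residueForm_eq_one (k := k)
    have h1 := h (f ⊗ₜ[k] X) (g ⊗ₜ[k] Y)
    have h2 : (g * LaurentSeries.hasseDeriv k 1 f).coeff (-1) = 1 := hfg
    rw [loopMap_tmul, loopMap_tmul, loopCocycle_tmul, loopCocycle_tmul, h2] at h1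
    simpa using h1
  · intro h x y
    induction x using TensorProduct.induction_on with
    | zero => simp
    | add x x' hx hx' => simp only [map_add, LinearMap.add_apply, hx, hx', mul_add]
    | tmul f X =>
      induction y using TensorProduct.induction_on with
      | zero => simp
      | add y y' hy hy' => simp only [map_add, hy, hy', mul_add]
      | tmul g Y =>
        rw [loopMap_tmul, loopMap_tmul, loopCocycle_tmul, loopCocycle_tmul, h, mul_assoc]

end Loop

variable {k : Type u} [Field k] [IsAlgClosed k] [CharZero k]
  {L : Type v} [LieRing L] [LieAlgebra k L] [FiniteDimensional k L] [LieAlgebra.IsSimple k L]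
  {H : LieSubalgebra k L} [H.IsCartanSubalgebra]

/-- Schur's lemma for invariant forms. -/
theorem exists_traceForm_eq_mul (V : Type w) [AddCommGroup V] [Module k V] [LieRingModule L V]
    [LieModule k L V] [FiniteDimensional k V] :
    ∃ c : k, ∀ x y, traceForm k L V x y = c * killingForm k L x y := by
  have hnd : (killingForm k L).Nondegenerate := IsKilling.killingForm_nondegenerate k L
  have : Nontrivial L := LieAlgebra.IsSimple.nontrivial k L
  let Φ : L →ₗ[k] Module.Dual k L := traceForm k L V
  let e : L ≃ₗ[k] Module.Dual k L := (killingForm k L).toDual hnd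
  -- The two forms differ by an endomorphism of `L`. One of its eigenspaces is the ideal `I` below,
  -- by invariance of both forms, hence everything.
  obtain ⟨c, hc⟩ := Module.End.exists_eigenvalue (e.symm.toLinearMap ∘ₗ Φ)
  obtain ⟨x₀, hx₀⟩ := hc.exists_hasEigenvector
  have h0 : ∀ y, traceForm k L V x₀ y = c * killingForm k L x₀ y := by
    intro y
    have h1 : e.symm (Φ x₀) = c • x₀ := hx₀.apply_eq_smul
    have h2 : Φ x₀ = e (c • x₀) := by rw [← h1, LinearEquiv.apply_symm_apply]
    have h3 := LinearMap.congr_fun h2 y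
    rw [map_smul] at h3
    exact h3
  let I : LieIdeal k L :=
    { carrier := {x | ∀ y, traceForm k L V x y = c * killingForm k L x y}
      add_mem' := fun {a b} ha hb y ↦ by
        simp only [Set.mem_ofPred_eq] at ha hb
        rw [map_add, map_add, LinearMap.add_apply, LinearMap.add_apply, ha, hb, mul_add]
      zero_mem' := fun y ↦ by simp
      smul_mem' := fun a x hx y ↦ by
        simp only [Set.mem_ofPred_eq] at hx
        rw [map_smul, map_smul, LinearMap.smul_apply, LinearMap.smul_apply, hx, smul_eq_mul,
          smul_eq_mul, mul_left_comm]
      lie_mem := fun {a x} hx y ↦ by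
        change ∀ y, _ at hx
        rw [← lie_skew, map_neg, map_neg, LinearMap.neg_apply, LinearMap.neg_apply,
          traceForm_apply_lie_apply, killingForm, traceForm_apply_lie_apply, hx]
        simp }
  have hI : I = ⊤ := (LieAlgebra.IsSimple.eq_bot_or_eq_top I).resolve_left fun h ↦ hx₀.2 (by
    have : x₀ ∈ I := h0
    rw [h] at this
    simpa using this)
  refine ⟨c, fun x ↦ ?_⟩
  have : x ∈ I := by rw [hI]; trivial
  exact this

theorem hasDynkinIndex_iff_traceForm (θ : H.root) {V : Type w} [AddCommGroup V] [Module k V]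
    [LieRingModule L V] [LieModule k L V] (ρ : L →ₗ⁅k⁆ sl k V)
    (hρ : ∀ x, (ρ x : Module.End k V) = toEnd k L V x) (c : k) : HasDynkinIndex θ ρ c ↔
      ∀ x y, traceForm k L V x y = c * normalizedForm θ x y := by
  rw [HasDynkinIndex, loopCocycle_comp_eq_iff]
  have : ∀ x y, slForm k V (ρ x) (ρ y) = traceForm k L V x y := by
    intro x y
    change LinearMap.trace k V ((ρ x : Module.End k V) * (ρ y : Module.End k V)) = _
    rw [hρ, hρ]
    rfl
  simp only [this]

theorem normalizedForm_eq_smul_killingForm (θ : H.root) :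
    ∃ a : k, a ≠ 0 ∧ normalizedForm θ = a • killingForm k L := by
  refine ⟨_, fun h ↦ ?_, rfl⟩
  have h1 := (normalizedForm_spec θ).2
  rw [normalizedForm, h] at h1
  simp at h1

variable {b : (rootSystem H).Base} {θ : H.root} {T : SimpleType} {e : Fin T.rank ≃ b.support}

/-- The coroot of `longNode` is shortest among the simple coroots, hence among all coroots, since
each root is conjugate to a simple one. The coroot of θ is also no longer than it, so the squares
agree, and at θ the normalized square is 2. -/
theorem normalizedForm_coroot_longNode (hθ : IsHighestRoot b θ)
    (he : ∀ i j, b.cartanMatrix (e i) (e j) = T.cartanMatrix i j) :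
    normalizedForm θ (coroot (e T.longNode).1.1 : L) (coroot (e T.longNode).1.1 : L) = 2 := by
  let F := (rootSystem H).flip.posRootForm ℤ
  have hF : ∀ α : H.root, ((F.rootLength α : ℤ) : k) =
      killingForm k L (coroot α.1 : L) (coroot α.1 : L) := by
    intro α
    have h1 := F.algebraMap_rootLength α
    have h2 : F.form = (rootSystem H).CorootForm := rfl
    rw [h2, corootForm_rootSystem_eq_killing] at h1
    exact h1
  have h1 : F.rootLength θ ≤ F.rootLength (e T.longNode).1 :=
    flip_rootLength_le_of_highest hθ F _
  have hsym : ∀ i j, (T.cartanMatrix i j : ℚ) * (F.rootLength (e i).1 : ℚ) =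
      T.cartanMatrix j i * (F.rootLength (e j).1 : ℚ) := by
    intro i j
    have h2 := F.pairingIn_mul_eq_pairingIn_mul_swap (e i).1 (e j).1
    have h3 : ∀ i j, (rootSystem H).flip.pairingIn ℤ (e j).1 (e i).1 = T.cartanMatrix i j := by
      intro i j
      rw [← he i j, RootPairing.Base.cartanMatrix, RootPairing.Base.cartanMatrixIn]
      apply FaithfulSMul.algebraMap_injective ℤ k
      simp only [Matrix.of_apply, RootPairing.algebraMap_pairingIn]
      rfl
    rw [h3, h3] at h2
    exact_mod_cast h2
  have hle : ∀ α : H.root, F.rootLength (e T.longNode).1 ≤ F.rootLength α := by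
    intro α
    refine b.induction_reflect α (p := fun α ↦ F.rootLength (e T.longNode).1 ≤ F.rootLength α)
      ?_ ?_ ?_
    · intro α hα
      have := F.rootLength_reflectionPerm_self α
      exact hα.trans (le_of_eq this.symm)
    · intro i hi
      obtain ⟨j, hj⟩ := e.surjective ⟨i, hi⟩
      have hj' : (e j).1 = i := congrArg Subtype.val hj
      have := T.le_of_symmetrizes (L := fun i ↦ (F.rootLength (e i).1 : ℚ))
        (fun i ↦ by exact_mod_cast F.rootLength_pos _) hsym j
      rw [← hj']
      exact_mod_cast this
    · intro α i hα _
      have : F.rootLength ((rootSystem H).reflectionPerm i α) = F.rootLength α := by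
        apply FaithfulSMul.algebraMap_injective ℤ k
        rw [F.algebraMap_rootLength, F.algebraMap_rootLength]
        have h2 := F.toInvariantForm.apply_reflection_reflection i
          ((rootSystem H).flip.root α) ((rootSystem H).flip.root α)
        rw [← RootPairing.root_reflectionPerm] at h2
        exact h2
      rw [this]
      exact hα
  have h2 : F.rootLength (e T.longNode).1 = F.rootLength θ := le_antisymm (hle θ) h1
  have h3 := (normalizedForm_spec θ).2
  rw [normalizedForm, LinearMap.smul_apply, LinearMap.smul_apply, ← hF] at h3 ⊢
  rw [h2]
  exact h3

end DynkinIndexOfRep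

/-! ### Integrality and divisibility of the index of a representation -/

section DynkinIndexOfModule

open LieModule LieAlgebra LieAlgebra.IsKilling Module

variable {k : Type u} [Field k] [IsAlgClosed k] [CharZero k]
  {L : Type v} [LieRing L] [LieAlgebra k L] [FiniteDimensional k L] [LieAlgebra.IsSimple k L]
  {H : LieSubalgebra k L} [H.IsCartanSubalgebra]
  {b : (rootSystem H).Base} {θ : H.root} {T : SimpleType} {e : Fin T.rank ≃ b.support}

/-- The Lie ring module given by a representation. -/
noncomputable abbrev lieRingModuleOfRep {V : Type w} [AddCommGroup V] [Module k V] (ρ : L →ₗ⁅k⁆ sl k V) :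
    LieRingModule L V :=
  LieRingModule.compLieHom V ((sl k V).incl.comp ρ)

theorem lieModuleOfRep {V : Type w} [AddCommGroup V] [Module k V] (ρ : L →ₗ⁅k⁆ sl k V) :
    letI := lieRingModuleOfRep ρ
    LieModule k L V ∧ ∀ x (v : V), (ρ x : Module.End k V) v = ⁅x, v⁆ := by
  let _ := lieRingModuleOfRep ρ
  exact ⟨LieModule.compLieHom V ((sl k V).incl.comp ρ), fun _ _ ↦ rfl⟩

/-- The action on a finite dimensional module of a simple Lie algebra, as a representation. -/
noncomputable def repOfLieModule (L : Type v) [LieRing L] [LieAlgebra k L] [FiniteDimensional k L]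
    [LieAlgebra.IsSimple k L] (V : Type w) [AddCommGroup V] [Module k V] [LieRingModule L V]
    [LieModule k L V] [FiniteDimensional k V] : L →ₗ⁅k⁆ sl k V :=
  { toFun := fun x ↦ ⟨toEnd k L V x, by
      -- A simple algebra equals its derived algebra, whose elements act with trace zero.
      have h1 : lowerCentralSeries k L L 1 = ⊤ :=
        (LieAlgebra.IsSimple.eq_bot_or_eq_top _).resolve_left fun h2 ↦ by
          refine LieAlgebra.IsSimple.non_abelian k (L := L) ⟨fun y z ↦ ?_⟩
          have h3 : ⁅y, z⁆ ∈ lowerCentralSeries k L L 1 := by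
            rw [lowerCentralSeries_succ]
            exact LieSubmodule.lie_mem_lie (LieSubmodule.mem_top y) (LieSubmodule.mem_top z)
          rwa [h2, LieSubmodule.mem_bot] at h3
      exact LieModule.trace_toEnd_eq_zero_of_mem_lcs k L V (k := 1) le_rfl (by rw [h1]; trivial)⟩
    map_add' := fun x y ↦ Subtype.ext (map_add _ x y)
    map_smul' := fun a x ↦ Subtype.ext (map_smul _ a x)
    map_lie' := fun {x y} ↦ Subtype.ext ((toEnd k L V).map_lie x y) }

theorem coe_repOfLieModule (V : Type w) [AddCommGroup V] [Module k V] [LieRingModule L V]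
    [LieModule k L V] [FiniteDimensional k V] (x : L) (v : V) :
    (repOfLieModule (k := k) L V x : Module.End k V) v = ⁅x, v⁆ := rfl

/-- The trace form is evaluated at the coroot of the long node, where it is the sum of squares over
weights and the normalized form is 2. If d = 0 the trace form vanishes, so the kernel contains a
raising operator and is everything by simplicity. -/
theorem exists_nat_hasDynkinIndex_iff (hθ : IsHighestRoot b θ)
    (he : ∀ i j, b.cartanMatrix (e i) (e j) = T.cartanMatrix i j)
    (B : LieAlgebra.Basis (Fin T.rank) H) (hA : ∀ i j, B.A i j = T.cartanMatrix i j)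
    (hh : ∀ i, B.h i = coroot (e i).1.1)
    {V : Type w} [AddCommGroup V] [Module k V] [LieRingModule L V] [LieModule k L V]
    [FiniteDimensional k V] (ρ : L →ₗ⁅k⁆ sl k V)
    (hρ : ∀ x (v : V), (ρ x : Module.End k V) v = ⁅x, v⁆) :
    ∃ d : ℕ, weightFunctional B V (fun v ↦ v T.longNode ^ 2) = 2 * d ∧
      (∀ c : k, HasDynkinIndex θ ρ c ↔ c = (d : k)) ∧ T.minIndex ∣ d ∧ (ρ ≠ 0 → d ≠ 0) := by
  obtain ⟨n, hn⟩ := two_dvd_weightFunctional_sq (k := k) B V T.longNode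
  have hn0 : 0 ≤ weightFunctional B V (fun v ↦ v T.longNode ^ 2) :=
    weightFunctional_nonneg (k := k) B V fun v ↦ sq_nonneg _
  lift n to ℕ using (by omega) with d
  have h2 : normalizedForm θ (B.h T.longNode) (B.h T.longNode) = 2 := by
    rw [hh]; exact normalizedForm_coroot_longNode hθ he
  have hℓ : traceForm k L V (B.h T.longNode) (B.h T.longNode) = d * 2 := by
    rw [traceForm_h_h]
    have : (fun v : Fin T.rank → ℤ ↦ v T.longNode * v T.longNode) = fun v ↦ v T.longNode ^ 2 := by
      funext v; ring
    rw [this, hn]; push_cast; ring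
  have key : ∀ x y, traceForm k L V x y = d * normalizedForm θ x y := by
    obtain ⟨c, hc⟩ := exists_traceForm_eq_mul (k := k) (L := L) V
    obtain ⟨a, ha, hκ⟩ := normalizedForm_eq_smul_killingForm θ
    have hc' : ∀ x y, traceForm k L V x y = (c * a⁻¹) * normalizedForm θ x y := by
      intro x y
      rw [hc, hκ, LinearMap.smul_apply, LinearMap.smul_apply, smul_eq_mul]
      field_simp
    rw [hc', h2] at hℓ
    rw [mul_right_cancel₀ two_ne_zero hℓ] at hc'
    exact hc'
  have hρ' : ∀ x, (ρ x : Module.End k V) = toEnd k L V x := fun x ↦ LinearMap.ext (hρ x)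
  refine ⟨d, hn, fun c ↦ ?_, ?_, fun h0 hd ↦ h0 ?_⟩
  · rw [hasDynkinIndex_iff_traceForm θ ρ hρ']
    constructor
    · intro h
      have h3 := h (B.h T.longNode) (B.h T.longNode)
      rw [key, h2] at h3
      exact (mul_right_cancel₀ two_ne_zero h3).symm
    · rintro rfl
      exact key
  · have hI := weightFunctional_isWeylInvariant B V
    rw [show B.A = T.cartanMatrix from Matrix.ext hA] at hI
    exact_mod_cast minIndex_dvd T hI hn
  · have ht : traceForm k L V = 0 := by
      ext x y
      rw [key, hd]; simp
    have hker : ρ.ker = ⊤ := (LieAlgebra.IsSimple.eq_bot_or_eq_top (R := k) _).resolve_left fun h3 ↦ by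
      have h4 : B.e T.longNode ∈ ρ.ker := by
        rw [LieHom.mem_ker]
        refine Subtype.ext (LinearMap.ext fun v ↦ ?_)
        rw [hρ, lie_eq_zero_of_traceForm_eq_zero B V ht]
        rfl
      rw [h3, LieSubmodule.mem_bot] at h4
      exact (B.sl2 T.longNode).e_ne_zero h4
    ext1 x
    have : x ∈ ρ.ker := by rw [hker]; trivial
    exact LieHom.mem_ker.1 this

end DynkinIndexOfModule

/-! ### Modules generated by a highest weight vector -/

section HighestWeight

open LieModule LieAlgebra LieAlgebra.IsKilling Module

variable {k L ι : Type*} [Field k] [CharZero k] [LieRing L] [LieAlgebra k L]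
  {H : LieSubalgebra k L} [Fintype ι] (B : LieAlgebra.Basis ι H)
  {V : Type*} [AddCommGroup V] [Module k V] [LieRingModule L V] [LieModule k L V]

/-- A subspace stable under the Chevalley generators is stable. -/
theorem lie_mem_of_lie_mem_generators {W : Submodule k V} (he : ∀ i, ∀ w ∈ W, ⁅B.e i, w⁆ ∈ W)
    (hf : ∀ i, ∀ w ∈ W, ⁅B.f i, w⁆ ∈ W) (x : L) : ∀ w ∈ W, ⁅x, w⁆ ∈ W := by
  let S : LieSubalgebra k L :=
    { carrier := {x | ∀ w ∈ W, ⁅x, w⁆ ∈ W}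
      add_mem' := fun {x y} hx hy w hw ↦ by
        rw [add_lie]; exact W.add_mem (hx w hw) (hy w hw)
      zero_mem' := fun w _ ↦ by rw [zero_lie]; exact W.zero_mem
      smul_mem' := fun c x hx w hw ↦ by
        rw [smul_lie]; exact W.smul_mem c (hx w hw)
      lie_mem' := fun {x y} hx hy w hw ↦ by
        rw [lie_lie]; exact W.sub_mem (hx _ (hy w hw)) (hy _ (hx w hw)) }
  have hS : (⊤ : LieSubalgebra k L) ≤ S := by
    rw [← B.span_ef, LieSubalgebra.lieSpan_le]
    rintro - (⟨i, rfl⟩ | ⟨i, rfl⟩)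
    · exact he i
    · exact hf i
  exact hS (LieSubalgebra.mem_top x)

/-- The vector obtained from `v` by the application of lowering operators. -/
def loweringWord (v : V) (w : List ι) : V := w.foldr (fun i x ↦ ⁅B.f i, x⁆) v

/-- The weight of `loweringWord B v w` if `v` has weight `χ`. -/
noncomputable def loweredWeight (χ : Module.Dual k H) (w : List ι) : Module.Dual k H :=
  w.foldr (fun i x ↦ x - B.baseSupp i) χ

/-- The coordinates of `loweredWeight B χ w` if `c` are those of `χ`. -/
def loweredCoord (A : Matrix ι ι ℤ) (c : ι → ℤ) (w : List ι) : ι → ℤ := w.foldr (fun i x ↦ x - A i) c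

theorem loweredWeight_apply {χ : Module.Dual k H} {c : ι → ℤ} (hc : ∀ i, χ (B.h' i) = c i)
    (w : List ι) (j : ι) : loweredWeight B χ w (B.h' j) = loweredCoord B.A c w j := by
  induction w with
  | nil => exact hc j
  | cons i w ih =>
    change loweredWeight B χ w (B.h' j) - B.baseSupp i (B.h' j) =
      ((loweredCoord B.A c w j - B.A i j : ℤ) : k)
    rw [ih, B.baseSupp_apply_h']; push_cast; rfl

variable {v₀ : V} {χ₀ : Module.Dual k H}

theorem lie_loweringWord (hh : ∀ h : H, ⁅(h : L), v₀⁆ = χ₀ h • v₀) (w : List ι) (h : H) :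
    ⁅(h : L), loweringWord B v₀ w⁆ = loweredWeight B χ₀ w h • loweringWord B v₀ w := by
  induction w with
  | nil => exact hh h
  | cons i w ih =>
    change ⁅(h : L), ⁅B.f i, loweringWord B v₀ w⁆⁆ =
      (loweredWeight B χ₀ w - B.baseSupp i) h • ⁅B.f i, loweringWord B v₀ w⁆
    have h1 : ⁅(h : L), B.f i⁆ = -(B.baseSupp i h • B.f i) := by
      rw [B.baseSupp_apply_smul_f, neg_neg]; rfl
    rw [leibniz_lie, ih, h1, neg_lie, smul_lie, lie_smul, LinearMap.sub_apply, sub_smul]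
    abel

theorem loweringWord_mem_genWeightSpace [LieRing.IsNilpotent H]
    (hh : ∀ h : H, ⁅(h : L), v₀⁆ = χ₀ h • v₀) (w : List ι) :
    loweringWord B v₀ w ∈ genWeightSpace V (loweredWeight B χ₀ w : H → k) :=
  (mem_genWeightSpace _ _ _).mpr fun x ↦ ⟨1, by
    have := lie_loweringWord B hh w x
    rw [pow_one, LinearMap.sub_apply, LinearMap.smul_apply, toEnd_apply_apply, Module.End.one_apply,
      sub_eq_zero]
    exact this⟩

/-- The words span a stable subspace. -/
theorem lie_mem_span_loweringWord (hh : ∀ h : H, ⁅(h : L), v₀⁆ = χ₀ h • v₀)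
    (he : ∀ i, ⁅B.e i, v₀⁆ = 0) (x : L) :
    ∀ v ∈ Submodule.span k (Set.range (loweringWord B v₀)),
      ⁅x, v⁆ ∈ Submodule.span k (Set.range (loweringWord B v₀)) := by
  classical
  have hf : ∀ i, ∀ v ∈ Submodule.span k (Set.range (loweringWord B v₀)),
      ⁅B.f i, v⁆ ∈ Submodule.span k (Set.range (loweringWord B v₀)) := by
    intro i v hv
    induction hv using Submodule.span_induction with
    | mem v hv =>
      obtain ⟨w, rfl⟩ := hv
      exact Submodule.subset_span ⟨i :: w, rfl⟩
    | zero => rw [lie_zero]; exact zero_mem _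
    | add v v' _ _ h h' => rw [lie_add]; exact add_mem h h'
    | smul c v _ h => rw [lie_smul]; exact Submodule.smul_mem _ c h
  refine lie_mem_of_lie_mem_generators B (fun i v hv ↦ ?_) hf x
  induction hv using Submodule.span_induction with
  | mem v hv =>
    obtain ⟨w, rfl⟩ := hv
    induction w with
    | nil =>
      change ⁅B.e i, v₀⁆ ∈ _
      rw [he]; exact zero_mem _
    | cons j w ih =>
      change ⁅B.e i, ⁅B.f j, loweringWord B v₀ w⁆⁆ ∈ _
      rw [leibniz_lie]
      refine add_mem ?_ (hf j _ ih)
      by_cases hij : i = j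
      · subst hij
        rw [(B.sl2 i).lie_e_f]
        have := lie_loweringWord B hh w (B.h' i)
        change ⁅B.h i, _⁆ = _ at this
        rw [this]
        exact Submodule.smul_mem _ _ (Submodule.subset_span ⟨w, rfl⟩)
      · rw [B.lie_e_f_ne i j hij, zero_lie]; exact zero_mem _
  | zero => rw [lie_zero]; exact zero_mem _
  | add v v' _ _ h h' => rw [lie_add]; exact add_mem h h'
  | smul c v _ h => rw [lie_smul]; exact Submodule.smul_mem _ c h

theorem loweredCoord_eq [DecidableEq ι] (A : Matrix ι ι ℤ) (c : ι → ℤ) (w : List ι) :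
    loweredCoord A c w = c - Matrix.vecMul (fun i ↦ (w.count i : ℤ)) A := by
  induction w with
  | nil =>
    have : (fun i : ι ↦ ((([] : List ι).count i : ℕ) : ℤ)) = 0 := by funext i; simp
    rw [this, Matrix.zero_vecMul, sub_zero]; rfl
  | cons i w ih =>
    change loweredCoord A c w - A i = _
    have : (fun j ↦ (((i :: w).count j : ℕ) : ℤ)) = (fun j ↦ ((w.count j : ℕ) : ℤ)) +
        Pi.single i 1 := by
      funext j
      rw [List.count_cons, Pi.add_apply, Pi.single_apply]
      by_cases h : i = j
      · simp [h]
      · simp [h, Ne.symm h]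
    rw [this, Matrix.add_vecMul, Matrix.single_one_vecMul, ih]
    have : A.row i = A i := rfl
    rw [this]; abel

theorem sum_count_eq_length [DecidableEq ι] (w : List ι) : ∑ i, (w.count i : ℤ) = w.length := by
  have := Multiset.sum_count_eq_card (s := Finset.univ) (m := (w : Multiset ι)) (by simp)
  simp only [Multiset.coe_count, Multiset.coe_card] at this
  exact_mod_cast this

/-- The weight determines the number of lowering operators. -/
theorem length_eq_of_loweredCoord_eq {A : Matrix ι ι ℤ} (hA : A.Nondegenerate) {c : ι → ℤ}
    {w w' : List ι} {i : ι} {t : ℤ} (h : loweredCoord A c w' = loweredCoord A c w - t • A i) :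
    (w'.length : ℤ) = w.length + t := by
  classical
  rw [loweredCoord_eq, loweredCoord_eq, sub_sub, sub_right_inj] at h
  have h1 : Matrix.vecMul (fun i ↦ (w'.count i : ℤ)) A =
      Matrix.vecMul ((fun i ↦ (w.count i : ℤ)) + t • Pi.single i 1) A := by
    rw [Matrix.add_vecMul, Matrix.smul_vecMul, Matrix.single_one_vecMul]
    exact h
  have h2 : (fun i ↦ (w'.count i : ℤ)) = (fun i ↦ (w.count i : ℤ)) + t • Pi.single i 1 :=
    sub_eq_zero.1 (Matrix.eq_zero_of_vecMul_eq_zero hA.det_ne_zero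
      (by rw [Matrix.sub_vecMul, h1, sub_self]))
  rw [← sum_count_eq_length, ← sum_count_eq_length]
  have h3 := congrArg (fun f ↦ ∑ i, f i) h2
  simpa [Finset.sum_add_distrib, Pi.single_apply] using h3

end HighestWeight

/-! ### Characters of quasi-minuscule representations -/

section Character

open LieModule LieAlgebra LieAlgebra.IsKilling Module

/-- `v` is obtained from `c` by a sequence of simple reflections. -/
def WeylReachable {ι : Type*} (A : Matrix ι ι ℤ) : (ι → ℤ) → (ι → ℤ) → Prop :=
  Relation.ReflTransGen fun v w ↦ ∃ i, w = simpleReflection A i v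

/-- The vectors `w j` form the orbit of `c` under the Weyl group, and their coordinates are at most
one in absolute value, except for the simple roots and their negatives. -/
structure IsQuasiMinuscule {ι J : Type*} (A : Matrix ι ι ℤ) (c : ι → ℤ) (w : J → ι → ℤ) : Prop where
  injective : Function.Injective w
  exists_eq : ∃ j, w j = c
  ne_zero : c ≠ 0
  reachable : ∀ j, WeylReachable A c (w j)
  reflected : ∀ j i, ∃ j', w j' = simpleReflection A i (w j)
  small : ∀ j i, |w j i| ≤ 1 ∨ w j = A i ∨ w j = - A i

section

variable {ι J : Type*} {A : Matrix ι ι ℤ} {c : ι → ℤ} {w : J → ι → ℤ}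

theorem WeylReachable.ne_zero (hA : ∀ i, A i i = 2) (hc : c ≠ 0) {v : ι → ℤ}
    (h : WeylReachable A c v) : v ≠ 0 := by
  induction h with
  | refl => exact hc
  | @tail u v _ h ih =>
    obtain ⟨i, rfl⟩ := h
    intro h0
    apply ih
    rw [← simpleReflection_simpleReflection (hA i) u, h0]
    funext j
    simp [simpleReflection]

/-- A coordinate larger than 1 can only be the 2 of a simple root. Therefore the points between w_j
and its reflection are the reflection itself or, for a simple root, zero. -/
theorem IsQuasiMinuscule.saturated (hw : IsQuasiMinuscule A c w) (hA : ∀ i, A i i = 2) (j : J)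
    (i : ι) (t : ℤ) (h1 : 1 ≤ t) (ht : t ≤ w j i) :
    w j - t • A i = 0 ∨ ∃ j', w j' = w j - t • A i := by
  rcases eq_or_lt_of_le ht with ht' | ht'
  · obtain ⟨j', hj'⟩ := hw.reflected j i
    refine Or.inr ⟨j', hj'.trans ?_⟩
    rw [ht']
    rfl
  · left
    rcases hw.small j i with h | h | h
    · have := le_abs_self (w j i)
      omega
    · have h2 := congrFun h i
      rw [hA] at h2
      obtain rfl : t = 1 := by omega
      rw [h, one_smul, sub_self]
    · have h2 := congrFun h i
      rw [Pi.neg_apply, hA] at h2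
      omega

end

variable {k L ι : Type*} [Field k] [IsAlgClosed k] [CharZero k] [LieRing L] [LieAlgebra k L]
  [FiniteDimensional k L] [IsKilling k L] {H : LieSubalgebra k L} [H.IsCartanSubalgebra]
  [Fintype ι] (B : LieAlgebra.Basis ι H)
  {V : Type*} [AddCommGroup V] [Module k V] [LieRingModule L V] [LieModule k L V]
  [FiniteDimensional k V]
  {v₀ : V} {χ₀ : Module.Dual k H}

section

variable (hv₀ : v₀ ≠ 0) (hh : ∀ h : H, ⁅(h : L), v₀⁆ = χ₀ h • v₀)
  (htop : Submodule.span k (Set.range (loweringWord B v₀)) = ⊤)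

-- Otherwise the words, which span, would all lie in the sum of the other weight spaces, contrary to
-- independence.
include hh htop in
theorem exists_loweringWord_ne_zero (χ : Weight k H V) :
    ∃ w, loweringWord B v₀ w ≠ 0 ∧ (loweredWeight B χ₀ w : H → k) = χ := by
  by_contra! hw
  have h1 := iSupIndep_genWeightSpace k H V (χ : H → k)
  set N : LieSubmodule k H V := ⨆ χ', ⨆ (_ : χ' ≠ (χ : H → k)), genWeightSpace V χ' with hN
  have h2 : (⊤ : Submodule k V) ≤ N.toSubmodule := by
    rw [← htop, Submodule.span_le]
    rintro - ⟨w, rfl⟩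
    by_cases h0 : loweringWord B v₀ w = 0
    · rw [h0]; exact N.zero_mem
    · have h3 : genWeightSpace V (loweredWeight B χ₀ w : H → k) ≤ N :=
        le_iSup₂_of_le _ (hw w h0) le_rfl
      exact h3 (loweringWord_mem_genWeightSpace B hh w)
  have h3 : N = ⊤ := by
    rw [eq_top_iff]; exact h2
  rw [h3, disjoint_top] at h1
  exact χ.2 h1

-- Nondegeneracy of the Cartan matrix makes the weight determine the length of the word, so only the
-- empty word has the highest weight.
include hv₀ hh htop in
theorem finrank_genWeightSpace_highest : finrank k (genWeightSpace V (χ₀ : H → k)) = 1 := by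
  have h1 := iSupIndep_genWeightSpace k H V (χ₀ : H → k)
  set N : LieSubmodule k H V := ⨆ χ', ⨆ (_ : χ' ≠ (χ₀ : H → k)), genWeightSpace V χ' with hN
  have hmem : v₀ ∈ genWeightSpace V (χ₀ : H → k) := loweringWord_mem_genWeightSpace B hh []
  have hne : ∀ i w, (loweredWeight B χ₀ (i :: w) : H → k) ≠ χ₀ := by
    intro i w h
    have h3 : loweredCoord B.A 0 (i :: w) = loweredCoord B.A 0 [] - (0 : ℤ) • B.A i := by
      funext j
      have h4 := loweredWeight_apply B (χ := 0) (c := 0) (by simp) (i :: w) j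
      have h5 : loweredWeight B 0 (i :: w) = 0 := by
        have h6 : ∀ w, loweredWeight B 0 w = loweredWeight B χ₀ w - χ₀ := by
          intro w
          induction w with
          | nil => exact (sub_self χ₀).symm
          | cons i w ih =>
            change loweredWeight B 0 w - _ = loweredWeight B χ₀ w - _ - _
            rw [ih]; abel
        rw [h6, sub_eq_zero]
        exact LinearMap.coe_injective h
      rw [h5] at h4
      rw [zero_smul, sub_zero]
      change _ = (0 : ℤ)
      have : ((loweredCoord B.A 0 (i :: w) j : ℤ) : k) = 0 := h4.symm
      exact_mod_cast this
    have h4 := length_eq_of_loweredCoord_eq B.nondegen h3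
    simp only [List.length_cons, List.length_nil] at h4
    omega
  have h2 : ∀ x : V, ∃ a : k, x - a • v₀ ∈ N := by
    intro x
    have hx : x ∈ Submodule.span k (Set.range (loweringWord B v₀)) := by rw [htop]; trivial
    induction hx using Submodule.span_induction with
    | mem x hx =>
      obtain ⟨w, rfl⟩ := hx
      cases w with
      | nil =>
        refine ⟨1, ?_⟩
        rw [one_smul]
        change v₀ - v₀ ∈ N
        rw [sub_self]; exact N.zero_mem
      | cons i w =>
        refine ⟨0, ?_⟩
        rw [zero_smul, sub_zero]
        have h3 : genWeightSpace V (loweredWeight B χ₀ (i :: w) : H → k) ≤ N :=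
          le_iSup₂_of_le _ (hne i w) le_rfl
        exact h3 (loweringWord_mem_genWeightSpace B hh _)
    | zero => exact ⟨0, by simp⟩
    | add x y _ _ hx hy =>
      obtain ⟨a, ha⟩ := hx
      obtain ⟨b, hb⟩ := hy
      refine ⟨a + b, ?_⟩
      have := add_mem ha hb
      rwa [show x - a • v₀ + (y - b • v₀) = x + y - (a + b) • v₀ by module] at this
    | smul c x _ hx =>
      obtain ⟨a, ha⟩ := hx
      refine ⟨c * a, ?_⟩
      have := N.smul_mem c ha
      rwa [show c • (x - a • v₀) = c • x - (c * a) • v₀ by module] at this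
  refine finrank_eq_one (⟨v₀, hmem⟩ : genWeightSpace V (χ₀ : H → k)) (fun h ↦ hv₀ ?_) ?_
  · exact congrArg Subtype.val h
  · rintro ⟨x, hx⟩
    obtain ⟨a, ha⟩ := h2 x
    refine ⟨a, Subtype.ext ?_⟩
    have h3 : x - a • v₀ ∈ genWeightSpace V (χ₀ : H → k) := sub_mem hx (SMulMemClass.smul_mem a hmem)
    have h4 : x - a • v₀ ∈ genWeightSpace V (χ₀ : H → k) ⊓ N := ⟨h3, ha⟩
    rw [h1.eq_bot, LieSubmodule.mem_bot, sub_eq_zero] at h4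
    exact h4.symm

end

variable {J : Type*} [Fintype J] {c : ι → ℤ} {w : J → ι → ℤ}

/-- Let y be the weight before the last lowering by α_i. If y_i ≥ 1, the new weight lies on the
string from y to its reflection, and saturation applies. If y_i ≤ 0, the reflection of the new
weight is again a weight, reached by a word shorter by 2 - y_i; by induction it is in the orbit,
being nonzero at i, and saturation leads back. -/
theorem weightCoord_eq_zero_or_of_isQuasiMinuscule (hw : IsQuasiMinuscule B.A c w)
    (hh : ∀ h : H, ⁅(h : L), v₀⁆ = χ₀ h • v₀) (hc : ∀ i, χ₀ (B.h' i) = c i)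
    (htop : Submodule.span k (Set.range (loweringWord B v₀)) = ⊤) :
    ∀ (n : ℕ) (u : List ι), u.length = n → loweringWord B v₀ u ≠ 0 →
      loweredCoord B.A c u = 0 ∨ ∃ j, w j = loweredCoord B.A c u := by
  have : IsAddTorsionFree L := .of_isTorsionFree k L
  intro n
  induction n using Nat.strong_induction_on with
  | _ n ih =>
    intro u hu h0
    cases u with
    | nil => exact Or.inr hw.exists_eq
    | cons i u =>
      have h0' : loweringWord B v₀ u ≠ 0 := by
        intro h
        apply h0
        change ⁅B.f i, loweringWord B v₀ u⁆ = 0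
        rw [h, lie_zero]
      have h1 := ih u.length (by rw [← hu]; simp) u rfl h0'
      set y := loweredCoord B.A c u with hy
      have hx : loweredCoord B.A c (i :: u) = y - B.A i := rfl
      rw [hx]
      by_cases hyi : 1 ≤ y i
      · rcases h1 with h1 | ⟨j, hj⟩
        · rw [h1] at hyi; simp at hyi
        · have := hw.saturated (fun i ↦ B.A_diag_eq_two i) j i 1 le_rfl (by rw [hj]; exact hyi)
          rwa [one_smul, hj] at this
      · let χ : Weight k H V := ⟨(loweredWeight B χ₀ (i :: u) : H → k), by
          intro h2
          have h3 := loweringWord_mem_genWeightSpace B hh (i :: u)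
          rw [h2, LieSubmodule.mem_bot] at h3
          exact h0 h3⟩
        have hχ : weightCoord B χ = y - B.A i := by
          funext j
          have h2 := weightCoord_spec B χ j
          change loweredWeight B χ₀ (i :: u) (B.h' j) = _ at h2
          rw [loweredWeight_apply B hc, hx] at h2
          exact_mod_cast h2.symm
        obtain ⟨u', hu', hu''⟩ := exists_loweringWord_ne_zero B hh htop (reflectedWeight B i χ)
        have hx' : loweredCoord B.A c u' = simpleReflection B.A i (y - B.A i) := by
          rw [← hχ, ← weightCoord_reflectedWeight]
          funext j
          have h2 := weightCoord_spec B (reflectedWeight B i χ) j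
          rw [← hu'', loweredWeight_apply B hc] at h2
          exact_mod_cast h2
        have h3 : simpleReflection B.A i (y - B.A i) = y - B.A i - (y i - 2) • B.A i := by
          funext j
          simp [simpleReflection]
        rw [h3, ← hx] at hx'
        have hlen := length_eq_of_loweredCoord_eq B.nondegen hx'
        have h4 := ih u'.length (by omega) u' rfl hu'
        rw [hx', hx] at h4
        rcases h4 with h4 | ⟨j, hj⟩
        · have h5 := congrFun h4 i
          simp at h5
          omega
        · have h5 := congrFun hj i
          simp only [Pi.sub_apply, Pi.smul_apply, smul_eq_mul, B.A_diag_eq_two] at h5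
          have h6 := hw.saturated (fun i ↦ B.A_diag_eq_two i) j i (2 - y i) (by omega) (by omega)
          rw [hj] at h6
          rwa [show y - B.A i - (y i - 2) • B.A i - (2 - y i) • B.A i = y - B.A i by module] at h6

theorem WeylReachable.eq_of_isWeylInvariant {A : Matrix ι ι ℤ} (hA : ∀ i, A i i = 2)
    {I : ((ι → ℤ) → ℤ) →+ ℤ} (hI : IsWeylInvariant A I) {v : ι → ℤ} (h : WeylReachable A c v) :
    I (fun x ↦ if x = v then 1 else 0) = I (fun x ↦ if x = c then 1 else 0) := by
  classical
  induction h with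
  | refl => rfl
  | @tail u v _ h ih =>
    obtain ⟨i, rfl⟩ := h
    rw [← ih, ← hI i]
    congr 1
    funext x
    have h1 : simpleReflection A i x = simpleReflection A i u ↔ x = u :=
      ⟨fun h ↦ by
        have := congrArg (simpleReflection A i) h
        rwa [simpleReflection_simpleReflection (hA i), simpleReflection_simpleReflection (hA i)]
          at this, fun h ↦ by rw [h]⟩
    simp only [Function.comp_apply, h1]

/-- The highest weight has multiplicity one and Weyl invariance spreads this over the orbit. The
multiplicity of the weight zero is irrelevant since `F 0 = 0`. -/
theorem weightFunctional_of_isQuasiMinuscule (hw : IsQuasiMinuscule B.A c w) (hv₀ : v₀ ≠ 0)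
    (hh : ∀ h : H, ⁅(h : L), v₀⁆ = χ₀ h • v₀) (hc : ∀ i, χ₀ (B.h' i) = c i)
    (htop : Submodule.span k (Set.range (loweringWord B v₀)) = ⊤)
    (F : (ι → ℤ) → ℤ) (hF : F 0 = 0) : weightFunctional B V F = ∑ j, F (w j) := by
  classical
  have : IsAddTorsionFree L := .of_isTorsionFree k L
  let G : (ι → ℤ) → ℤ := fun x ↦ ∑ j, F (w j) * (if x = w j then 1 else 0)
  have h1 : weightFunctional B V F = weightFunctional B V G := by
    rw [weightFunctional_apply, weightFunctional_apply]
    refine Finset.sum_congr rfl fun χ _ ↦ ?_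
    congr 1
    obtain ⟨u, hu, huχ⟩ := exists_loweringWord_ne_zero B hh htop χ
    have h2 : weightCoord B χ = loweredCoord B.A c u := by
      funext j
      have h3 := weightCoord_spec B χ j
      rw [← huχ, loweredWeight_apply B hc] at h3
      exact_mod_cast h3.symm
    rcases weightCoord_eq_zero_or_of_isQuasiMinuscule B hw hh hc htop _ u rfl hu with h3 | ⟨j, hj⟩
    · rw [h2, h3, hF]
      refine (Finset.sum_eq_zero fun j _ ↦ ?_).symm
      rw [if_neg ((hw.reachable j).ne_zero (fun i ↦ B.A_diag_eq_two i) hw.ne_zero).symm, mul_zero]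
    · rw [h2, ← hj]
      simp only [G, hw.injective.eq_iff]
      simp
  have h2 : weightFunctional B V (fun x ↦ if x = c then 1 else 0) = 1 := by
    let χ : Weight k H V := ⟨(χ₀ : H → k), by
      intro h2
      have h3 := loweringWord_mem_genWeightSpace B hh []
      change v₀ ∈ genWeightSpace V (χ₀ : H → k) at h3
      rw [h2, LieSubmodule.mem_bot] at h3
      exact hv₀ h3⟩
    have hχ : weightCoord B χ = c := by
      funext j
      have h3 := weightCoord_spec B χ j
      change χ₀ (B.h' j) = _ at h3
      rw [hc] at h3
      exact_mod_cast h3.symm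
    rw [weightFunctional_apply, Finset.sum_eq_single χ]
    · rw [if_pos hχ, mul_one]
      exact_mod_cast finrank_genWeightSpace_highest B hv₀ hh htop
    · intro χ' _ h
      rw [if_neg fun h' ↦ h (weight_eq_of_weightCoord_eq B (h'.trans hχ.symm)), mul_zero]
    · simp
  have h3 : G = ∑ j, F (w j) • (fun x ↦ if x = w j then (1 : ℤ) else 0) := by
    funext x
    simp [G, Finset.sum_apply]
  rw [h1, h3, map_sum]
  refine Finset.sum_congr rfl fun j _ ↦ ?_
  rw [map_zsmul, (hw.reachable j).eq_of_isWeylInvariant (fun i ↦ B.A_diag_eq_two i)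
    (weightFunctional_isWeylInvariant B V), h2, smul_eq_mul, mul_one]

end Character

/-! ### The minimal representations of the exceptional types -/

section Codes

/-- The vector whose coordinates are the decimal digits of a number, shifted by five. -/
def codeVec (r n : ℕ) : Fin r → ℤ := fun i ↦ ((n / 10 ^ i.1 % 10 : ℕ) : ℤ) - 5

/-- The simple reflection in terms of codes. -/
def codeReflection {r : ℕ} (A : Matrix (Fin r) (Fin r) ℤ) (n : ℕ) (i : Fin r) : ℕ :=
  (n - codeVec r n i * ∑ j, A i j * 10 ^ j.1).toNat

/-- The list `l` consists of the codes of the orbit of `c`. -/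
def IsCodeList {r : ℕ} (A : Matrix (Fin r) (Fin r) ℤ) (c : Fin r → ℤ) (l : List ℕ) : Prop :=
  (∃ m : Fin l.length, codeVec r l[m] = c) ∧ l.Nodup ∧
  (∀ n ∈ l, ∑ i, (codeVec r n i + 5) * 10 ^ i.1 = n) ∧
  (∀ m : Fin l.length, codeVec r l[m] = c ∨ ∃ i, codeReflection A l[m] i ∈ l.take m) ∧
  (∀ n ∈ l, ∀ i, codeReflection A n i ∈ l ∧
    codeVec r (codeReflection A n i) = simpleReflection A i (codeVec r n)) ∧
  ∀ n ∈ l, ∀ i, |codeVec r n i| ≤ 1 ∨ codeVec r n = A.row i ∨ codeVec r n = - A.row i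

instance {r : ℕ} (A : Matrix (Fin r) (Fin r) ℤ) (c : Fin r → ℤ) (l : List ℕ) :
    Decidable (IsCodeList A c l) := by
  unfold IsCodeList
  infer_instance

/-- Encoding vectors by numbers makes the orbit conditions a quick computation. Every code other
than that of `c` has a reflection earlier in the list, which gives reachability by induction;
decoding gives injectivity. -/
theorem isQuasiMinuscule_of_codes {r : ℕ} {A : Matrix (Fin r) (Fin r) ℤ} (hA : ∀ i, A i i = 2)
    {c : Fin r → ℤ} (hc : c ≠ 0) {l : List ℕ} (h : IsCodeList A c l) :
    IsQuasiMinuscule A c fun m : Fin l.length ↦ codeVec r l[m] := by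
  obtain ⟨hl, hnd, hinj, hreach, hrefl, hsmall⟩ := h
  exact {
  injective m m' h := by
    have h1 := hinj l[m] (List.getElem_mem _)
    have h2 := hinj l[m'] (List.getElem_mem _)
    simp only at h
    rw [h, h2] at h1
    exact Fin.ext ((List.Nodup.getElem_inj_iff hnd).1 (by exact_mod_cast h1.symm))
  exists_eq := hl
  ne_zero := hc
  reachable := by
    rintro ⟨m, hm⟩
    induction m using Nat.strong_induction_on with
    | _ m ih =>
      rcases hreach ⟨m, hm⟩ with h | ⟨i, hi⟩
      · rw [h]; exact .refl
      · obtain ⟨p, hp, hpi⟩ := List.mem_take_iff_getElem.1 hi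
        have hpm : p < m := by
          have : p < min m l.length := hp
          omega
        refine Relation.ReflTransGen.tail (ih p hpm (by omega)) ⟨i, ?_⟩
        have h1 := (hrefl l[m] (List.getElem_mem _) i).2
        simp only [Fin.getElem_fin] at hpi ⊢
        rw [hpi, h1, simpleReflection_simpleReflection (hA i)]
  reflected m i := by
    obtain ⟨h1, h2⟩ := hrefl l[m] (List.getElem_mem _) i
    obtain ⟨p, hp, hpi⟩ := List.mem_iff_getElem.1 h1
    refine ⟨⟨p, hp⟩, ?_⟩
    simp only [Fin.getElem_fin] at hpi h2 ⊢
    rw [hpi, h2]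
  small m i := hsmall _ (List.getElem_mem _) i }

/-- The orbit of the fundamental weight of `E6`. -/
def codesE6 : List ℕ :=
  [655555, 465555, 546555, 554665, 555645, 555466, 556446, 555564, 556544, 564556, 564654,
  645556, 565455, 645654, 455556, 646455, 455654, 654565, 456455, 655545, 464565, 465545,
  545565, 546545, 554655, 555456, 555554]

/-- The orbit of the fundamental weight of `E7`. -/
def codesE7 : List ℕ :=
  [6555555, 4655555, 5465555, 5546555, 5554665, 5555645, 5555466, 5556446, 5555564, 5556544,
  5564556, 5564654, 5645556, 5565455, 5645654, 6455556, 5646455, 6455654, 4555556, 5654565,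
  6456455, 4555654, 5655545, 6464565, 4556455, 6465545, 6545565, 4564565, 6546545, 4565545,
  4645565, 6554655, 4646545, 5455565, 6555456, 4654655, 5456545, 6555554, 4655456, 5464655,
  4655554, 5465456, 5545655, 5465554, 5546456, 5546554, 5554566, 5554664, 5555546, 5555644,
  5555465, 5556445, 5564555, 5645555, 6455555, 4555555]

/-- The orbit of the fundamental weight of `E8`. -/
def codesE8 : List ℕ :=
  [65555555, 46555555, 54655555, 55465555, 55546555, 55554665, 55555645, 55555466, 55556446,
  55555564, 55556544, 55564556, 55564654, 55645556, 55565455, 55645654, 56455556, 55646455,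
  56455654, 64555556, 55654565, 56456455, 64555654, 45555556, 55655545, 56464565, 64556455,
  45555654, 56465545, 56545565, 64564565, 45556455, 56546545, 64565545, 64645565, 45564565,
  56554655, 64646545, 45565545, 65455565, 45645565, 56555456, 64654655, 65456545, 45646545,
  46455565, 56555554, 64655456, 65464655, 45654655, 46456545, 54555565, 64655554, 65465456,
  45655456, 65545655, 46464655, 54556545, 65465554, 45655554, 65546456, 46465456, 46545655,
  54564655, 65546554, 46465554, 65554566, 46546456, 54565456, 54645655, 65554664, 46546554,
  54565554, 65555546, 46554566, 54646456, 55455655, 65555644, 65555465, 46554664, 54646554,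
  46555546, 54654566, 55456456, 65556445, 46555644, 46555465, 54654664, 55456554, 54655546,
  55464566, 65564555, 46556445, 54655644, 54655465, 55464664, 55465546, 55545566, 65645555,
  46564555, 54656445, 55465644, 55465465, 55545664, 55546546, 66455555, 46645555, 54664555,
  55466445, 55546644, 55546465, 55554656, 74555555, 47455555, 54745555, 55474555, 55547445,
  55554754, 55554575, 55555457, 36555555, 63655555, 56365555, 55636555, 55563665, 55556356,
  55556535, 55555653, 44655555, 64465555, 56446555, 55644665, 55564645, 55564466, 55556454,
  45465555, 64546555, 56454665, 55645645, 55645466, 55565446, 55564564, 45546555, 64554665,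
  56455645, 56455466, 55646446, 55645564, 55565544, 45554665, 64555645, 64555466, 56456446,
  56455564, 55646544, 55654556, 45555645, 45555466, 64556446, 64555564, 56456544, 56464556,
  55654654, 45556446, 45555564, 64556544, 64564556, 56464654, 56545556, 55655455, 45556544,
  45564556, 64564654, 64645556, 56465455, 56545654, 45564654, 45645556, 64565455, 64645654,
  65455556, 56546455, 45565455, 45645654, 46455556, 64646455, 65455654, 56554565, 45646455,
  46455654, 54555556, 64654565, 65456455, 56555545, 45654565, 46456455, 54555654, 64655545,
  65464565, 45655545, 46464565, 54556455, 65465545, 65545565, 46465545, 46545565, 54564565,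
  65546545, 46546545, 54565545, 54645565, 65554655, 46554655, 54646545, 55455565, 65555456,
  46555456, 54654655, 55456545, 65555554, 46555554, 54655456, 55464655, 54655554, 55465456,
  55545655, 55465554, 55546456, 55546554, 55554566, 55554664, 55555546, 55555644, 55555465,
  55556445, 55564555, 55645555, 56455555, 64555555, 45555555]

/-- The orbit of the fundamental weight of `F4`. -/
def codesF4 : List ℕ :=
  [6555, 4655, 5465, 5646, 5654, 6456, 6464, 4556, 6645, 4564, 7455, 4745, 3655, 6365, 4465,
  6546, 4646, 6554, 4654, 5456, 5464, 5645, 6455, 4555]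

/-- The orbit of the fundamental weight of `G2`. -/
def codesG2 : List ℕ :=
  [56, 64, 47, 63, 46, 54]

theorem isQuasiMinuscule_E6 : IsQuasiMinuscule CartanMatrix.E₆ (Pi.single 5 1)
    fun m : Fin codesE6.length ↦ codeVec 6 codesE6[m] :=
  isQuasiMinuscule_of_codes (by decide +kernel) (by decide +kernel) (by decide +kernel)

theorem sum_sq_codesE6 : ∑ m : Fin codesE6.length, codeVec 6 codesE6[m] 0 ^ 2 = 12 := by
  refine (Fin.sum_univ_fun_getElem codesE6 (fun n ↦ codeVec 6 n 0 ^ 2)).trans ?_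
  decide +kernel

theorem isQuasiMinuscule_E7 : IsQuasiMinuscule CartanMatrix.E₇ (Pi.single 6 1)
    fun m : Fin codesE7.length ↦ codeVec 7 codesE7[m] :=
  isQuasiMinuscule_of_codes (by decide +kernel) (by decide +kernel) (by decide +kernel)

theorem sum_sq_codesE7 : ∑ m : Fin codesE7.length, codeVec 7 codesE7[m] 0 ^ 2 = 24 := by
  refine (Fin.sum_univ_fun_getElem codesE7 (fun n ↦ codeVec 7 n 0 ^ 2)).trans ?_
  decide +kernel

theorem isQuasiMinuscule_E8 : IsQuasiMinuscule CartanMatrix.E₈ (Pi.single 7 1)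
    fun m : Fin codesE8.length ↦ codeVec 8 codesE8[m] :=
  isQuasiMinuscule_of_codes (by decide +kernel) (by decide +kernel) (by decide +kernel)

theorem sum_sq_codesE8 : ∑ m : Fin codesE8.length, codeVec 8 codesE8[m] 0 ^ 2 = 120 := by
  refine (Fin.sum_univ_fun_getElem codesE8 (fun n ↦ codeVec 8 n 0 ^ 2)).trans ?_
  decide +kernel

theorem isQuasiMinuscule_F4 : IsQuasiMinuscule CartanMatrix.F₄ (Pi.single 3 1)
    fun m : Fin codesF4.length ↦ codeVec 4 codesF4[m] :=
  isQuasiMinuscule_of_codes (by decide +kernel) (by decide +kernel) (by decide +kernel)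

theorem sum_sq_codesF4 : ∑ m : Fin codesF4.length, codeVec 4 codesF4[m] 0 ^ 2 = 12 := by
  refine (Fin.sum_univ_fun_getElem codesF4 (fun n ↦ codeVec 4 n 0 ^ 2)).trans ?_
  decide +kernel

theorem isQuasiMinuscule_G2 : IsQuasiMinuscule CartanMatrix.G₂.transpose (Pi.single 0 1)
    fun m : Fin codesG2.length ↦ codeVec 2 codesG2[m] :=
  isQuasiMinuscule_of_codes (by decide +kernel) (by decide +kernel) (by decide +kernel)

theorem sum_sq_codesG2 : ∑ m : Fin codesG2.length, codeVec 2 codesG2[m] 1 ^ 2 = 4 := by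
  refine (Fin.sum_univ_fun_getElem codesG2 (fun n ↦ codeVec 2 n 1 ^ 2)).trans ?_
  decide +kernel

end Codes

/-! ### The vector representations of the classical types -/

section Classical

namespace SimpleType

variable {r : ℕ}

/-- For types B, C and D the orbit is ±ε₁, …, ±ε_r, so only one half has to be described. -/
theorem isQuasiMinuscule_signed {A : Matrix (Fin r) (Fin r) ℤ} {u : Fin r → Fin r → ℤ} (k₀ : Fin r)
    (hinj : Function.Injective u) (hne : ∀ k k', u k ≠ - u k')
    (hreach : ∀ k, WeylReachable A (u k₀) (u k)) (hreach' : ∀ k, WeylReachable A (u k₀) (- u k))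
    (hrefl : ∀ k i, ∃ k', u k' = simpleReflection A i (u k) ∨ - u k' = simpleReflection A i (u k))
    (hsmall : ∀ k i, |u k i| ≤ 1 ∨ u k = A i ∨ u k = - A i) :
    IsQuasiMinuscule A (u k₀) fun p : Fin r × Bool ↦ if p.2 then u p.1 else - u p.1 where
  injective := by
    rintro ⟨k, s⟩ ⟨k', s'⟩ h
    cases s <;> cases s' <;> simp only [Bool.false_eq_true, if_true, if_false] at h
    · rw [hinj (neg_injective h)]
    · exact absurd h.symm (hne _ _)
    · exact absurd h (hne _ _)
    · rw [hinj h]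
  exists_eq := ⟨(k₀, true), rfl⟩
  ne_zero h := hne k₀ k₀ (by rw [h, neg_zero])
  reachable := by
    rintro ⟨k, s⟩
    cases s
    · exact hreach' k
    · exact hreach k
  reflected := by
    rintro ⟨k, s⟩ i
    have hneg : ∀ v, simpleReflection A i (- v) = - simpleReflection A i v := fun v ↦ by
      funext j
      simp only [simpleReflection, Pi.neg_apply]
      ring
    obtain ⟨k', h | h⟩ := hrefl k i
    · exact ⟨(k', s), by cases s <;> simp [h, hneg]⟩
    · refine ⟨(k', !s), ?_⟩
      cases s
      · simp only [Bool.not_false, if_true, Bool.false_eq_true, if_false]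
        rw [hneg, ← h, neg_neg]
      · simpa using h
  small := by
    rintro ⟨k, s⟩ i
    cases s
    · rcases hsmall k i with h | h | h
      · left; simpa using h
      · right; right; simp [h]
      · right; left; simp [h]
    · exact hsmall k i

/-- The weights of the vector representation of type `A`. -/
def vecA (r : ℕ) (k : Fin (r + 1)) (j : Fin r) : ℤ :=
  (if k.1 = j.1 then 1 else 0) - if k.1 = j.1 + 1 then 1 else 0

/-- Half of the weights of the vector representation of type `B`. -/
def vecB (r : ℕ) (k j : Fin r) : ℤ :=
  -- These are the values of ε_k at the coroots ε_j - ε_{j+1} and 2ε_r; the last one explains the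
  -- entry 2.
  if k.1 = j.1 then (if k.1 + 1 = r then 2 else 1) else if k.1 = j.1 + 1 then -1 else 0

/-- Half of the weights of the vector representation of type `C`. -/
def vecC (r : ℕ) (k j : Fin r) : ℤ :=
  if k.1 = j.1 then 1 else if k.1 = j.1 + 1 then -1 else 0

/-- Half of the weights of the vector representation of type `D`. -/
def vecD (r : ℕ) (k j : Fin r) : ℤ :=
  if j.1 + 1 = r then (if r ≤ k.1 + 2 then 1 else 0)
  else if k.1 = j.1 then 1 else if k.1 = j.1 + 1 then -1 else 0

theorem isQuasiMinuscule_A (hr : 1 ≤ r) :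
    IsQuasiMinuscule (CartanMatrix.A r) (vecA r 0) (vecA r) := by
  have hA : ∀ i j : Fin r, CartanMatrix.A r i j = _ := cartanMatrix_A_apply hr
  exact {
  injective k k' h := by
    have h1 : ∀ j : Fin r, vecA r k j = vecA r k' j := fun j ↦ congrFun h j
    simp only [vecA] at h1
    rcases lt_trichotomy k.1 k'.1 with h2 | h2 | h2
    · have := h1 ⟨k.1, by omega⟩
      grind
    · exact Fin.ext h2
    · have := h1 ⟨k'.1, by omega⟩
      grind
  exists_eq := ⟨0, rfl⟩
  ne_zero h := by
    have : vecA r 0 ⟨0, hr⟩ = 0 := congrFun h _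
    simp [vecA] at this
  reachable := by
    rintro ⟨k, hk⟩
    induction k with
    | zero => exact .refl
    | succ k ih =>
      refine (ih (by omega)).tail ⟨⟨k, by omega⟩, funext fun j ↦ ?_⟩
      simp only [simpleReflection, vecA]
      rw [hA]
      grind
  reflected k i := by
    refine ⟨if h : k.1 = i.1 then ⟨i.1 + 1, by omega⟩ else if k.1 = i.1 + 1 then ⟨i.1, by omega⟩
      else k, funext fun j ↦ ?_⟩
    simp only [simpleReflection, vecA]
    rw [hA]
    grind
  small k i := by
    left
    simp only [vecA, abs_le]
    grind }

theorem isQuasiMinuscule_B (hr : 3 ≤ r) :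
    IsQuasiMinuscule (CartanMatrix.B r) (vecB r ⟨0, by omega⟩)
      fun p : Fin r × Bool ↦ if p.2 then vecB r p.1 else - vecB r p.1 := by
  have hA : ∀ i j : Fin r, CartanMatrix.B r i j = _ := cartanMatrix_B_apply hr
  have hr1 : ∀ k (hk : k < r), WeylReachable (CartanMatrix.B r) (vecB r ⟨0, by omega⟩)
      (vecB r ⟨k, hk⟩) := by
    intro k
    induction k with
    | zero => exact fun _ ↦ .refl
    | succ k ih =>
      intro hk
      refine (ih (by omega)).tail ⟨⟨k, by omega⟩, funext fun j ↦ ?_⟩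
      simp only [simpleReflection, vecB]
      rw [hA]
      grind
  -- The last reflection sends ε_r to -ε_r, and the other reflections carry it back to -ε_k; m
  -- counts the remaining distance.
  have hr2 : ∀ m k (hk : k < r), k + 1 + m = r → WeylReachable (CartanMatrix.B r)
      (vecB r ⟨0, by omega⟩) (- vecB r ⟨k, hk⟩) := by
    intro m
    induction m with
    | zero =>
      intro k hk h
      refine (hr1 k hk).tail ⟨⟨k, hk⟩, funext fun j ↦ ?_⟩
      simp only [simpleReflection, vecB, Pi.neg_apply]
      rw [hA]
      grind
    | succ m ih =>
      intro k hk h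
      refine (ih (k + 1) (by omega) (by omega)).tail ⟨⟨k, hk⟩, funext fun j ↦ ?_⟩
      simp only [simpleReflection, vecB, Pi.neg_apply]
      rw [hA]
      grind
  refine isQuasiMinuscule_signed ⟨0, by omega⟩ (fun k k' h ↦ ?_) (fun k k' h ↦ ?_)
    (fun k ↦ hr1 k.1 k.2) (fun k ↦ hr2 (r - 1 - k.1) k.1 k.2 (by omega)) (fun k i ↦ ?_)
    (fun k i ↦ ?_)
  · have h2 := congrFun h k
    have h3 := congrFun h k'
    simp only [vecB] at h2 h3
    grind
  · have h2 := congrFun h k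
    have h3 := congrFun h k'
    simp only [vecB, Pi.neg_apply] at h2 h3
    grind
  · by_cases h : i.1 + 1 = r
    · by_cases h' : k.1 = i.1
      · refine ⟨k, Or.inr (funext fun j ↦ ?_)⟩
        simp only [simpleReflection, vecB, Pi.neg_apply]
        rw [hA]
        grind
      · refine ⟨k, Or.inl (funext fun j ↦ ?_)⟩
        simp only [simpleReflection, vecB]
        rw [hA]
        grind
    · refine ⟨if h : k.1 = i.1 then ⟨i.1 + 1, by omega⟩ else if k.1 = i.1 + 1 then ⟨i.1, by omega⟩
        else k, Or.inl (funext fun j ↦ ?_)⟩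
      simp only [simpleReflection, vecB]
      rw [hA]
      grind
  -- The only entry 2 belongs to ε_r, which is the short simple root itself.
  · by_cases h : k.1 = i.1 ∧ k.1 + 1 = r
    · right; left
      funext j
      simp only [vecB]
      rw [hA]
      grind
    · left
      simp only [vecB, abs_le]
      grind

theorem isQuasiMinuscule_C (hr : 1 ≤ r) :
    IsQuasiMinuscule (CartanMatrix.C r) (vecC r ⟨0, by omega⟩)
      fun p : Fin r × Bool ↦ if p.2 then vecC r p.1 else - vecC r p.1 := by
  have hA : ∀ i j : Fin r, CartanMatrix.C r i j = _ := cartanMatrix_C_apply hr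
  have hr1 : ∀ k (hk : k < r), WeylReachable (CartanMatrix.C r) (vecC r ⟨0, by omega⟩)
      (vecC r ⟨k, hk⟩) := by
    intro k
    induction k with
    | zero => exact fun _ ↦ .refl
    | succ k ih =>
      intro hk
      refine (ih (by omega)).tail ⟨⟨k, by omega⟩, funext fun j ↦ ?_⟩
      simp only [simpleReflection, vecC]
      rw [hA]
      grind
  have hr2 : ∀ m k (hk : k < r), k + 1 + m = r → WeylReachable (CartanMatrix.C r)
      (vecC r ⟨0, by omega⟩) (- vecC r ⟨k, hk⟩) := by
    intro m
    induction m with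
    | zero =>
      intro k hk h
      refine (hr1 k hk).tail ⟨⟨k, hk⟩, funext fun j ↦ ?_⟩
      simp only [simpleReflection, vecC, Pi.neg_apply]
      rw [hA]
      grind
    | succ m ih =>
      intro k hk h
      refine (ih (k + 1) (by omega) (by omega)).tail ⟨⟨k, hk⟩, funext fun j ↦ ?_⟩
      simp only [simpleReflection, vecC, Pi.neg_apply]
      rw [hA]
      grind
  refine isQuasiMinuscule_signed ⟨0, by omega⟩ (fun k k' h ↦ ?_) (fun k k' h ↦ ?_)
    (fun k ↦ hr1 k.1 k.2) (fun k ↦ hr2 (r - 1 - k.1) k.1 k.2 (by omega)) (fun k i ↦ ?_)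
    (fun k i ↦ ?_)
  · have h2 := congrFun h k
    have h3 := congrFun h k'
    simp only [vecC] at h2 h3
    grind
  · have h2 := congrFun h k
    have h3 := congrFun h k'
    simp only [vecC, Pi.neg_apply] at h2 h3
    grind
  · by_cases h : i.1 + 1 = r
    · by_cases h' : k.1 = i.1
      · refine ⟨k, Or.inr (funext fun j ↦ ?_)⟩
        simp only [simpleReflection, vecC, Pi.neg_apply]
        rw [hA]
        grind
      · refine ⟨k, Or.inl (funext fun j ↦ ?_)⟩
        simp only [simpleReflection, vecC]
        rw [hA]
        grind
    · refine ⟨if h : k.1 = i.1 then ⟨i.1 + 1, by omega⟩ else if k.1 = i.1 + 1 then ⟨i.1, by omega⟩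
        else k, Or.inl (funext fun j ↦ ?_)⟩
      simp only [simpleReflection, vecC]
      rw [hA]
      grind
  · left
    simp only [vecC, abs_le]
    grind

theorem simpleReflection_vecD (hr : 4 ≤ r) (k i : Fin r) (h : i.1 + 1 < r) :
    simpleReflection (CartanMatrix.D r) i (vecD r k) = vecD r
      (if h : k.1 = i.1 then ⟨i.1 + 1, by omega⟩ else if k.1 = i.1 + 1 then ⟨i.1, by omega⟩
        else k) := by
  have hA : ∀ i j : Fin r, CartanMatrix.D r i j = _ := cartanMatrix_D_apply hr
  by_cases h1 : k.1 = i.1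
  · rw [dif_pos h1]
    funext j
    simp only [simpleReflection, vecD]
    rw [hA]
    clear hA
    grind
  · rw [dif_neg h1]
    by_cases h2 : k.1 = i.1 + 1
    · have h3 : vecD r k i = -1 := by
        simp only [vecD]
        grind
      rw [if_pos h2]
      funext j
      simp only [simpleReflection, h3]
      rw [hA]
      simp only [vecD]
      clear hA h3
      grind (splits := 20)
    · rw [if_neg h2]
      funext j
      simp only [simpleReflection, vecD]
      rw [hA]
      clear hA
      grind

theorem simpleReflection_vecD_last (hr : 4 ≤ r) (k i : Fin r) (h : i.1 + 1 = r) (hk : r ≤ k.1 + 2) :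
    simpleReflection (CartanMatrix.D r) i (vecD r k) =
      - vecD r (if k.1 + 1 = r then ⟨r - 2, by omega⟩ else ⟨r - 1, by omega⟩) := by
  have hA : ∀ i j : Fin r, CartanMatrix.D r i j = _ := cartanMatrix_D_apply hr
  by_cases h1 : k.1 + 1 = r
  · rw [if_pos h1]
    funext j
    simp only [simpleReflection, vecD, Pi.neg_apply]
    rw [hA]
    clear hA
    grind
  · rw [if_neg h1]
    funext j
    simp only [simpleReflection, vecD, Pi.neg_apply]
    rw [hA]
    clear hA
    grind

theorem simpleReflection_vecD_last' (hr : 4 ≤ r) (k i : Fin r) (h : i.1 + 1 = r)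
    (hk : k.1 + 2 < r) : simpleReflection (CartanMatrix.D r) i (vecD r k) = vecD r k := by
  funext j
  have : vecD r k i = 0 := by
    simp only [vecD]
    rw [if_pos h, if_neg (by omega)]
  rw [simpleReflection, this, zero_mul, sub_zero]

theorem isQuasiMinuscule_D (hr : 4 ≤ r) :
    IsQuasiMinuscule (CartanMatrix.D r) (vecD r ⟨0, by omega⟩)
      fun p : Fin r × Bool ↦ if p.2 then vecD r p.1 else - vecD r p.1 := by
  have hA : ∀ i j : Fin r, CartanMatrix.D r i j = _ := cartanMatrix_D_apply hr
  have hr1 : ∀ k (hk : k < r), WeylReachable (CartanMatrix.D r) (vecD r ⟨0, by omega⟩)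
      (vecD r ⟨k, hk⟩) := by
    intro k
    induction k with
    | zero => exact fun _ ↦ .refl
    | succ k ih =>
      intro hk
      refine (ih (by omega)).tail ⟨⟨k, by omega⟩, funext fun j ↦ ?_⟩
      simp only [simpleReflection, vecD]
      rw [hA]
      grind
  -- The last reflection exchanges ε_r with -ε_{r-1}; the chain therefore starts there, and -ε_r is
  -- reached separately in `hr3`.
  have hr2 : ∀ m k (hk : k < r), k + 2 + m = r → WeylReachable (CartanMatrix.D r)
      (vecD r ⟨0, by omega⟩) (- vecD r ⟨k, hk⟩) := by
    intro m
    induction m with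
    | zero =>
      intro k hk h
      refine (hr1 (k + 1) (by omega)).tail ⟨⟨k + 1, by omega⟩, funext fun j ↦ ?_⟩
      simp only [simpleReflection, vecD, Pi.neg_apply]
      rw [hA]
      grind
    | succ m ih =>
      intro k hk h
      refine (ih (k + 1) (by omega) (by omega)).tail ⟨⟨k, hk⟩, funext fun j ↦ ?_⟩
      simp only [simpleReflection, vecD, Pi.neg_apply]
      rw [hA]
      grind
  have hr3 : WeylReachable (CartanMatrix.D r) (vecD r ⟨0, by omega⟩)
      (- vecD r ⟨r - 1, by omega⟩) := by
    refine (hr2 0 (r - 2) (by omega) (by omega)).tail ⟨⟨r - 2, by omega⟩, funext fun j ↦ ?_⟩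
    simp only [simpleReflection, vecD, Pi.neg_apply]
    rw [hA]
    grind
  refine isQuasiMinuscule_signed ⟨0, by omega⟩ (fun k k' h ↦ ?_) (fun k k' h ↦ ?_)
    (fun k ↦ hr1 k.1 k.2) (fun k ↦ ?_) (fun k i ↦ ?_) (fun k i ↦ ?_)
  · have h2 := congrFun h k
    have h3 := congrFun h k'
    have h4 := congrFun h ⟨r - 2, by omega⟩
    simp only [vecD] at h2 h3 h4
    grind
  · have h2 := congrFun h k
    have h3 := congrFun h k'
    have h4 := congrFun h ⟨r - 2, by omega⟩
    clear hA hr1 hr2 hr3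
    simp only [vecD, Pi.neg_apply] at h2 h3 h4
    grind
  · by_cases h : k.1 + 1 = r
    · have hk : k = ⟨r - 1, by omega⟩ := Fin.ext (by simp only; omega)
      rw [hk]
      exact hr3
    · exact hr2 (r - 2 - k.1) k.1 k.2 (by omega)
  · by_cases h : i.1 + 1 = r
    · by_cases h' : r ≤ k.1 + 2
      · exact ⟨_, Or.inr (simpleReflection_vecD_last hr k i h h').symm⟩
      · exact ⟨_, Or.inl (simpleReflection_vecD_last' hr k i h (by omega)).symm⟩
    · exact ⟨_, Or.inl (simpleReflection_vecD hr k i (by omega)).symm⟩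
  · left
    simp only [vecD, abs_le]
    grind

end SimpleType

end Classical

/-! ### The Dynkin index of the minimal representation -/

section MinimalRepresentation

open LieModule LieAlgebra LieAlgebra.IsKilling Module

namespace SimpleType

theorem sum_sq_signed {r : ℕ} (u : Fin r → Fin r → ℤ) (ℓ : Fin r) :
    ∑ p : Fin r × Bool, (if p.2 then u p.1 else - u p.1) ℓ ^ 2 = 2 * ∑ k, u k ℓ ^ 2 := by
  rw [Fintype.sum_prod_type, Finset.mul_sum]
  refine Finset.sum_congr rfl fun k _ ↦ ?_
  simp
  ring

/-- The weights of the minimal representations. -/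
theorem exists_isQuasiMinuscule (T : SimpleType) :
    ∃ (J : Type) (_ : Fintype J) (w : J → Fin T.rank → ℤ),
      IsQuasiMinuscule T.cartanMatrix (Pi.single T.node 1) w ∧
      ∑ j, w j T.longNode ^ 2 = 2 * T.minIndex := by
  cases T with
  | A r hr =>
    have h0 : vecA r 0 = Pi.single ⟨0, hr⟩ 1 := by
      funext j
      simp only [vecA, Pi.single_apply, Fin.ext_iff, Fin.val_zero]
      grind
    refine ⟨Fin (r + 1), inferInstance, vecA r, h0 ▸ isQuasiMinuscule_A hr, ?_⟩
    change ∑ j : Fin (r + 1), vecA r j ⟨0, hr⟩ ^ 2 = 2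
    have h1 : ∀ j : Fin (r + 1), vecA r j ⟨0, hr⟩ ^ 2 =
        (if j = ⟨0, by omega⟩ then 1 else 0) + if j = ⟨1, by omega⟩ then 1 else 0 := by
      intro j
      simp only [vecA, Fin.ext_iff]
      grind
    simp only [h1, Finset.sum_add_distrib, Finset.sum_ite_eq', Finset.mem_univ, if_true]
    norm_num
  | B r hr =>
    have h0 : vecB r ⟨0, by omega⟩ = Pi.single ⟨0, by omega⟩ 1 := by
      funext j
      simp only [vecB, Pi.single_apply, Fin.ext_iff]
      grind
    refine ⟨Fin r × Bool, inferInstance, _, h0 ▸ isQuasiMinuscule_B hr, ?_⟩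
    refine (sum_sq_signed (vecB r) ⟨r - 3, by omega⟩).trans ?_
    have h1 : ∀ j : Fin r, vecB r j ⟨r - 3, by omega⟩ ^ 2 =
        (if j = ⟨r - 3, by omega⟩ then 1 else 0) + if j = ⟨r - 2, by omega⟩ then 1 else 0 := by
      intro j
      simp only [vecB, Fin.ext_iff]
      grind
    simp only [h1, Finset.sum_add_distrib, Finset.sum_ite_eq', Finset.mem_univ, if_true]
    norm_num [minIndex]
  | C r hr =>
    have h0 : vecC r ⟨0, by omega⟩ = Pi.single ⟨0, by omega⟩ 1 := by
      funext j
      simp only [vecC, Pi.single_apply, Fin.ext_iff]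
      grind
    refine ⟨Fin r × Bool, inferInstance, _, h0 ▸ isQuasiMinuscule_C hr, ?_⟩
    refine (sum_sq_signed (vecC r) ⟨r - 1, by omega⟩).trans ?_
    have h1 : ∀ j : Fin r, vecC r j ⟨r - 1, by omega⟩ ^ 2 =
        if j = ⟨r - 1, by omega⟩ then 1 else 0 := by
      intro j
      simp only [vecC, Fin.ext_iff]
      grind
    simp only [h1, Finset.sum_ite_eq', Finset.mem_univ, if_true]
    norm_num [minIndex]
  | D r hr =>
    have h0 : vecD r ⟨0, by omega⟩ = Pi.single ⟨0, by omega⟩ 1 := by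
      funext j
      simp only [vecD, Pi.single_apply, Fin.ext_iff]
      grind
    refine ⟨Fin r × Bool, inferInstance, _, h0 ▸ isQuasiMinuscule_D hr, ?_⟩
    refine (sum_sq_signed (vecD r) ⟨r - 4, by omega⟩).trans ?_
    have h1 : ∀ j : Fin r, vecD r j ⟨r - 4, by omega⟩ ^ 2 =
        (if j = ⟨r - 4, by omega⟩ then 1 else 0) + if j = ⟨r - 3, by omega⟩ then 1 else 0 := by
      intro j
      simp only [vecD, Fin.ext_iff]
      grind
    simp only [h1, Finset.sum_add_distrib, Finset.sum_ite_eq', Finset.mem_univ, if_true]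
    norm_num [minIndex]
  | E6 => exact ⟨_, inferInstance, _, isQuasiMinuscule_E6, sum_sq_codesE6⟩
  | E7 => exact ⟨_, inferInstance, _, isQuasiMinuscule_E7, sum_sq_codesE7⟩
  | E8 => exact ⟨_, inferInstance, _, isQuasiMinuscule_E8, sum_sq_codesE8⟩
  | F4 => exact ⟨_, inferInstance, _, isQuasiMinuscule_F4, sum_sq_codesF4⟩
  | G2 => exact ⟨_, inferInstance, _, isQuasiMinuscule_G2, sum_sq_codesG2⟩

end SimpleType

variable {k : Type u} [Field k] [IsAlgClosed k] [CharZero k]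
  {L : Type v} [LieRing L] [LieAlgebra k L] [FiniteDimensional k L] [LieAlgebra.IsSimple k L]
  {H : LieSubalgebra k L} [H.IsCartanSubalgebra]
  {b : (rootSystem H).Base} {θ : H.root} {T : SimpleType} {e : Fin T.rank ≃ b.support}

theorem fundamentalWeight_h' (B : LieAlgebra.Basis (Fin T.rank) H)
    (hh : ∀ i, B.h i = coroot (e i).1.1) (i j : Fin T.rank) :
    fundamentalWeight b (e i) (B.h' j) = ((Pi.single i 1 : Fin T.rank → ℤ) j : ℤ) := by
  classical
  have h1 : B.h' j = b.toCoweightBasis (e j) := by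
    rw [RootPairing.Base.toCoweightBasis_apply]
    exact Subtype.ext (hh j)
  rw [fundamentalWeight, h1, Basis.coord_apply, Basis.repr_self, Finsupp.single_apply,
    Pi.single_apply]
  simp only [e.injective.eq_iff]
  split_ifs <;> simp

/-- Irreducibility makes the lowering words span, so the character is that of a quasi-minuscule
orbit and 2d is the computed sum of squares. -/
theorem hasDynkinIndex_of_isIrreducibleWithHighestWeight (hθ : IsHighestRoot b θ)
    (he : ∀ i j, b.cartanMatrix (e i) (e j) = T.cartanMatrix i j)
    (B : LieAlgebra.Basis (Fin T.rank) H) (hA : ∀ i j, B.A i j = T.cartanMatrix i j)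
    (hh : ∀ i, B.h i = coroot (e i).1.1) (hBe : ∀ i, B.e i ∈ rootSpace H (e i).1.1)
    {V : Type w} [AddCommGroup V] [Module k V] [FiniteDimensional k V] (ρ : L →ₗ⁅k⁆ sl k V)
    (hρ : IsIrreducibleWithHighestWeight b ρ (fundamentalWeight b (e T.node))) :
    HasDynkinIndex θ ρ (T.minIndex : k) := by
  let _ := lieRingModuleOfRep ρ
  obtain ⟨_, hρV⟩ := lieModuleOfRep ρ
  obtain ⟨hirr, v₀, hv₀, hv₀h, hv₀e⟩ := hρ
  have hh' : ∀ h : H, ⁅(h : L), v₀⁆ = fundamentalWeight b (e T.node) h • v₀ := hv₀h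
  have he' : ∀ i, ⁅B.e i, v₀⁆ = 0 := fun i ↦
    hv₀e _ (RootPairing.Base.isPos_of_mem_support (e i).2) _ (hBe i)
  have htop : Submodule.span k (Set.range (loweringWord B v₀)) = ⊤ := by
    refine (hirr _ (fun x w hw ↦ lie_mem_span_loweringWord B hh' he' x w hw)).resolve_left fun h ↦ ?_
    have h1 : v₀ ∈ Submodule.span k (Set.range (loweringWord B v₀)) :=
      Submodule.subset_span ⟨[], rfl⟩
    rw [h] at h1
    exact hv₀ (by simpa using h1)
  obtain ⟨d, hd, hd', -⟩ := exists_nat_hasDynkinIndex_iff hθ he B hA hh ρ hρV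
  obtain ⟨J, _, w, hw, hsum⟩ := T.exists_isQuasiMinuscule
  have h1 := weightFunctional_of_isQuasiMinuscule B
    (by rw [show B.A = T.cartanMatrix from Matrix.ext hA]; exact hw) hv₀ hh'
    (fundamentalWeight_h' B hh T.node) htop (fun v ↦ v T.longNode ^ 2) (by simp)
  rw [hd, hsum] at h1
  have h2 : d = T.minIndex := by omega
  rw [hd', h2]

end MinimalRepresentation

/-! ### Irreducible representations from highest weight vectors -/

section IrreducibleQuotient

open LieModule LieAlgebra LieAlgebra.IsKilling Module

variable {k : Type u} [Field k] [IsAlgClosed k] [CharZero k]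
  {L : Type v} [LieRing L] [LieAlgebra k L] [FiniteDimensional k L] [LieAlgebra.IsSimple k L]
  {H : LieSubalgebra k L} [H.IsCartanSubalgebra]
  {b : (rootSystem H).Base} {ι : Type*} [Fintype ι] {e : ι ≃ b.support}

/-- The root spaces of the positive roots are contained in the subalgebra generated by those of
the simple roots. -/
theorem rootSpace_le_lieSpan_of_isPos (B : LieAlgebra.Basis ι H)
    (hh : ∀ i, B.h i = coroot (e i).1.1) (hA : ∀ i j, B.A i j = b.cartanMatrix (e i) (e j))
    {α : H.root} (hα : b.IsPos α) {x : L} (hx : x ∈ rootSpace H α.1) :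
    x ∈ LieSubalgebra.lieSpan k L (Set.range B.e) := by
  classical
  have hsupp : ∀ i, B.baseSupp i = (rootSystem H).root (e i).1 := by
    intro i
    refine LinearMap.ext_on_range (span_lieBasis_h' B) fun j ↦ ?_
    rw [B.baseSupp_apply_h', hA, ← eq_intCast (algebraMap ℤ k),
      RootPairing.Base.algebraMap_cartanMatrixIn_apply]
    have : B.h' j = coroot (e j).1.1 := Subtype.ext (hh j)
    rw [this]
    rfl
  obtain ⟨f, hf⟩ : ∃ f : H.root → ℕ, (rootSystem H).root α =
      ∑ i ∈ b.support, f i • (rootSystem H).root i := by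
    obtain ⟨f, -, hf | hf⟩ := b.exists_root_eq_sum_nat_or_neg α
    · exact ⟨f, hf⟩
    · exfalso
      have h1 : (rootSystem H).root α = ∑ j ∈ b.support, (fun i ↦ -(f i : ℤ)) j •
          (rootSystem H).root j := by
        rw [hf, ← Finset.sum_neg_distrib]
        refine Finset.sum_congr rfl fun i _ ↦ ?_
        simp
      have h2 := b.height_eq_sum h1
      have h3 : ∑ i ∈ b.support, -(f i : ℤ) ≤ 0 :=
        Finset.sum_nonpos fun i _ ↦ by simp
      have h4 : 0 < b.height α := hα
      rw [h2] at h4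
      exact absurd h3 (not_le.2 h4)
  have h1 : (α.1 : H → k) = ∑ i, f (e i).1 • (B.baseSupp i : H → k) := by
    have h2 : (rootSystem H).root α = ∑ i, f (e i).1 • B.baseSupp i := by
      rw [hf, ← Finset.sum_coe_sort b.support, ← e.sum_comp]
      refine Finset.sum_congr rfl fun i _ ↦ ?_
      rw [hsupp]
    funext x
    have h3 := LinearMap.congr_fun h2 x
    rw [LinearMap.sum_apply] at h3
    rw [Finset.sum_apply]
    exact h3
  have hn : (fun i ↦ f (e i).1) ≠ 0 := by
    intro h
    have h2 : (α.1 : H → k) = 0 := by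
      rw [h1]
      refine Finset.sum_eq_zero fun i _ ↦ ?_
      have : f (e i).1 = 0 := congrFun h i
      rw [this, zero_smul]
    have h3 : α.1.IsNonZero := by
      clear hx hα hf h1 h2
      obtain ⟨α', hα'⟩ := α
      simpa using hα'
    exact h3 h2
  have h2 : x ∈ B.borelUpper := by
    rw [B.borelUpper_eq]
    rw [h1] at hx
    have h3 : rootSpace H (∑ i, f (e i).1 • (B.baseSupp i : H → k)) ≤
        ⨆ (n : ι → ℕ) (_ : n ≠ 0), rootSpace H (∑ i, n i • (B.baseSupp i : H → k)) :=
      le_iSup₂_of_le _ hn le_rfl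
    convert! h3 hx using 6
  exact h2

/-- The vector generates a submodule in which a proper submodule is one that omits it. The quotient
by a maximal such submodule is irreducible and keeps the highest weight vector. -/
theorem exists_isIrreducibleWithHighestWeight (B : LieAlgebra.Basis ι H)
    (hh : ∀ i, B.h i = coroot (e i).1.1) (hA : ∀ i j, B.A i j = b.cartanMatrix (e i) (e j))
    (V : Type u) [AddCommGroup V] [Module k V] [LieRingModule L V] [LieModule k L V]
    [FiniteDimensional k V] {v₀ : V} {χ₀ : Module.Dual k H} (hv₀ : v₀ ≠ 0)
    (hv₀h : ∀ h : H, ⁅(h : L), v₀⁆ = χ₀ h • v₀) (hv₀e : ∀ i, ⁅B.e i, v₀⁆ = 0) :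
    ∃ (W : Type u) (_ : AddCommGroup W) (_ : Module k W) (_ : FiniteDimensional k W)
      (ρ : L →ₗ⁅k⁆ sl k W), IsIrreducibleWithHighestWeight b ρ χ₀ := by
  let U : LieSubmodule k L V :=
    { Submodule.span k (Set.range (loweringWord B v₀)) with
      lie_mem := fun {x v} hv ↦ lie_mem_span_loweringWord B hv₀h hv₀e x v hv }
  let u₀ : U := ⟨v₀, Submodule.subset_span ⟨[], rfl⟩⟩
  have hgen : ∀ M : LieSubmodule k L U, u₀ ∈ M → M = ⊤ := by
    intro M hM
    have h1 : Submodule.span k (Set.range (loweringWord B v₀)) ≤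
        M.toSubmodule.map U.toSubmodule.subtype := by
      rw [Submodule.span_le]
      rintro - ⟨w, rfl⟩
      induction w with
      | nil => exact ⟨u₀, hM, rfl⟩
      | cons i w ih =>
        obtain ⟨m, hm, hm'⟩ := ih
        exact ⟨(⁅B.f i, (m : U)⁆ : U), M.lie_mem hm, congrArg (fun v ↦ ⁅B.f i, v⁆) hm'⟩
    rw [eq_top_iff]
    intro u _
    obtain ⟨m, hm, hm'⟩ := h1 u.2
    have : m = u := Subtype.ext hm'
    exact this ▸ hm
  obtain ⟨N, hN, hmax⟩ := (wellFounded_gt (α := LieSubmodule k L U)).has_min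
    {N | u₀ ∉ N} ⟨⊥, fun h ↦ hv₀ (congrArg Subtype.val ((LieSubmodule.mem_bot u₀).1 h))⟩
  have hmk : ∀ x (u : U), ⁅x, (LieSubmodule.Quotient.mk u : U ⧸ N)⁆ =
      LieSubmodule.Quotient.mk ⁅x, u⁆ := fun x u ↦
    ((LieSubmodule.Quotient.mk' N).map_lie x u).symm
  have : FiniteDimensional k (U ⧸ N) :=
    Module.Finite.of_surjective (LieSubmodule.Quotient.mk' N : U →ₗ[k] U ⧸ N)
      (LieSubmodule.Quotient.surjective_mk' N)
  refine ⟨U ⧸ N, inferInstance, inferInstance, this, repOfLieModule L (U ⧸ N), ?_, ?_⟩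
  · intro W hW
    let W' : LieSubmodule k L (U ⧸ N) := { W with lie_mem := fun {x w} hw ↦ hW x w hw }
    set M := W'.comap (LieSubmodule.Quotient.mk' N) with hM
    by_cases h : u₀ ∈ M
    · right
      rw [eq_top_iff]
      intro w _
      obtain ⟨u, rfl⟩ := LieSubmodule.Quotient.surjective_mk' N w
      have : u ∈ M := by rw [hgen M h]; trivial
      exact this
    · left
      have hNM : N ≤ M := fun u hu ↦ by
        have h1 : LieSubmodule.Quotient.mk' N u = 0 := (LieSubmodule.Quotient.mk_eq_zero N).2 hu
        change LieSubmodule.Quotient.mk' N u ∈ W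
        rw [h1]
        exact W.zero_mem
      have hMN : M = N := (hNM.eq_or_lt.resolve_right fun h' ↦ hmax M h h').symm
      rw [eq_bot_iff]
      intro w hw
      obtain ⟨u, rfl⟩ := LieSubmodule.Quotient.surjective_mk' N w
      have h1 : u ∈ M := hw
      rw [hMN] at h1
      exact (LieSubmodule.Quotient.mk_eq_zero N).2 h1
  · refine ⟨LieSubmodule.Quotient.mk u₀, fun h ↦ hN ((LieSubmodule.Quotient.mk_eq_zero N).1 h),
      fun h ↦ ?_, fun α hα x hx ↦ ?_⟩
    · rw [coe_repOfLieModule, hmk]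
      have : ⁅(h : L), u₀⁆ = χ₀ h • u₀ := Subtype.ext (hv₀h h)
      rw [this]
      rfl
    · rw [coe_repOfLieModule, hmk]
      have h1 := rootSpace_le_lieSpan_of_isPos B hh hA hα hx
      have h2 : ⁅x, u₀⁆ = 0 := by
        clear hx
        induction h1 using LieSubalgebra.lieSpan_induction with
        | mem y hy =>
          obtain ⟨i, rfl⟩ := hy
          exact Subtype.ext (hv₀e i)
        | zero => exact zero_lie _
        | add y z _ _ hy hz => rw [add_lie, hy, hz, add_zero]
        | smul c y _ hy => rw [smul_lie, hy, smul_zero]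
        | lie y z _ _ hy hz => rw [lie_lie, hy, hz, lie_zero, lie_zero, sub_zero]
      rw [h2]
      rfl

end IrreducibleQuotient

/-! ### Representations from the Chevalley relations -/

section Ideals

open LieModule LieAlgebra Module

variable {k D ι : Type*} [Field k] [IsAlgClosed k] [CharZero k] [LieRing D] [LieAlgebra k D]
  [FiniteDimensional k D] {H : LieSubalgebra k D} [Fintype ι] (B : LieAlgebra.Basis ι H)

/-- The algebra is the sum of its Cartan subalgebra and the two nilpotent parts, whose weights have
coefficients of one sign; independence of weight spaces excludes any other weight. -/
theorem exists_nat_sum_baseSupp {χ : Module.Dual k H} {x : D} (hx : x ≠ 0)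
    (hχ : ∀ h : H, ⁅(h : D), x⁆ = χ h • x) :
    ∃ n : ι → ℕ, χ = ∑ i, n i • B.baseSupp i ∨ χ = - ∑ i, n i • B.baseSupp i := by
  have := B.isLieAbelian_cartan
  by_contra! hn
  have h1 := iSupIndep_genWeightSpace k H D (χ : H → k)
  set N : LieSubmodule k H D := ⨆ χ', ⨆ (_ : χ' ≠ (χ : H → k)), genWeightSpace D χ' with hN
  have h2 : N = ⊤ := by
    rw [eq_top_iff, ← B.iSup_cartan_borelLower_borelUpper_eq_top, iSup_le_iff]
    intro i
    fin_cases i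
    · refine (toLieSubmodule_le_rootSpace_zero k D H).trans (le_iSup₂_of_le _ (fun h ↦ ?_) le_rfl)
      exact (hn 0).1 (LinearMap.coe_injective (by rw [← h]; simp; rfl))
    · refine B.borelLower_le_biSup.trans (iSup₂_le fun n _ ↦ le_iSup₂_of_le _ (fun h ↦ ?_) le_rfl)
      refine (hn n).2 (LinearMap.coe_injective ?_)
      rw [← h]
      funext y
      simp
    · refine B.borelUpper_le_biSup.trans (iSup₂_le fun n _ ↦ le_iSup₂_of_le _ (fun h ↦ ?_) le_rfl)
      refine (hn n).1 (LinearMap.coe_injective ?_)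
      rw [← h]
      funext y
      simp
  rw [h2, disjoint_top] at h1
  have h3 : x ∈ genWeightSpace D (χ : H → k) := (mem_genWeightSpace _ _ _).mpr fun h ↦ ⟨1, by
    rw [pow_one, LinearMap.sub_apply, LinearMap.smul_apply, toEnd_apply_apply,
      Module.End.one_apply, sub_eq_zero]
    exact hχ h⟩
  have h4 : genWeightSpace D (χ : H → k) = ⊥ := h1
  rw [h4, LieSubmodule.mem_bot] at h3
  exact hx h3

/-- Descent on the height. A nonzero vector killed by all f_j is a lowest weight vector, so its
weight is non-positive at all coroots and `hP` makes it zero. Otherwise some f_i lowers the height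
within `K`; if n_i = 0 the new weight would have coefficients of mixed signs, or n would vanish. -/
theorem eq_zero_of_weight_eq_sum
    (hP : ∀ n : ι → ℕ, (∀ j, ∑ i, (n i : ℤ) * B.A i j ≤ 0) → n = 0)
    {K : LieIdeal k D} (hK : ∀ x ∈ K, x ∈ H → x = 0) (m : ℕ) :
    ∀ n : ι → ℕ, ∑ i, n i = m → ∀ x ∈ K,
      (∀ h : H, ⁅(h : D), x⁆ = (∑ i, n i • B.baseSupp i) h • x) → x = 0 := by
  classical
  have := B.isLieAbelian_cartan
  induction m with
  | zero =>
    intro n hn x hx hxh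
    refine hK x hx ?_
    have hn0 : ∀ i, n i = 0 := fun i ↦ (Finset.sum_eq_zero_iff.1 hn) i (Finset.mem_univ i)
    have h1 : x ∈ rootSpace H (0 : H → k) := (mem_genWeightSpace _ _ _).mpr fun h ↦ ⟨1, by
      rw [pow_one, LinearMap.sub_apply, LinearMap.smul_apply, toEnd_apply_apply,
        Pi.zero_apply, zero_smul, sub_zero]
      have := hxh h
      simp only [hn0, zero_smul, Finset.sum_const_zero, LinearMap.zero_apply] at this
      exact this⟩
    rw [← B.cartan_eq] at h1
    exact h1
  | succ m ih =>
    intro n hn x hx hxh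
    by_contra hx0
    have hχ : ∀ j, (∑ i, n i • B.baseSupp i) (B.h' j) = ((∑ i, (n i : ℤ) * B.A i j : ℤ) : k) := by
      intro j
      rw [LinearMap.sum_apply]
      push_cast
      refine Finset.sum_congr rfl fun i _ ↦ ?_
      rw [LinearMap.smul_apply, B.baseSupp_apply_h', nsmul_eq_mul]
    obtain ⟨i, hi⟩ : ∃ i, ⁅B.f i, x⁆ ≠ 0 := by
      by_contra! hf
      have hn0 : n = 0 := hP n fun j ↦ by
        have hprim : (B.sl2 j).symm.HasPrimitiveVectorWith x
            ((-(∑ i, (n i : ℤ) * B.A i j) : ℤ) : k) :=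
          { ne_zero := hx0
            lie_h := by
              have := hxh (B.h' j)
              rw [hχ] at this
              rw [neg_lie, Int.cast_neg, neg_smul, ← this]
              rfl
            lie_e := hf j }
        obtain ⟨p, hp⟩ := hprim.exists_nat
        have : -(∑ i, (n i : ℤ) * B.A i j) = p := by exact_mod_cast hp
        omega
      rw [hn0] at hn
      simp at hn
    have hw : ∀ h : H, ⁅(h : D), ⁅B.f i, x⁆⁆ =
        (∑ l, n l • B.baseSupp l - B.baseSupp i) h • ⁅B.f i, x⁆ := by
      intro h
      have h1 : ⁅(h : D), B.f i⁆ = -(B.baseSupp i h • B.f i) := by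
        rw [B.baseSupp_apply_smul_f, neg_neg]; rfl
      rw [leibniz_lie, hxh, h1, neg_lie, smul_lie, lie_smul, LinearMap.sub_apply, sub_smul]
      abel
    have hmem : ⁅B.f i, x⁆ ∈ K := K.lie_mem hx
    by_cases hni : n i = 0
    · have hind : ∀ m : ι → ℤ, ∑ l, m l • B.baseSupp l = 0 → m = 0 := by
        intro m hm
        have h1 := Fintype.linearIndependent_iff.1 B.linearIndependent_baseSupp
          (fun l ↦ (m l : k)) (by simpa only [Int.cast_smul_eq_zsmul] using hm)
        funext l
        have := h1 l
        exact_mod_cast this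
      obtain ⟨n', h' | h'⟩ := exists_nat_sum_baseSupp B hi hw
      · have h2 := hind (fun l ↦ (n l : ℤ) - (if l = i then 1 else 0) - n' l) (by
          simp only [sub_smul, Finset.sum_sub_distrib, natCast_zsmul, ite_smul, one_smul, zero_smul,
            Finset.sum_ite_eq', Finset.mem_univ, if_true]
          rw [h', sub_self])
        have h3 := congrFun h2 i
        simp only [hni, if_true, Pi.zero_apply] at h3
        omega
      · have h2 := hind (fun l ↦ (n l : ℤ) - (if l = i then 1 else 0) + n' l) (by
          simp only [sub_smul, add_smul, Finset.sum_sub_distrib, Finset.sum_add_distrib,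
            natCast_zsmul, ite_smul, one_smul, zero_smul,
            Finset.sum_ite_eq', Finset.mem_univ, if_true]
          rw [h', neg_add_cancel])
        have h3 : ∑ l, n l = 0 := by
          refine Finset.sum_eq_zero fun l _ ↦ ?_
          have h3 := congrFun h2 l
          simp only [Pi.zero_apply] at h3
          by_cases hl : l = i
          · rw [hl, hni]
          · rw [if_neg hl] at h3
            omega
        omega
    · refine hi (ih (n - Pi.single i 1) ?_ _ hmem fun h ↦ ?_)
      · have h1 : n = (n - Pi.single i 1) + Pi.single i 1 := by
          funext l
          by_cases hl : l = i
          · subst hl; simp; omega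
          · simp [hl]
        have h2 := congrArg (fun f ↦ ∑ l, f l) h1
        simp only [Pi.add_apply, Finset.sum_add_distrib, Finset.sum_pi_single', Finset.mem_univ,
          if_true] at h2
        omega
      · rw [hw]
        congr 2
        rw [sub_eq_iff_eq_add]
        have : B.baseSupp i = ∑ l, (Pi.single i 1 : ι → ℕ) l • B.baseSupp l := by
          simp [Pi.single_apply]
        conv_rhs => rw [this]
        rw [← Finset.sum_add_distrib]
        refine Finset.sum_congr rfl fun l _ ↦ ?_
        rw [← add_smul]
        congr 1
        by_cases hl : l = i
        · subst hl; simp; omega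
        · simp [hl]

/-- An ideal that meets the Cartan subalgebra trivially is zero. -/
theorem eq_bot_of_disjoint_cartan
    (hP : ∀ n : ι → ℕ, (∀ j, ∑ i, (n i : ℤ) * B.A i j ≤ 0) → n = 0)
    {K : LieIdeal k D} (hK : ∀ x ∈ K, x ∈ H → x = 0) : K = ⊥ := by
  have := B.isLieAbelian_cartan
  let N : LieSubmodule k H D := { K.toSubmodule with lie_mem := fun {x y} hy ↦ K.lie_mem hy }
  by_contra hne
  have hN : N ≠ ⊥ := by
    intro h
    apply hne
    rw [LieSubmodule.eq_bot_iff]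
    intro x hx
    have : x ∈ N := hx
    rwa [h, LieSubmodule.mem_bot] at this
  have htop := iSup_genWeightSpace_eq_top' k H N
  have : Nonempty (Weight k H N) := by
    by_contra h
    rw [not_nonempty_iff] at h
    rw [iSup_of_empty] at htop
    apply hN
    rw [LieSubmodule.eq_bot_iff]
    intro x hx
    have : (⟨x, hx⟩ : N) ∈ (⊤ : LieSubmodule k H N) := trivial
    rw [← htop, LieSubmodule.mem_bot] at this
    exact congrArg Subtype.val this
  obtain ⟨χ⟩ := this
  obtain ⟨⟨x, hx⟩, hx0, hxχ⟩ := exists_forall_lie_eq_smul k H N χ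
  have hx0' : x ≠ 0 := fun h ↦ hx0 (Subtype.ext h)
  have hxχ' : ∀ h : H, ⁅(h : D), x⁆ = Weight.toLinear k H N χ h • x := fun h ↦ congrArg Subtype.val (hxχ h)
  obtain ⟨n, hn | hn⟩ := exists_nat_sum_baseSupp B hx0' hxχ'
  · refine hx0' (eq_zero_of_weight_eq_sum B hP hK _ n rfl x hx fun h ↦ ?_)
    rw [hxχ', hn]
  -- Exchanging raising and lowering operators turns negative combinations into positive ones.
  · refine hx0' (eq_zero_of_weight_eq_sum B.symm hP hK _ n rfl x hx fun h ↦ ?_)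
    rw [hxχ', hn]
    simp

end Ideals

/-! ### Homomorphisms and foldings from the Chevalley relations -/

section Chevalley

open LieModule LieAlgebra Module

/-- The elements `h i`, `e i`, `f i` satisfy the Chevalley relations of the matrix `A`. -/
structure IsChevalley {ι G : Type*} [LieRing G] (A : Matrix ι ι ℤ) (h e f : ι → G) : Prop where
  lie_e_f (i : ι) : ⁅e i, f i⁆ = h i
  lie_e_f_ne (i j : ι) (hij : i ≠ j) : ⁅e i, f j⁆ = 0
  lie_h_h (i j : ι) : ⁅h i, h j⁆ = 0
  lie_h_e (i j : ι) : ⁅h j, e i⁆ = A i j • e i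
  lie_h_f (i j : ι) : ⁅h j, f i⁆ = -A i j • f i

theorem IsChevalley.map {ι k G G' : Type*} [CommRing k] [LieRing G] [LieAlgebra k G] [LieRing G']
    [LieAlgebra k G'] {A : Matrix ι ι ℤ} {h e f : ι → G} (hc : IsChevalley A h e f)
    (φ : G →ₗ⁅k⁆ G') : IsChevalley A (fun i ↦ φ (h i)) (fun i ↦ φ (e i)) fun i ↦ φ (f i) where
  lie_e_f i := by rw [← φ.map_lie, hc.lie_e_f]
  lie_e_f_ne i j hij := by rw [← φ.map_lie, hc.lie_e_f_ne i j hij, map_zero]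
  lie_h_h i j := by rw [← φ.map_lie, hc.lie_h_h, map_zero]
  lie_h_e i j := by rw [← φ.map_lie, hc.lie_h_e, map_zsmul]
  lie_h_f i j := by rw [← φ.map_lie, hc.lie_h_f, map_zsmul]

/-- The Chevalley relations are inherited by the sums over the fibres of a folding. -/
theorem IsChevalley.fold {ι κ G : Type*} [Fintype κ] [DecidableEq ι] [LieRing G]
    {A : Matrix ι ι ℤ} {A' : Matrix κ κ ℤ} {h e f : κ → G} (hc : IsChevalley A' h e f)
    (π : κ → ι) (hπ : ∀ j i, ∑ j' with π j' = i, A' j j' = A (π j) i) :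
    IsChevalley A (fun i ↦ ∑ j with π j = i, h j) (fun i ↦ ∑ j with π j = i, e j)
      fun i ↦ ∑ j with π j = i, f j where
  lie_e_f i := by
    rw [sum_lie]
    refine Finset.sum_congr rfl fun j hj ↦ ?_
    rw [lie_sum, Finset.sum_eq_single j, hc.lie_e_f]
    · exact fun j' _ hne ↦ hc.lie_e_f_ne _ _ hne.symm
    · exact fun h ↦ absurd hj h
  lie_e_f_ne i i' hi := by
    rw [sum_lie]
    refine Finset.sum_eq_zero fun j hj ↦ ?_
    rw [lie_sum]
    refine Finset.sum_eq_zero fun j' hj' ↦ hc.lie_e_f_ne _ _ ?_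
    rintro rfl
    exact hi ((Finset.mem_filter.1 hj).2.symm.trans (Finset.mem_filter.1 hj').2)
  lie_h_h i i' := by
    rw [sum_lie]
    refine Finset.sum_eq_zero fun j _ ↦ ?_
    rw [lie_sum]
    exact Finset.sum_eq_zero fun j' _ ↦ hc.lie_h_h _ _
  lie_h_e i i' := by
    rw [lie_sum, Finset.smul_sum]
    refine Finset.sum_congr rfl fun j hj ↦ ?_
    rw [sum_lie, Finset.sum_congr rfl fun j' _ ↦ hc.lie_h_e j j', ← Finset.sum_smul, hπ,
      (Finset.mem_filter.1 hj).2]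
  lie_h_f i i' := by
    rw [lie_sum, Finset.smul_sum]
    refine Finset.sum_congr rfl fun j hj ↦ ?_
    rw [sum_lie, Finset.sum_congr rfl fun j' _ ↦ hc.lie_h_f j j', ← Finset.sum_smul,
      Finset.sum_neg_distrib, hπ, (Finset.mem_filter.1 hj).2]

variable {k L G ι : Type*} [Field k] [IsAlgClosed k] [CharZero k] [LieRing L] [LieAlgebra k L]
  [FiniteDimensional k L] [LieRing G] [LieAlgebra k G] [FiniteDimensional k G]
  {H : LieSubalgebra k L} [Fintype ι] (B : LieAlgebra.Basis ι H)

/-- The subalgebra `D` of `L × G` generated by the pairs of generators is to be the graph of φ. It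
again has Chevalley generators with the same matrix, and the kernel of its projection to `L` meets
its Cartan subalgebra trivially because the h_i are independent. Such an ideal is zero, so the
projection is bijective. -/
theorem exists_lieHom_of_isChevalley
    (hP : ∀ n : ι → ℕ, (∀ j, ∑ i, (n i : ℤ) * B.A i j ≤ 0) → n = 0)
    {h e f : ι → G} (hc : IsChevalley B.A h e f) :
    ∃ φ : L →ₗ⁅k⁆ G, (∀ i, φ (B.h i) = h i) ∧ (∀ i, φ (B.e i) = e i) ∧ ∀ i, φ (B.f i) = f i := by
  have : IsAddTorsionFree L := .of_isTorsionFree k L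
  set S : Set (L × G) := (Set.range fun i ↦ (B.e i, e i)) ∪ Set.range fun i ↦ (B.f i, f i) with hS
  let D := LieSubalgebra.lieSpan k (L × G) S
  let e' : ι → D := fun i ↦ ⟨(B.e i, e i), LieSubalgebra.subset_lieSpan (Or.inl ⟨i, rfl⟩)⟩
  let f' : ι → D := fun i ↦ ⟨(B.f i, f i), LieSubalgebra.subset_lieSpan (Or.inr ⟨i, rfl⟩)⟩
  let h' : ι → D := fun i ↦ ⟨(B.h i, h i), by
    have := D.lie_mem (e' i).2 (f' i).2
    have h1 : ⁅((e' i : D) : L × G), ((f' i : D) : L × G)⁆ = (B.h i, h i) :=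
      Prod.ext (B.sl2 i).lie_e_f (hc.lie_e_f i)
    rwa [h1] at this⟩
  have hext : ∀ x y : D, x.1.1 = y.1.1 → x.1.2 = y.1.2 → x = y :=
    fun x y h1 h2 ↦ Subtype.ext (Prod.ext h1 h2)
  let B' : LieAlgebra.Basis ι (LieSubalgebra.lieSpan k D (Set.range h')) :=
    { A := B.A
      h := h'
      e := e'
      f := f'
      cartan_eq_lieSpan := rfl
      span_ef := by
        have h1 : Set.range e' ∪ Set.range f' = Subtype.val ⁻¹' S := by
          ext x
          simp only [hS, Set.mem_union, Set.mem_range, Set.mem_preimage, e', f', Subtype.ext_iff]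
        rw [h1]
        exact LieSubalgebra.lieSpan_lieSpan_coe_preimage
      linInd := .of_comp D.toSubmodule.subtype (.of_comp (LinearMap.fst k L G) B.linInd)
      nondegen := B.nondegen
      sl2 := fun i ↦
        { h_ne_zero := fun h0 ↦ (B.sl2 i).h_ne_zero (congrArg (fun x : D ↦ x.1.1) h0)
          lie_e_f := hext _ _ (B.sl2 i).lie_e_f (hc.lie_e_f i)
          lie_h_e_nsmul := hext _ _ (B.sl2 i).lie_h_e_nsmul (by
            have := hc.lie_h_e i i
            rw [B.A_diag_eq_two] at this
            exact this.trans (ofNat_zsmul (e i) 2))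
          lie_h_f_nsmul := hext _ _ (B.sl2 i).lie_h_f_nsmul (by
            have := hc.lie_h_f i i
            rw [B.A_diag_eq_two] at this
            exact this.trans ((neg_smul (2 : ℤ) (f i)).trans (congrArg Neg.neg (ofNat_zsmul (f i) 2)))) }
      lie_h_h := fun i j ↦ hext _ _ (B.lie_h_h i j) (hc.lie_h_h i j)
      lie_h_e := fun i j ↦ hext _ _ (B.lie_h_e i j) (hc.lie_h_e i j)
      lie_h_f := fun i j ↦ hext _ _ (B.lie_h_f i j) (hc.lie_h_f i j)
      lie_e_f_ne := fun i j hij ↦ hext _ _ (B.lie_e_f_ne i j hij) (hc.lie_e_f_ne i j hij) }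
  let p : D →ₗ⁅k⁆ L := (LieHom.fst k L G).comp D.incl
  have hker : p.ker = ⊥ := by
    refine eq_bot_of_disjoint_cartan B' hP fun x hx hxH ↦ ?_
    have h1 : x ∈ Submodule.span k (Set.range h') := by
      have := B'.coe_cartan_eq_span
      have h2 : x ∈ (LieSubalgebra.lieSpan k D (Set.range h')).toSubmodule := hxH
      rw [this] at h2
      exact h2
    obtain ⟨c, hc'⟩ := (Submodule.mem_span_range_iff_exists_fun k).1 h1
    have h2 : ∑ i, c i • B.h i = 0 := by
      have h3 : p x = 0 := LieHom.mem_ker.1 hx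
      rw [← hc', map_sum] at h3
      simp only [map_smul] at h3
      exact h3
    have h3 := Fintype.linearIndependent_iff.1 B.linInd c h2
    rw [← hc']
    exact Finset.sum_eq_zero fun i _ ↦ by rw [h3, zero_smul]
  have hsurj : Function.Surjective p := by
    rw [← LieHom.range_eq_top, eq_top_iff, ← B.span_ef, LieSubalgebra.lieSpan_le]
    rintro - (⟨i, rfl⟩ | ⟨i, rfl⟩)
    · exact ⟨e' i, rfl⟩
    · exact ⟨f' i, rfl⟩
  have hinj : Function.Injective p := (LieHom.ker_eq_bot p).1 hker
  let q : D ≃ₗ⁅k⁆ L := LieEquiv.ofBijective p ⟨hinj, hsurj⟩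
  let φ : L →ₗ⁅k⁆ G := ((LieHom.snd k L G).comp D.incl).comp q.symm.toLieHom
  have hφ : ∀ d : D, φ d.1.1 = d.1.2 := by
    intro d
    have h1 : q.symm d.1.1 = d := q.symm_apply_apply d
    change (q.symm d.1.1).1.2 = d.1.2
    rw [h1]
  exact ⟨φ, fun i ↦ hφ (h' i), fun i ↦ hφ (e' i), fun i ↦ hφ (f' i)⟩

/-- Positive definiteness of a Cartan matrix. -/
theorem eq_zero_of_sum_mul_cartanMatrix_nonpos {κ R M N : Type*} [Finite κ] [Field R] [CharZero R]
    [AddCommGroup M] [Module R M] [AddCommGroup N] [Module R N] {P : RootPairing κ R M N}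
    [P.IsRootSystem] [P.IsCrystallographic] (b : P.Base) (ε : ι ≃ b.support) (n : ι → ℕ)
    (hn : ∀ j, ∑ i, (n i : ℤ) * b.cartanMatrix (ε i) (ε j) ≤ 0) : n = 0 := by
  classical
  obtain ⟨d, hd, hd'⟩ := b.exists_cartanMatrix_mul_diagaonal_posDef
  by_contra hn0
  set x : b.support → ℤ := fun i ↦ n (ε.symm i) with hx
  have hx0 : x ≠ 0 := by
    intro h
    apply hn0
    funext i
    have := congrFun h (ε i)
    simpa [hx] using this
  have h1 := hd'.dotProduct_mulVec_pos hx0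
  have h2 : star x ⬝ᵥ (b.cartanMatrix * Matrix.diagonal d).mulVec x =
      ∑ j, (∑ i, x i * b.cartanMatrix i j) * (d j * x j) := by
    rw [Matrix.dotProduct_mulVec, ← Matrix.vecMul_vecMul]
    simp only [dotProduct, Matrix.vecMul_diagonal, star_trivial]
    refine Finset.sum_congr rfl fun j _ ↦ ?_
    rw [Matrix.vecMul, dotProduct, mul_assoc]
  rw [h2] at h1
  refine absurd h1 (not_lt.2 (Finset.sum_nonpos fun j _ ↦ mul_nonpos_of_nonpos_of_nonneg ?_ ?_))
  · have h3 := hn (ε.symm j)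
    rw [← ε.sum_comp]
    simpa [hx] using h3
  · exact mul_nonneg (hd j).le (Int.natCast_nonneg _)

end Chevalley

/-! ### Explicit minuscule modules -/

section Minuscule

open Module

variable {ι : Type*}

/-- There is a finite dimensional representation, over `k`, of the Chevalley relations of `A` that
has a highest weight vector of weight `c`. -/
def HasHighestWeightModule (k : Type u) [Field k] (A : Matrix ι ι ℤ) (c : ι → ℤ) : Prop :=
  ∃ (V : Type u) (_ : AddCommGroup V) (_ : Module k V) (_ : FiniteDimensional k V)
    (h e f : ι → End k V) (v₀ : V), IsChevalley A h e f ∧ v₀ ≠ 0 ∧ (∀ i, h i v₀ = c i • v₀) ∧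
      ∀ i, e i v₀ = 0

theorem HasHighestWeightModule.fold {k : Type u} [Field k] {κ : Type*} [Fintype κ] [DecidableEq ι]
    {A : Matrix ι ι ℤ} {A' : Matrix κ κ ℤ} {c : κ → ℤ} (h : HasHighestWeightModule k A' c)
    (π : κ → ι) (hπ : ∀ j i, ∑ j' with π j' = i, A' j j' = A (π j) i) :
    HasHighestWeightModule k A fun i ↦ ∑ j with π j = i, c j := by
  obtain ⟨V, _, _, hV, h, e, f, v₀, hc, hv₀, hh, he⟩ := h
  refine ⟨V, _, _, hV, _, _, _, v₀, hc.fold π hπ, hv₀, fun i ↦ ?_, fun i ↦ ?_⟩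
  · rw [LinearMap.sum_apply, Finset.sum_smul]
    exact Finset.sum_congr rfl fun j _ ↦ hh j
  · rw [LinearMap.sum_apply]
    exact Finset.sum_eq_zero fun j _ ↦ he j

/-- Generalized Cartan matrices. -/
def IsGeneralizedCartan (A : ι → ι → ℤ) : Prop :=
  (∀ i, A i i = 2) ∧ (∀ i j, i ≠ j → A i j ≤ 0) ∧ ∀ i j, A i j = 0 → A j i = 0

instance [Fintype ι] [DecidableEq ι] (A : ι → ι → ℤ) : Decidable (IsGeneralizedCartan A) := by
  unfold IsGeneralizedCartan
  infer_instance

variable {J : Type} {A : Matrix ι ι ℤ} {c : ι → ℤ} {w : J → ι → ℤ}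

/-- When all coordinates are -1, 0 or 1, the functions on the orbit form the module: e_i and f_i
move values along the reflection s_i, on the points with coordinate 1 and -1 respectively. -/
theorem IsQuasiMinuscule.hasHighestWeightModule (k : Type u) [Field k] [Finite J]
    (hw : IsQuasiMinuscule A c w) (h1 : ∀ j i, |w j i| ≤ 1) (hA : IsGeneralizedCartan A)
    (hnonneg : ∀ i, 0 ≤ c i) :
    HasHighestWeightModule k A c := by
  classical
  obtain ⟨hA, hneg, hzero⟩ := hA
  choose s hs using hw.reflected
  have hs' : ∀ j i l, w (s j i) l = w j l - w j i * A i l := by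
    intro j i l
    rw [hs]
    simp [simpleReflection]
  have hsi : ∀ j i, w (s j i) i = - w j i := by
    intro j i
    rw [hs', hA]
    ring
  have hss : ∀ j i, s (s j i) i = j := by
    intro j i
    apply hw.injective
    rw [hs, hs, simpleReflection_simpleReflection (hA i)]
  let h : ι → End k (J → k) := fun i ↦
    { toFun := fun x j ↦ w j i • x j
      map_add' := fun x y ↦ by ext j; simp
      map_smul' := fun a x ↦ by ext j; simp [mul_left_comm] }
  let p : ℤ → ι → End k (J → k) := fun n i ↦
    { toFun := fun x j ↦ if w j i = n then x (s j i) else 0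
      map_add' := fun x y ↦ by ext j; by_cases hj : w j i = n <;> simp [hj]
      map_smul' := fun a x ↦ by ext j; by_cases hj : w j i = n <;> simp [hj] }
  have hh : ∀ i x j, h i x j = w j i • x j := fun _ _ _ ↦ rfl
  have hp : ∀ n i x j, p n i x j = if w j i = n then x (s j i) else 0 := fun _ _ _ _ ↦ rfl
  have hbr : ∀ (a b : End k (J → k)) x j, ⁅a, b⁆ x j = a (b x) j - b (a x) j := fun _ _ _ _ ↦ rfl
  have hhp : ∀ n i l, ⁅h l, p n i⁆ = (n * A i l) • p n i := by
    intro n i l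
    refine LinearMap.ext fun x ↦ funext fun j ↦ ?_
    rw [hbr, hh, hp, hp, LinearMap.smul_apply, Pi.smul_apply, hp, hh, hs']
    split_ifs with hj
    · rw [← sub_smul, hj]
      congr 1
      ring
    · simp
  have hc : IsChevalley A h (p 1) (p (-1)) :=
    { lie_e_f := by
        intro i
        refine LinearMap.ext fun x ↦ funext fun j ↦ ?_
        rw [hbr, hp, hp, hp, hp, hsi, hss, hh]
        obtain ⟨h2, h3⟩ := abs_le.1 (h1 j i)
        obtain h4 | h4 | h4 : w j i = -1 ∨ w j i = 0 ∨ w j i = 1 := by omega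
        all_goals simp [h4]
      lie_e_f_ne := by
        intro i l hil
        refine LinearMap.ext fun x ↦ funext fun j ↦ ?_
        rw [hbr, hp, hp, hp, hp, hs', hs']
        have h2 := hneg i l hil
        have h3 := hneg l i hil.symm
        have h4 := abs_le.1 (h1 j i)
        have h5 := abs_le.1 (h1 j l)
        -- A product of e_i and f_l is nonzero at j only in this case, since off-diagonal entries
        -- are non-positive; then A_il = 0 and the two reflections commute.
        by_cases h6 : w j i = 1 ∧ w j l = -1 ∧ A i l = 0
        · obtain ⟨h7, h8, h9⟩ := h6
          have h10 := hzero i l h9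
          have h11 : s (s j i) l = s (s j l) i := by
            apply hw.injective
            funext m
            rw [hs', hs', hs', hs', hs', hs', h9, h10]
            ring
          simp [h7, h8, h9, h10, h11]
        · have h7 : ¬ (w j i = 1 ∧ w j l - w j i * A i l = -1) := by
            rintro ⟨h7, h8⟩
            rw [h7] at h8
            exact h6 ⟨h7, by omega, by omega⟩
          have h8 : ¬ (w j l = -1 ∧ w j i - w j l * A l i = 1) := by
            rintro ⟨h8, h9⟩
            rw [h8] at h9
            exact h6 ⟨by omega, h8, hzero l i (by omega)⟩
          rw [← ite_and, ← ite_and, if_neg h7, if_neg h8, sub_zero]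
          rfl
      lie_h_h := by
        intro i l
        refine LinearMap.ext fun x ↦ funext fun j ↦ ?_
        rw [hbr, hh, hh, hh, hh, smul_comm, sub_self]
        rfl
      lie_h_e := by
        intro i l
        rw [hhp, one_mul]
      lie_h_f := by
        intro i l
        rw [hhp, neg_one_mul] }
  obtain ⟨j₀, hj₀⟩ := hw.exists_eq
  refine ⟨J → k, inferInstance, inferInstance, inferInstance, h, p 1, p (-1), Pi.single j₀ 1, hc,
    by simp, fun i ↦ ?_, fun i ↦ ?_⟩
  · funext j
    rw [hh, Pi.smul_apply, Pi.single_apply]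
    split_ifs with hj
    · rw [hj, hj₀]
    · simp
  · funext j
    rw [hp, Pi.single_apply, Pi.zero_apply]
    split_ifs with hj hj' <;> try rfl
    have h2 : w j₀ i = -1 := by rw [← hj', hsi, hj]
    have h3 := hnonneg i
    rw [← hj₀] at h3
    omega

end Minuscule

/-! ### Highest weight modules for all types except E₈ -/

section Classification

namespace SimpleType

/-- The folding of `D r` onto `B (r - 1)`. -/
theorem sum_fiber_cartanMatrix_D {r : ℕ} (hr : 3 ≤ r) (j : Fin (r + 1)) (i : Fin r) :
    ∑ j' : Fin (r + 1) with (⟨min j'.1 (r - 1), by omega⟩ : Fin r) = i, CartanMatrix.D (r + 1) j j' =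
      CartanMatrix.B r ⟨min j.1 (r - 1), by omega⟩ i := by
  have hD : ∀ i j : Fin (r + 1), CartanMatrix.D (r + 1) i j = _ :=
    cartanMatrix_D_apply (by omega : 4 ≤ r + 1)
  have hB : ∀ i j : Fin r, CartanMatrix.B r i j = _ := cartanMatrix_B_apply hr
  rw [Finset.sum_filter, Fin.sum_univ_castSucc]
  have h1 : ∀ m : Fin r, (⟨min m.castSucc.1 (r - 1), by omega⟩ : Fin r) = m := fun m ↦
    Fin.ext (by simp only [Fin.val_castSucc]; omega)
  simp only [h1, Finset.sum_ite_eq', Finset.mem_univ, if_true]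
  have h2 : min (Fin.last r).1 (r - 1) = r - 1 := by rw [Fin.val_last]; omega
  have h3 : j.1 < r ∧ min j.1 (r - 1) = j.1 ∨ j.1 = r ∧ min j.1 (r - 1) = r - 1 := by omega
  have h4 : min j.1 (r - 1) < r := by omega
  simp only [h2, Fin.ext_iff]
  generalize hm : (⟨min j.1 (r - 1), h4⟩ : Fin r) = m
  have h5 : min j.1 (r - 1) = m.1 := congrArg Fin.val hm
  rw [h5] at h3
  clear hm h5 h4
  rw [hD, hD, hB]
  simp only [Fin.val_castSucc, Fin.val_last]
  obtain ⟨i, hi⟩ := i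
  obtain ⟨j, hj⟩ := j
  obtain ⟨m, hm⟩ := m
  clear hD hB h1 h2
  simp only at h3 ⊢
  obtain ⟨h, rfl⟩ | ⟨rfl, rfl⟩ := h3 <;> grind

variable (k : Type u) [Field k]

theorem hasHighestWeightModule_D {r : ℕ} (hr : 4 ≤ r) :
    HasHighestWeightModule k (CartanMatrix.D r) (Pi.single ⟨0, by omega⟩ 1) := by
  have hA : ∀ i j : Fin r, CartanMatrix.D r i j = _ := cartanMatrix_D_apply hr
  have h0 : vecD r ⟨0, by omega⟩ = Pi.single ⟨0, by omega⟩ 1 := by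
    funext j
    simp only [vecD, Pi.single_apply, Fin.ext_iff]
    grind
  refine (h0 ▸ isQuasiMinuscule_D hr).hasHighestWeightModule k ?_ ⟨?_, ?_, ?_⟩ ?_
  · rintro ⟨m, _ | _⟩ i
    · simp only [vecD, Bool.false_eq_true, if_false, Pi.neg_apply, abs_neg]
      split_ifs <;> simp
    · simp only [vecD, if_true]
      split_ifs <;> simp
  · intro i
    rw [hA]
    grind
  · intro i j hij
    rw [hA]
    have := Fin.val_ne_of_ne hij
    clear hA h0
    grind
  · intro i j
    rw [hA, hA]
    clear hA h0
    grind
  · intro i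
    rw [Pi.single_apply]
    split_ifs <;> simp

theorem hasHighestWeightModule_E6 :
    HasHighestWeightModule k CartanMatrix.E₆ (Pi.single 5 1) :=
  isQuasiMinuscule_E6.hasHighestWeightModule k (by decide +kernel)
    (show IsGeneralizedCartan fun i j ↦ CartanMatrix.E₆ i j by decide +kernel) (by decide +kernel)

theorem hasHighestWeightModule {T : SimpleType} (hT : T ≠ E8) :
    HasHighestWeightModule k T.cartanMatrix (Pi.single T.node 1) := by
  cases T with
  | A r hr =>
    have hA : ∀ i j : Fin r, CartanMatrix.A r i j = _ := cartanMatrix_A_apply hr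
    have h0 : vecA r 0 = Pi.single ⟨0, hr⟩ 1 := by
      funext j
      simp only [vecA, Pi.single_apply, Fin.ext_iff, Fin.val_zero]
      grind
    refine (h0 ▸ isQuasiMinuscule_A hr).hasHighestWeightModule k ?_ ⟨?_, ?_, ?_⟩ ?_
    · intro m i
      simp only [vecA]
      split_ifs <;> simp
    · intro i
      rw [hA]
      grind
    · intro i j hij
      rw [hA]
      have := Fin.val_ne_of_ne hij
      clear hA h0
      grind
    · intro i j
      rw [hA, hA]
      clear hA h0
      grind
    · intro i
      rw [Pi.single_apply]
      split_ifs <;> simp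
  | B r hr =>
    have h1 := (hasHighestWeightModule_D k (by omega : 4 ≤ r + 1)).fold
      (fun j ↦ (⟨min j.1 (r - 1), by omega⟩ : Fin r)) (sum_fiber_cartanMatrix_D hr)
    have h2 : (Pi.single (⟨0, by omega⟩ : Fin r) 1 : Fin r → ℤ) = fun i ↦
        ∑ j : Fin (r + 1) with (⟨min j.1 (r - 1), by omega⟩ : Fin r) = i,
          (Pi.single (⟨0, by omega⟩ : Fin (r + 1)) 1 : Fin (r + 1) → ℤ) j := by
      funext i
      simp only [Finset.sum_filter, Pi.single_apply]
      rw [Finset.sum_eq_single ⟨0, by omega⟩ (fun m _ hm ↦ by rw [if_neg hm, ite_self]) (by simp)]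
      simp [Fin.ext_iff, eq_comm]
    exact h2 ▸ h1
  | C r hr =>
    have hA : ∀ i j : Fin r, CartanMatrix.C r i j = _ := cartanMatrix_C_apply hr
    have h0 : vecC r ⟨0, by omega⟩ = Pi.single ⟨0, by omega⟩ 1 := by
      funext j
      simp only [vecC, Pi.single_apply, Fin.ext_iff]
      grind
    refine (h0 ▸ isQuasiMinuscule_C hr).hasHighestWeightModule k ?_ ⟨?_, ?_, ?_⟩ ?_
    · rintro ⟨m, _ | _⟩ i
      · simp only [vecC, Bool.false_eq_true, if_false, Pi.neg_apply, abs_neg]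
        split_ifs <;> simp
      · simp only [vecC, if_true]
        split_ifs <;> simp
    · intro i
      rw [hA]
      grind
    · intro i j hij
      rw [hA]
      have := Fin.val_ne_of_ne hij
      clear hA h0
      grind
    · intro i j
      rw [hA, hA]
      clear hA h0
      grind
    · intro i
      rw [Pi.single_apply]
      split_ifs <;> simp
  | D r hr => exact hasHighestWeightModule_D k hr
  | E6 => exact hasHighestWeightModule_E6 k
  | E7 =>
    exact isQuasiMinuscule_E7.hasHighestWeightModule k (by decide +kernel)
      (show IsGeneralizedCartan fun i j ↦ CartanMatrix.E₇ i j by decide +kernel) (by decide +kernel)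
  | E8 => exact absurd rfl hT
  | F4 =>
    -- F₄ is E₆ folded by its diagram involution; below, G₂ is D₄ folded by triality. The folded
    -- module need not be irreducible; only its highest weight vector matters.
    have h1 := (hasHighestWeightModule_E6 k).fold (A := CartanMatrix.F₄)
      (![3, 0, 2, 1, 2, 3] : Fin 6 → Fin 4) (by decide +kernel)
    have h2 : (Pi.single 3 1 : Fin 4 → ℤ) = fun i ↦
        ∑ j with (![3, 0, 2, 1, 2, 3] : Fin 6 → Fin 4) j = i, (Pi.single 5 1 : Fin 6 → ℤ) j := by
      decide +kernel
    exact h2 ▸ h1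
  | G2 =>
    have h1 := (hasHighestWeightModule_D k (le_refl 4)).fold (A := CartanMatrix.G₂.transpose)
      (![0, 1, 0, 0] : Fin 4 → Fin 2) (by decide +kernel)
    have h2 : (Pi.single 0 1 : Fin 2 → ℤ) = fun i ↦
        ∑ j with (![0, 1, 0, 0] : Fin 4 → Fin 2) j = i, (Pi.single 0 1 : Fin 4 → ℤ) j := by
      decide +kernel
    exact h2 ▸ h1

end SimpleType

end Classification

/-! ### The highest root of E₈ -/

section ExceptionalE8

open LieModule LieAlgebra LieAlgebra.IsKilling Module

section

variable {κ ι R M N : Type*} [Finite κ] [Field R] [CharZero R] [AddCommGroup M] [Module R M]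
  [AddCommGroup N] [Module R N] {P : RootPairing κ R M N} [P.IsCrystallographic]

theorem pairingIn_reflectionPerm_left (j α i : κ) : P.pairingIn ℤ (P.reflectionPerm j α) i =
    P.pairingIn ℤ α i - P.pairingIn ℤ α j * P.pairingIn ℤ j i := by
  apply FaithfulSMul.algebraMap_injective ℤ R
  rw [map_sub, map_mul]
  simp only [RootPairing.algebraMap_pairingIn]
  rw [← P.root_coroot_eq_pairing, P.root_reflectionPerm, P.reflection_apply]
  simp

/-- The highest root is dominant. -/
theorem pairingIn_nonneg_of_highest [P.IsRootSystem] [P.IsReduced] {b : P.Base} {θ : κ}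
    (hθ : ∀ i, P.root θ - P.root i ∈ AddSubmonoid.closure (P.root '' b.support))
    {i : κ} (hi : i ∈ b.support) : 0 ≤ P.pairingIn ℤ θ i := by
  by_contra! hn
  obtain ⟨n, hn'⟩ : ∃ n : ℕ, P.pairingIn ℤ θ i = -(n + 1) :=
    ⟨(-P.pairingIn ℤ θ i - 1).toNat, by omega⟩
  have h1 := hθ (P.reflectionPerm i θ)
  have h2 : P.root i ∈ AddSubmonoid.closure (P.root '' b.support) :=
    AddSubmonoid.subset_closure ⟨i, hi, rfl⟩
  rw [RootPairing.root_reflectionPerm, RootPairing.reflection_apply_root' ℤ, hn'] at h1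
  exact P.ne_zero i (eq_zero_of_add_eq_zero_of_mem_closure b h2
    (add_mem h1 (nsmul_mem h2 n)) (by module))

variable {r : ℕ} {w : ι → Fin r → ℤ} {A : Matrix (Fin r) (Fin r) ℤ} {b : P.Base}
  {e : Fin r ≃ b.support}

/-- The coordinates of the roots in a set of vectors that is stable under the simple reflections
and contains those of the simple roots. -/
theorem exists_eq_pairingIn [P.IsReduced]
    (hA : ∀ i j, b.cartanMatrix (e i) (e j) = A i j)
    (hw : ∀ j i, ∃ j', w j' = simpleReflection A i (w j)) (h0 : ∀ i, ∃ j, w j = A i) (α : κ) :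
    ∃ j, w j = fun i ↦ P.pairingIn ℤ α (e i) := by
  have hA' : ∀ i j, P.pairingIn ℤ (e i) (e j) = A i j := hA
  suffices h : (∃ j, w j = fun i ↦ P.pairingIn ℤ α (e i)) ∧
      ∃ j, w j = fun i ↦ - P.pairingIn ℤ α (e i) from h.1
  refine b.induction_reflect α (p := fun α ↦ (∃ j, w j = fun i ↦ P.pairingIn ℤ α (e i)) ∧
      ∃ j, w j = fun i ↦ - P.pairingIn ℤ α (e i)) (fun α h ↦ ?_)
    (fun α hα ↦ ?_) fun α β h hβ ↦ ?_
  · simp only [RootPairing.pairingIn_reflectionPerm_self_left, neg_neg]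
    exact h.symm
  · obtain ⟨i, hi⟩ := e.surjective ⟨α, hα⟩
    obtain rfl : (e i : κ) = α := congrArg Subtype.val hi
    simp only [hA']
    refine ⟨h0 i, ?_⟩
    obtain ⟨j, hj⟩ := h0 i
    obtain ⟨j', hj'⟩ := hw j i
    refine ⟨j', ?_⟩
    have h2 : A i i = 2 := by rw [← hA', P.pairingIn_same]
    rw [hj', hj]
    funext l
    simp only [simpleReflection, h2]
    ring
  · obtain ⟨i, hi⟩ := e.surjective ⟨β, hβ⟩
    obtain rfl : (e i : κ) = β := congrArg Subtype.val hi
    obtain ⟨⟨j, hj⟩, l, hl⟩ := h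
    obtain ⟨j', hj'⟩ := hw j i
    obtain ⟨l', hl'⟩ := hw l i
    refine ⟨⟨j', ?_⟩, l', ?_⟩
    · rw [hj', hj]
      funext m
      rw [pairingIn_reflectionPerm_left, hA']
      rfl
    · rw [hl', hl]
      funext m
      rw [pairingIn_reflectionPerm_left, hA']
      simp only [simpleReflection]
      ring

end

theorem exists_codesE8_eq_row (i : Fin 8) :
    ∃ m : Fin codesE8.length, codeVec 8 codesE8[m] = CartanMatrix.E₈.row i := by
  revert i
  decide +kernel

/-- The list consists of the roots, and the only dominant one is the fundamental weight ϖ₈. This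
identifies the highest root. -/
theorem eq_single_of_codesE8_nonneg (m : Fin codesE8.length) (h : ∀ i, 0 ≤ codeVec 8 codesE8[m] i) :
    codeVec 8 codesE8[m] = Pi.single 7 1 := by
  revert m
  decide +kernel

variable {k : Type u} [Field k] [IsAlgClosed k] [CharZero k]
  {L : Type v} [LieRing L] [LieAlgebra k L] [FiniteDimensional k L] [LieAlgebra.IsSimple k L]
  {H : LieSubalgebra k L} [H.IsCartanSubalgebra] {b : (rootSystem H).Base} {θ : H.root}

/-- The sum α + θ would be zero or a root, and neither is compatible with θ being highest. -/
theorem lie_eq_zero_of_highest (hθ : IsHighestRoot b θ) {α : H.root} (hα : α ∈ b.support) {x y : L}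
    (hx : x ∈ rootSpace H α.1) (hy : y ∈ rootSpace H θ.1) : ⁅x, y⁆ = 0 := by
  have h1 : ⁅x, y⁆ ∈ rootSpace H (α.1 + θ.1 : H → k) :=
    lie_mem_genWeightSpace_of_mem_genWeightSpace hx hy
  have hα' : (rootSystem H).root α ∈ AddSubmonoid.closure ((rootSystem H).root '' b.support) :=
    AddSubmonoid.subset_closure ⟨α, hα, rfl⟩
  by_contra h2
  have h3 : rootSpace H (α.1 + θ.1 : H → k) ≠ ⊥ := fun h ↦ h2 (by rw [h] at h1; simpa using h1)
  let χ : Weight k H L := ⟨α.1 + θ.1, h3⟩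
  have hχ : Weight.toLinear k H L χ = (rootSystem H).root α + (rootSystem H).root θ := by
    ext h
    rfl
  by_cases h4 : χ.IsZero
  · have h5 : (rootSystem H).root α + (rootSystem H).root θ = 0 := by
      rw [← hχ]
      ext h
      exact congrFun h4 h
    have h6 := hθ α
    refine (rootSystem H).ne_zero α (eq_zero_of_add_eq_zero_of_mem_closure b hα'
      (add_mem h6 hα') ?_)
    rw [← h5]
    module
  · have h5 := hθ ⟨χ, by simpa using h4⟩
    have h6 : (rootSystem H).root ⟨χ, by simpa using h4⟩ =
      (rootSystem H).root α + (rootSystem H).root θ := hχ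
    rw [h6] at h5
    exact (rootSystem H).ne_zero α (eq_zero_of_add_eq_zero_of_mem_closure b hα' h5 (by module))

end ExceptionalE8

/-! ### Existence of the representation and minimality -/

section Existence

open LieModule LieAlgebra LieAlgebra.IsKilling Module

theorem isChevalley_basis {k L ι : Type*} [Field k] [LieRing L] [LieAlgebra k L]
    {H : LieSubalgebra k L} [Finite ι] (B : LieAlgebra.Basis ι H) : IsChevalley B.A B.h B.e B.f where
  lie_e_f i := (B.sl2 i).lie_e_f
  lie_e_f_ne := B.lie_e_f_ne
  lie_h_h := B.lie_h_h
  lie_h_e := B.lie_h_e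
  lie_h_f := B.lie_h_f

variable {k : Type u} [Field k] [IsAlgClosed k] [CharZero k]
  {L : Type v} [LieRing L] [LieAlgebra k L] [FiniteDimensional k L] [LieAlgebra.IsSimple k L]
  {H : LieSubalgebra k L} [H.IsCartanSubalgebra] {b : (rootSystem H).Base} {θ : H.root}

/-- The highest root is a highest weight of the adjoint representation. -/
theorem hasHighestWeightModule_adjoint (hθ : IsHighestRoot b θ) {r : ℕ} {e : Fin r ≃ b.support}
    (B : LieAlgebra.Basis (Fin r) H) (hh : ∀ i, B.h i = coroot (e i).1.1)
    (hBe : ∀ i, B.e i ∈ rootSpace H (e i).1.1) :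
    HasHighestWeightModule k B.A fun i ↦ (rootSystem H).pairingIn ℤ θ (e i) := by
  obtain ⟨v₀, hv₀, h0⟩ := Submodule.exists_mem_ne_zero_of_ne_bot
    (show (rootSpace H θ.1).toSubmodule ≠ ⊥ by simpa using θ.1.genWeightSpace_ne_bot)
  -- Coordinates move the adjoint module to the universe of `k`, where the module is required to
  -- live.
  let ε : L ≃ₗ[k] (Fin (finrank k L) → k) := (finBasis k L).equivFun
  have hε : ∀ x y : L, (ε.lieConj (LieAlgebra.ad k L x)) (ε y) = ε ⁅x, y⁆ := by
    intro x y
    simp [LinearEquiv.lieConj_apply, LinearEquiv.conj_apply]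
  refine ⟨Fin (finrank k L) → k, inferInstance, inferInstance, inferInstance, _, _, _, ε v₀,
    ((isChevalley_basis B).map (LieAlgebra.ad k L)).map ε.lieConj.toLieHom, by simpa using h0,
    fun i ↦ ?_, fun i ↦ ?_⟩
  · refine (hε (B.h i) v₀).trans ?_
    have h1 := lie_eq_smul_of_mem_rootSpace hv₀ (coroot (e i).1.1)
    have h2 : θ.1 (coroot (e i).1.1) = ((rootSystem H).pairingIn ℤ θ (e i) : k) := by
      rw [← eq_intCast (algebraMap ℤ k), RootPairing.algebraMap_pairingIn]
      rfl
    rw [hh, ← map_zsmul]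
    congr 1
    rw [← Int.cast_smul_eq_zsmul k, ← h2]
    exact h1
  · refine (hε (B.e i) v₀).trans ?_
    rw [lie_eq_zero_of_highest hθ (e i).2 (hBe i) hv₀, map_zero]

theorem hasHighestWeightModule_E8 (hθ : IsHighestRoot b θ) {e : Fin 8 ≃ b.support}
    (he : ∀ i j, b.cartanMatrix (e i) (e j) = CartanMatrix.E₈ i j)
    (B : LieAlgebra.Basis (Fin 8) H) (hA : ∀ i j, B.A i j = CartanMatrix.E₈ i j)
    (hh : ∀ i, B.h i = coroot (e i).1.1) (hBe : ∀ i, B.e i ∈ rootSpace H (e i).1.1) :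
    HasHighestWeightModule k CartanMatrix.E₈ (Pi.single 7 1) := by
  have h1 := hasHighestWeightModule_adjoint hθ B hh hBe
  obtain ⟨m, hm⟩ := exists_eq_pairingIn (P := rootSystem H) he isQuasiMinuscule_E8.reflected
    exists_codesE8_eq_row θ
  have h2 := eq_single_of_codesE8_nonneg m fun i ↦ by
    rw [hm]
    exact pairingIn_nonneg_of_highest hθ (e i).2
  rw [show B.A = CartanMatrix.E₈ from Matrix.ext hA, ← hm, h2] at h1
  exact h1

variable {T : SimpleType} {e : Fin T.rank ≃ b.support}

theorem exists_isIrreducibleWithHighestWeight_fundamentalWeight (hθ : IsHighestRoot b θ)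
    (he : ∀ i j, b.cartanMatrix (e i) (e j) = T.cartanMatrix i j)
    (B : LieAlgebra.Basis (Fin T.rank) H) (hA : ∀ i j, B.A i j = T.cartanMatrix i j)
    (hh : ∀ i, B.h i = coroot (e i).1.1) (hBe : ∀ i, B.e i ∈ rootSpace H (e i).1.1) :
    ∃ (V : Type u) (_ : AddCommGroup V) (_ : Module k V) (_ : FiniteDimensional k V)
      (ρ : L →ₗ⁅k⁆ sl k V),
      IsIrreducibleWithHighestWeight b ρ (fundamentalWeight b (e T.node)) := by
  have h1 : HasHighestWeightModule k B.A (Pi.single T.node 1) := by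
    rw [show B.A = T.cartanMatrix from Matrix.ext hA]
    by_cases hT : T = .E8
    · subst hT
      exact hasHighestWeightModule_E8 hθ he B hA hh hBe
    · exact SimpleType.hasHighestWeightModule k hT
  obtain ⟨V, _, _, _, h, e', f, v₀, hc, hv₀, hv₀h, hv₀e⟩ := h1
  have hA' : ∀ i j, B.A i j = b.cartanMatrix (e i) (e j) := fun i j ↦ (hA i j).trans (he i j).symm
  obtain ⟨φ, hφh, hφe, -⟩ := exists_lieHom_of_isChevalley B (fun n hn ↦
    eq_zero_of_sum_mul_cartanMatrix_nonpos b e n (by simpa only [hA'] using hn)) hc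
  let _ : LieRingModule L V := LieRingModule.compLieHom V φ
  have _ : LieModule k L V := LieModule.compLieHom V φ
  refine exists_isIrreducibleWithHighestWeight B hh hA' V hv₀ (fun x ↦ ?_) fun i ↦ ?_
  · change (φ (x : L)) v₀ = _
    have h2 : ((LinearMap.applyₗ v₀).comp φ.toLinearMap).comp H.toSubmodule.subtype =
        (fundamentalWeight b (e T.node)).smulRight v₀ := by
      refine LinearMap.ext_on_range (span_lieBasis_h' B) fun i ↦ ?_
      change (φ (B.h i)) v₀ = fundamentalWeight b (e T.node) (B.h' i) • v₀
      rw [hφh, hv₀h, fundamentalWeight_h' B hh, Int.cast_smul_eq_zsmul]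
    exact LinearMap.congr_fun h2 x
  · change (φ (B.e i)) v₀ = 0
    rw [hφe, hv₀e]

/-- The index is attained by the irreducible representation, which is nontrivial as its highest
weight is nonzero. It is a lower bound because a nonzero natural number is at least any of its
divisors. -/
theorem isMinimalDynkinIndex (hθ : IsHighestRoot b θ)
    (he : ∀ i j, b.cartanMatrix (e i) (e j) = T.cartanMatrix i j)
    (B : LieAlgebra.Basis (Fin T.rank) H) (hA : ∀ i j, B.A i j = T.cartanMatrix i j)
    (hh : ∀ i, B.h i = coroot (e i).1.1) (hBe : ∀ i, B.e i ∈ rootSpace H (e i).1.1) :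
    IsMinimalDynkinIndex θ T.minIndex := by
  constructor
  · obtain ⟨V, _, _, hV, ρ, hρ⟩ :=
      exists_isIrreducibleWithHighestWeight_fundamentalWeight hθ he B hA hh hBe
    have h1 := hasDynkinIndex_of_isIrreducibleWithHighestWeight hθ he B hA hh hBe ρ hρ
    refine ⟨V, _, _, hV, ρ, ?_, h1⟩
    rintro rfl
    obtain ⟨-, v₀, hv₀, hh₀, -⟩ := hρ
    have h2 := hh₀ (B.h' T.node)
    rw [fundamentalWeight_h' B hh] at h2
    simp at h2
    exact hv₀ h2.symm
  · rintro d ⟨V, _, _, _, ρ, hρ, hd⟩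
    let _ := lieRingModuleOfRep ρ
    obtain ⟨_, hρV⟩ := lieModuleOfRep ρ
    obtain ⟨d', -, hd', hdvd, hne⟩ := exists_nat_hasDynkinIndex_iff hθ he B hA hh ρ hρV
    have h1 : d = d' := Nat.cast_injective ((hd' _).1 hd)
    rw [h1]
    exact Nat.le_of_dvd (Nat.pos_of_ne_zero (hne hρ)) hdvd

end Existence

end DynkinIndex

theorem mainTheorem11 {k : Type u} [Field k] [IsAlgClosed k] [CharZero k]
    {L : Type v} [LieRing L] [LieAlgebra k L] [FiniteDimensional k L] [LieAlgebra.IsSimple k L]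
    (H : LieSubalgebra k L) [H.IsCartanSubalgebra]
    (b : (LieAlgebra.IsKilling.rootSystem H).Base)
    (θ : H.root) (hθ : DynkinIndex.IsHighestRoot b θ)
    (T : DynkinIndex.SimpleType) (e : Fin T.rank ≃ b.support)
    (he : ∀ i j, b.cartanMatrix (e i) (e j) = T.cartanMatrix i j) :
    DynkinIndex.IsMinimalDynkinIndex θ T.minIndex ∧
    (∃ (V : Type u) (_ : AddCommGroup V) (_ : Module k V) (_ : FiniteDimensional k V)
      (ρ : L →ₗ⁅k⁆ DynkinIndex.sl k V),
      DynkinIndex.IsIrreducibleWithHighestWeight b ρ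
        (DynkinIndex.fundamentalWeight b (e T.node))) ∧
    (∀ (V : Type w) [AddCommGroup V] [Module k V] [FiniteDimensional k V]
      (ρ : L →ₗ⁅k⁆ DynkinIndex.sl k V),
      DynkinIndex.IsIrreducibleWithHighestWeight b ρ
        (DynkinIndex.fundamentalWeight b (e T.node)) →
      DynkinIndex.HasDynkinIndex θ ρ (T.minIndex : k)) ∧
    (∀ (V : Type w) [AddCommGroup V] [Module k V] [FiniteDimensional k V]
      (ρ : L →ₗ⁅k⁆ DynkinIndex.sl k V),
      ∃ d : ℕ, (∀ c : k, DynkinIndex.HasDynkinIndex θ ρ c ↔ c = (d : k)) ∧ T.minIndex ∣ d) := by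
  obtain ⟨B, hBA, hh, hBe, -⟩ := DynkinIndex.exists_lieBasis b e
  have hA : ∀ i j, B.A i j = T.cartanMatrix i j := fun i j ↦ (hBA i j).trans (he i j)
  refine ⟨DynkinIndex.isMinimalDynkinIndex hθ he B hA hh hBe,
    DynkinIndex.exists_isIrreducibleWithHighestWeight_fundamentalWeight hθ he B hA hh hBe,
    fun V _ _ _ ρ hρ ↦
      DynkinIndex.hasDynkinIndex_of_isIrreducibleWithHighestWeight hθ he B hA hh hBe ρ hρ,
    fun V _ _ _ ρ ↦ ?_⟩
  let _ := DynkinIndex.lieRingModuleOfRep ρ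
  obtain ⟨_, hρV⟩ := DynkinIndex.lieModuleOfRep ρ
  obtain ⟨d, -, hd, hdvd, -⟩ := DynkinIndex.exists_nat_hasDynkinIndex_iff hθ he B hA hh ρ hρV
  exact ⟨d, hd, hdvd⟩
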